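/- **Conventions.** $M$ is a (possibly nonstandard) model of $P^-$, the axioms of the non-negative part of a discretely ordered commutative ring; subsets of $M$ are denoted by capital letters, and $A\oplus B=\{2a:a\in A\}\cup\{2b+1:b\in B\}$. A set is $\Sigma_n^A$ if it is definable in $M$ by a $\Sigma_n$ formula with number parameters from $M$ and the set parameter $A$; it is $\Delta_n^A$ if it and its complement are $\Sigma_n^A$. A set $D\subseteq M$ is *finite* if it is coded by the binary expansion of an element of $M$, and *regular* if $D\cap[0,m)$ is finite for every $m\in M$. The jump is $A'=\{e\in M:\Phi_e^A(e)\downarrow\}$, where $\Phi_e^A$ ($e\in M$) are the partial recursive functions with oracle $A$ in the sense of $M$ (computations are finite in the sense of $M$), and $A^{(n)}$ is the $n$-th iterate. For $X\subseteq M$, $M[X]$ is the second-order structure over $M$ whose sets form the closure of $\{X\}$ under $\oplus$ and $\Delta^0_1$ comprehension. For a family $\mathcal S$ of subsets of $M$, $(M,\mathcal S)\models \mathrm{I}\Sigma^0_n$ means the induction scheme for $\Sigma_n$ formulas with a set parameter from $\mathcal S$, and $(M,\mathcal S)\models \mathrm{B}\Sigma^0_n$ means $\mathrm{I}\Sigma^0_0$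 together with the bounding scheme $(\forall x<a)(\exists y)\varphi\rightarrow(\exists b)(\forall x<a)(\exists y<b)\varphi$ for such formulas $\varphi$; $M\models\mathrm{I}\Sigma_n$ is the case without set parameters. $\exp$ says that $x\mapsto 2^x$ is total. **Lemma.** Let $M\models P^-+\mathrm{I}\Sigma_1$ and let $A,C\subseteq M$ be such that $A'\oplus C$ is regular. Then there is $B\subseteq M$ such that $A'\oplus C$ and $(A\oplus B)'$ are $\Delta_1$ relative to each other and $(A\oplus B)'$ is regular; in particular $M[A\oplus B]\models\mathrm{I}\Sigma^0_1$, and every $\Sigma^0_1$ set of $M[A\oplus B]$ is regular. If furthermore $M[A'\oplus C]\models\mathrm{B}\Sigma^0_1$, then (for the same $B$) $M[A\oplus B]\models\mathrm{B}\Sigma^0_2$. **Proposition.** Let $n\ge 1$, let $M\models P^-+\exp$ and let $A,C\subseteq M$. 1. If $(M,\{A^{(n)}\oplus C\})\models\mathrm{I}\Sigma^0_0$ (in particular, if $M[A^{(n)}\oplus C]\models\mathrm{I}\Sigma^0_0$), then there is $B\subseteq M$ such that $A^{(n)}\oplus C$ and $(A\oplus B)^{(n)}$ are $\Delta_n$ relative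 to each other, $M[A\oplus B]\models\mathrm{I}\Sigma^0_n$, and every $\Sigma^0_n$ set of $M[A\oplus B]$ is regular. 2. If $M[A^{(n)}\oplus C]\models\mathrm{B}\Sigma^0_1$, then there is $B\subseteq M$ such that $A^{(n)}\oplus C$ and $(A\oplus B)^{(n)}$ are $\Delta_n$ relative to each other and $M[A\oplus B]\models\mathrm{B}\Sigma^0_{n+1}$. -/

import Mathlib

/-- Models of `P⁻`: the non-negative parts of discretely ordered commutative rings. The ring and
order axioms are those of `CommSemiring`, `LinearOrder` and `IsStrictOrderedRing`;
`CanonicallyOrderedAdd` says that `x ≤ y` iff `y = x + z` for some `z`. -/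
class PeanoMinus (M : Type*) [CommSemiring M] [LinearOrder M] : Prop
    extends IsStrictOrderedRing M, CanonicallyOrderedAdd M where
  one_le_of_pos : ∀ x : M, 0 < x → 1 ≤ x

namespace RevRec

universe u

/-! ### Formulas of arithmetic with one set variable, and the arithmetical hierarchy -/

/-- Function symbols of arithmetic. -/
inductive ArithFunc : ℕ → Type
  | zero : ArithFunc 0
  | one : ArithFunc 0
  | add : ArithFunc 2
  | mul : ArithFunc 2

/-- Relation symbols: `<`, and a unary predicate for membership in the set parameter. -/
inductive ArithRel : ℕ → Type
  | lt : ArithRel 2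
  | mem : ArithRel 1

/-- The language of arithmetic with one set variable. -/
def arith : FirstOrder.Language.{0, 0} := ⟨ArithFunc, ArithRel⟩

/-- The bounded quantification `∀ x < t, φ`, where `x` does not occur in `t`. -/
def ball {α : Type*} {k : ℕ} (t : arith.Term (α ⊕ Fin k))
    (φ : arith.BoundedFormula α (k + 1)) : arith.BoundedFormula α k :=
  ((FirstOrder.Language.BoundedFormula.rel (L := arith) ArithRel.lt
    ![FirstOrder.Language.Term.var (Sum.inr (Fin.last k)),
      t.relabel (Sum.map id Fin.castSucc)]).imp φ).all

/-- `Δ₀` (that is, `Σ₀`) formulas: all quantifiers are bounded. Conjunction, disjunction,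
negation and bounded existential quantification are expressed through `imp`, `falsum`, `ball`. -/
inductive IsDelta0 {α : Type*} : ∀ {k : ℕ}, arith.BoundedFormula α k → Prop
  | falsum {k : ℕ} : IsDelta0 (FirstOrder.Language.BoundedFormula.falsum : arith.BoundedFormula α k)
  | atomic {k : ℕ} {φ : arith.BoundedFormula α k} : φ.IsAtomic → IsDelta0 φ
  | imp {k : ℕ} {φ ψ : arith.BoundedFormula α k} :
      IsDelta0 φ → IsDelta0 ψ → IsDelta0 (φ.imp ψ)
  | ball {k : ℕ} (t : arith.Term (α ⊕ Fin k)) {φ : arith.BoundedFormula α (k + 1)} :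
      IsDelta0 φ → IsDelta0 (ball t φ)

/-- `Σₙ` formulas: `Σ₀ = Δ₀`, and a `Σₙ₊₁` formula is a block of existential quantifiers in
front of the negation of a `Σₙ` formula (that is, in front of a `Πₙ` formula). -/
inductive IsSigma {α : Type*} : ℕ → ∀ {k : ℕ}, arith.BoundedFormula α k → Prop
  | delta0 {k : ℕ} {φ : arith.BoundedFormula α k} : IsDelta0 φ → IsSigma 0 φ
  | not {n k : ℕ} {φ : arith.BoundedFormula α k} : IsSigma n φ → IsSigma (n + 1) φ.not
  | ex {n k : ℕ} {φ : arith.BoundedFormula α (k + 1)} :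
      IsSigma (n + 1) φ → IsSigma (n + 1) φ.ex

variable {M : Type u} [CommSemiring M] [LinearOrder M]

/-- The interpretation of the language in `M`, with the set `A` as value of the set variable. -/
@[reducible] def arithStructure (A : Set M) : arith.Structure M where
  funMap {_} f v :=
    match f, v with
    | ArithFunc.zero, _ => 0
    | ArithFunc.one, _ => 1
    | ArithFunc.add, v => v 0 + v 1
    | ArithFunc.mul, v => v 0 * v 1
  RelMap {_} r v :=
    match r, v with
    | ArithRel.lt, v => v 0 < v 1
    | ArithRel.mem, v => v 0 ∈ A

/-- The `k`-ary relation `R` is `Σₙ` definable from the set parameter `A` and number parameters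
from `M`. The free variables of the formula are named by the elements of `M` and interpreted by
themselves: they are the number parameters. -/
def SigmaRel (n : ℕ) (A : Set M) {k : ℕ} (R : (Fin k → M) → Prop) : Prop :=
  ∃ φ : arith.BoundedFormula M k, IsSigma n φ ∧
    ∀ v : Fin k → M,
      R v ↔ @FirstOrder.Language.BoundedFormula.Realize arith M (arithStructure A) M k φ id v

/-- `D` is a `Σₙ^A` set. -/
def SigmaSet (n : ℕ) (A D : Set M) : Prop :=
  SigmaRel n A (fun v : Fin 1 → M => v 0 ∈ D)

/-- `D` is a `Δₙ^A` set: both `D` and its complement are `Σₙ^A`. -/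
def DeltaSet (n : ℕ) (A D : Set M) : Prop :=
  SigmaSet n A D ∧ SigmaSet n A Dᶜ

/-! ### Second-order parts, induction and bounding -/

/-- The join `A ⊕ B`. -/
def join (A B : Set M) : Set M :=
  {x | (∃ a ∈ A, x = 2 * a) ∨ (∃ b ∈ B, x = 2 * b + 1)}

/-- The second-order part of `M[X]`: the closure of `{X}` under join and `Δ⁰₁` comprehension. -/
inductive Ext (X : Set M) : Set (Set M)
  | base : Ext X X
  | join {Y Z : Set M} : Ext X Y → Ext X Z → Ext X (join Y Z)
  | comprehension {Y Z : Set M} : Ext X Y → DeltaSet 1 Y Z → Ext X Z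

/-- `(M, S) ⊨ IΣ⁰ₙ`: the induction scheme for `Σₙ` formulas with one set parameter from `S`. -/
def ISigma (n : ℕ) (S : Set (Set M)) : Prop :=
  ∀ Y ∈ S, ∀ D : Set M, SigmaSet n Y D →
    0 ∈ D → (∀ x, x ∈ D → x + 1 ∈ D) → ∀ x, x ∈ D

/-- `(M, S) ⊨ BΣ⁰ₙ`: the bounding scheme for `Σₙ` formulas with one set parameter from `S`,
together, as usual, with induction for `Σ₀` formulas. -/
def BSigma (n : ℕ) (S : Set (Set M)) : Prop :=
  ISigma 0 S ∧
  ∀ Y ∈ S, ∀ R : M → M → Prop, SigmaRel n Y (fun v : Fin 2 → M => R (v 0) (v 1)) →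
    ∀ a : M, (∀ x < a, ∃ y, R x y) → ∃ b, ∀ x < a, ∃ y < b, R x y

/-! ### Exponentiation and finite sets in the sense of the model -/

/-- Gödel's beta function: `v` is the remainder of `c` modulo `1 + (i + 1) d`. -/
def Beta (c d i v : M) : Prop :=
  v < 1 + (i + 1) * d ∧ ∃ q, c = q * (1 + (i + 1) * d) + v

/-- `p = 2 ^ x` in `M`: there is a coded sequence with first entry `1`, each entry twice the one
before, and entry number `x` equal to `p`. -/
def IsPow2 (x p : M) : Prop :=
  ∃ c d, Beta c d 0 1 ∧ (∀ i < x, ∃ v, Beta c d i v ∧ Beta c d (i + 1) (2 * v)) ∧ Beta c d x p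

/-- The axiom `exp`: the function `x ↦ 2 ^ x` is total. -/
def Exp (M : Type u) [CommSemiring M] [LinearOrder M] : Prop :=
  ∀ x : M, ∃ p, IsPow2 x p

/-- The digit number `x` in the binary expansion of `c` is `1`. -/
def Bit (x c : M) : Prop :=
  ∃ p q r, IsPow2 x p ∧ r < p ∧ c = (2 * q + 1) * p + r

/-- `D` is finite in the sense of `M`: it is coded by the binary expansion of an element. -/
def MFinite (D : Set M) : Prop :=
  ∃ c, ∀ x, x ∈ D ↔ Bit x c

/-- `A` is regular: every initial segment `A ↾ n` is finite in the sense of `M`. -/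
def Regular (A : Set M) : Prop :=
  ∀ n, MFinite {x | x ∈ A ∧ x < n}

/-- `(M, S) ⊨ IΣ⁰ₙ` in the form: every `Σ⁰ₙ` set is regular. -/
def SigmaRegular (n : ℕ) (S : Set (Set M)) : Prop :=
  ∀ Y ∈ S, ∀ D : Set M, SigmaSet n Y D → Regular D

/-! ### Partial recursive functions with an oracle, and the jump -/

/-- A quadratic, injective pairing function. -/
def pair (a b : M) : M := (a + b) ^ 2 + a

/-- `Line s e x y` is the code of the statement "the function with index `e`, at the argument
`x`, has been found at stage `s` to have the value `y`". -/
def Line (s e x y : M) : M := pair s (pair e (pair x y))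

/-- The set `D` of lines contains the statement that `e` at `x` has the value `y`, with a stage
smaller than `s`. -/
def Before (D : Set M) (s e x y : M) : Prop :=
  ∃ t < s, Line t e x y ∈ D

/-- The line `(s, e, x, y)` follows from the lines with smaller stages in `D` by one of the clauses
that define the functions partial recursive in `A`: constants, identity, unpairing,
addition, multiplication, the characteristic functions of `<` and of `A`, pairing, composition,
and minimization. (Functions of several arguments are handled through pairing.) -/
inductive Justified (A D : Set M) (s : M) : M → M → M → Prop
  | const (k x : M) : Justified A D s (pair 0 k) x k
  | ident (x : M) : Justified A D s (pair 1 0) x x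
  | left (a b : M) : Justified A D s (pair 2 0) (pair a b) a
  | right (a b : M) : Justified A D s (pair 3 0) (pair a b) b
  | add (a b : M) : Justified A D s (pair 4 0) (pair a b) (a + b)
  | mul (a b : M) : Justified A D s (pair 5 0) (pair a b) (a * b)
  | less (a b : M) : a < b → Justified A D s (pair 6 0) (pair a b) 1
  | not_less (a b : M) : ¬ a < b → Justified A D s (pair 6 0) (pair a b) 0
  | oracle (x : M) : x ∈ A → Justified A D s (pair 7 0) x 1
  | not_oracle (x : M) : x ∉ A → Justified A D s (pair 7 0) x 0
  | pairing (f g x u v : M) : Before D s f x u → Before D s g x v →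
      Justified A D s (pair 8 (pair f g)) x (pair u v)
  | comp (f g x u y : M) : Before D s g x u → Before D s f u y →
      Justified A D s (pair 9 (pair f g)) x y
  | minim (f x y : M) : Before D s f (pair x y) 0 →
      (∀ z < y, ∃ v, v ≠ 0 ∧ Before D s f (pair x z) v) →
      Justified A D s (pair 10 f) x y

/-- `D` is a computation with oracle `A`: a set of lines, finite in the sense of `M`, each of
which is justified by lines with smaller stages. -/
def IsComputation (A D : Set M) : Prop :=
  MFinite D ∧ ∀ s e x y, Line s e x y ∈ D → Justified A D s e x y

/-- `Φ_e^A(x) = y`. The indices `e` range over all of `M`. -/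
def Computes (A : Set M) (e x y : M) : Prop :=
  ∃ D, IsComputation A D ∧ ∃ s, Line s e x y ∈ D

/-- The jump `A' = {e | Φ_e^A(e) ↓}`. -/
def jump (A : Set M) : Set M :=
  {e | ∃ y, Computes A e e y}

end RevRec

/-!
The set `B` is obtained by jump inversion in the style of Friedberg, with care for the induction that
each step consumes.

*Definability.* The classes of formulas of the statement are replaced by classes of predicates of
assignments `ℕ → M`: `D0 A` for `Δ₀`, `Sg A n` for `Σₙ`, `D1 A` for `Δ₁` in the set parameter `A`
(`sigmaSet_iff` makes the connection). Membership of a concrete predicate in such a class is found by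
instance search (`Dfn`). For models of elementary arithmetic there is also `Loc A`, the class of
predicates that are `Δ₀` in `A` on bounded assignments. It contains the graph of exponentiation, admits
induction as soon as `Δ₀` formulas with parameter `A` do, and yields codes of bounded sets
(`exists_code`); hence regularity of `A` and `Δ₀` induction relative to `A` amount to the same.

*Jumps.* If `Δ₀` induction relative to `A` holds, then for every `Σ₁` predicate in `A` there is a
polynomial that reduces it to `A'` (`Sg.exists_mem_jump`). The reason is that `Δ₀` predicates are
computed at indices where one finite computation, with stages that depend on the index only, serves all
arguments below a bound. So a quantifier is traded for a jump (`Sg.jump`), and `Δ₀` induction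
relative to `A'` gives `Σ₁` induction relative to `A`. Conversely, under `Σ₁` induction `A'` is `Σ₁`
in `A`.

*Inversion of one jump.* Assume `Δ₀` induction relative to `A' ⊕ C`. The set `B` is built by blocks: if
the part built so far has length `l`, append the rest of the first string (in the order of codes) that
decides, for all `e < l`, whether `e` belongs to the jump of `A ⊕ B`, and then append the first `l`
entries of `C`. A string that decides all these questions at once exists, since a maximal coded set of
numbers `e < l` can be forced into the jump (`exists_forces`). Finite parts of this construction are
coded by numbers, and whether a number codes one is `Δ₀` in `A' ⊕ C`. The largest length below a given
bound exists by induction, so lengths are unbounded (`exists_hist`). Thus `A' ⊕ C` computes the jump of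
`A ⊕ B`, which is even regular, because a single finite part decides an initial segment. In the other
direction, `A'` and `B` determine the ends of the blocks and with them `C` (`d1_coded`).

*Iteration.* The outermost of `n + 1` jumps is inverted relative to `A⁽ⁿ⁾`, which gives a target for
the remaining `n` jumps (`exists_iterate_jump_inversion`). As the comparison of jumps is by polynomials,
the final jump keeps `Δ₀` induction. Trading quantifiers for jumps then turns `Σₙ` sets of `M[A ⊕ B]`
into `Δ₀` sets, and `Σₙ₊₁` relations into `Σ₁` relations, relative to `(A ⊕ B)⁽ⁿ⁾`; this gives the
induction, regularity and bounding in `M[A ⊕ B]`. Finally, `Σ₁` induction implies the totality of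
exponentiation, by the Chinese remainder theorem for the moduli of the beta function (`ISigma.exp`).
-/

set_option linter.unusedSectionVars false

namespace RevRec

universe u

/-! ### Definable predicates without syntax -/

section

variable {M : Type u} [CommSemiring M] [LinearOrder M]

/-- The assignment that gives `x` to the variable `0` and shifts the values of `w`. -/
def push (x : M) (w : ℕ → M) : ℕ → M
  | 0 => x
  | i + 1 => w i

/-- Functions of an assignment that are given by terms, that is, polynomials. A class, so that
membership is found by instance search. -/
class inductive IsTerm : ((ℕ → M) → M) → Prop
  | var (i : ℕ) : IsTerm fun w => w i
  | const (a : M) : IsTerm fun _ => a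
  | add {s t : (ℕ → M) → M} : IsTerm s → IsTerm t → IsTerm fun w => s w + t w
  | mul {s t : (ℕ → M) → M} : IsTerm s → IsTerm t → IsTerm fun w => s w * t w

instance (i : ℕ) : IsTerm (fun w : ℕ → M => w i) := .var i
instance (a : M) : IsTerm (fun _ : ℕ → M => a) := .const a
instance {s t : (ℕ → M) → M} [hs : IsTerm s] [ht : IsTerm t] : IsTerm fun w => s w + t w :=
  .add hs ht
instance {s t : (ℕ → M) → M} [hs : IsTerm s] [ht : IsTerm t] : IsTerm fun w => s w * t w :=
  .mul hs ht

/-- Terms may be substituted for the variables of a term. -/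
theorem IsTerm.subst {t : (ℕ → M) → M} (ht : IsTerm t) (s : ℕ → (ℕ → M) → M)
    (hs : ∀ i, IsTerm (s i)) : IsTerm fun w => t fun i => s i w := by
  induction ht with
  | var i => exact hs i
  | const a => exact .const a
  | add _ _ h₁ h₂ => exact .add h₁ h₂
  | mul _ _ h₁ h₂ => exact .mul h₁ h₂

/-- The terms substituted for the variables when a substitution passes under a quantifier. -/
def liftSubst (s : ℕ → (ℕ → M) → M) : ℕ → (ℕ → M) → M
  | 0 => fun w => w 0
  | i + 1 => fun w => s i fun j => w (j + 1)

theorem isTerm_liftSubst {s : ℕ → (ℕ → M) → M} (hs : ∀ i, IsTerm (s i)) (i : ℕ) :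
    IsTerm (liftSubst s i) := by
  cases i with
  | zero => exact .var 0
  | succ i => exact (hs i).subst (fun j w => w (j + 1)) fun j => .var (j + 1)

theorem liftSubst_push (s : ℕ → (ℕ → M) → M) (x : M) (w : ℕ → M) :
    (fun i => liftSubst s i (push x w)) = push x fun i => s i w := by
  funext i
  cases i <;> rfl

/-- The predicates of an assignment that are defined by `Δ₀` formulas with set parameter `A` and
arbitrary number parameters. -/
inductive D0 (A : Set M) : ((ℕ → M) → Prop) → Prop
  | falsum : D0 A fun _ => False
  | lt {s t : (ℕ → M) → M} : IsTerm s → IsTerm t → D0 A fun w => s w < t w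
  | eq {s t : (ℕ → M) → M} : IsTerm s → IsTerm t → D0 A fun w => s w = t w
  | mem {t : (ℕ → M) → M} : IsTerm t → D0 A fun w => t w ∈ A
  | imp {P Q : (ℕ → M) → Prop} : D0 A P → D0 A Q → D0 A fun w => P w → Q w
  | ball {t : (ℕ → M) → M} {P : (ℕ → M) → Prop} : IsTerm t → D0 A P →
      D0 A fun w => ∀ x < t w, P (push x w)

/-- The predicates of an assignment that are defined by `Σₙ` formulas with set parameter `A`. -/
inductive Sg (A : Set M) : ℕ → ((ℕ → M) → Prop) → Prop
  | delta0 {P : (ℕ → M) → Prop} : D0 A P → Sg A 0 P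
  | not {n : ℕ} {P : (ℕ → M) → Prop} : Sg A n P → Sg A (n + 1) fun w => ¬ P w
  | ex {n : ℕ} {P : (ℕ → M) → Prop} : Sg A (n + 1) P → Sg A (n + 1) fun w => ∃ x, P (push x w)

theorem D0.subst {A : Set M} {P : (ℕ → M) → Prop} (hP : D0 A P) :
    ∀ {s : ℕ → (ℕ → M) → M}, (∀ i, IsTerm (s i)) → D0 A fun w => P fun i => s i w := by
  induction hP with
  | falsum => exact fun _ => .falsum
  | lt h₁ h₂ => exact fun hs => .lt (h₁.subst _ hs) (h₂.subst _ hs)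
  | eq h₁ h₂ => exact fun hs => .eq (h₁.subst _ hs) (h₂.subst _ hs)
  | mem h => exact fun hs => .mem (h.subst _ hs)
  | imp _ _ h₁ h₂ => exact fun hs => .imp (h₁ hs) (h₂ hs)
  | ball ht _ h =>
    intro s hs
    have := D0.ball (ht.subst _ hs) (h (isTerm_liftSubst hs))
    simp only [liftSubst_push] at this
    exact this

theorem Sg.subst {A : Set M} {n : ℕ} {P : (ℕ → M) → Prop} (hP : Sg A n P) :
    ∀ {s : ℕ → (ℕ → M) → M}, (∀ i, IsTerm (s i)) → Sg A n fun w => P fun i => s i w := by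
  induction hP with
  | delta0 h => exact fun hs => .delta0 (h.subst hs)
  | not _ h => exact fun hs => .not (h hs)
  | ex _ h =>
    intro s hs
    have := Sg.ex (h (isTerm_liftSubst hs))
    simp only [liftSubst_push] at this
    exact this

open FirstOrder.Language in
/-- Syntactic terms give polynomials. -/
theorem isTerm_realize (A : Set M) {k : ℕ} (t : arith.Term (M ⊕ Fin k)) :
    IsTerm fun w : ℕ → M =>
      @Term.realize arith M (arithStructure A) _ (Sum.elim id fun i : Fin k => w i) t := by
  induction t with
  | var i =>
    cases i with
    | inl a => exact .const a
    | inr i => exact .var i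
  | func f ts ih =>
    cases f with
    | zero => exact .const 0
    | one => exact .const 1
    | add => exact .add (ih 0) (ih 1)
    | mul => exact .mul (ih 0) (ih 1)

open FirstOrder.Language in
theorem realize_ball (A : Set M) {k : ℕ} (t : arith.Term (M ⊕ Fin k))
    (φ : arith.BoundedFormula M (k + 1)) (v : Fin k → M) :
    @BoundedFormula.Realize arith M (arithStructure A) M k (ball t φ) id v ↔
      ∀ x, x < @Term.realize arith M (arithStructure A) _ (Sum.elim id v) t →
        @BoundedFormula.Realize arith M (arithStructure A) M (k + 1) φ id (Fin.snoc v x) := by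
  let := arithStructure A
  have h (x : M) : Sum.elim id (Fin.snoc v x : Fin (k + 1) → M) ∘ Sum.map id Fin.castSucc
      = Sum.elim id v := by
    funext i
    cases i <;> simp
  simp only [ball, BoundedFormula.realize_all, BoundedFormula.realize_imp]
  refine forall_congr' fun x => ?_
  refine imp_congr ?_ Iff.rfl
  simp only [BoundedFormula.Realize]
  change (Term.realize _ (Term.var _) < Term.realize _ (Term.relabel _ _)) ↔ _
  rw [Term.realize_relabel, h]
  simp

/-- An assignment of the free variables, as an assignment of all variables, read under one more
quantifier. -/
theorem snoc_eq {k : ℕ} (w : ℕ → M) (x : M) :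
    (Fin.snoc (fun i : Fin k => w i) x : Fin (k + 1) → M) =
      fun i : Fin (k + 1) => if (i : ℕ) < k then push x w (i + 1) else push x w 0 := by
  funext i
  induction i using Fin.lastCases with
  | last => simp [push]
  | cast i => simp [push]

open FirstOrder.Language in
/-- A `Δ₀` formula defines a `Δ₀` predicate. The quantified variable comes last in Mathlib's
formulas and first in `push`; a substitution mediates. -/
theorem D0.of_isDelta0 {A : Set M} {k : ℕ} {φ : arith.BoundedFormula M k} (h : IsDelta0 φ) :
    D0 A fun w : ℕ → M => @BoundedFormula.Realize arith M (arithStructure A) M k φ id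
      fun i : Fin k => w i := by
  induction h with
  | falsum => exact .falsum
  | atomic h =>
    cases h with
    | equal t₁ t₂ => exact .eq (isTerm_realize A t₁) (isTerm_realize A t₂)
    | rel R ts =>
      cases R with
      | lt => exact .lt (isTerm_realize A (ts 0)) (isTerm_realize A (ts 1))
      | mem => exact .mem (isTerm_realize A (ts 0))
  | imp _ _ h₁ h₂ => exact .imp h₁ h₂
  | @ball k t φ _ h =>
    simp only [realize_ball, snoc_eq]
    exact .ball (isTerm_realize A t) (h.subst
      (s := fun i w => if i < k then w (i + 1) else w 0)
      fun i => by by_cases hi : i < k <;> simp only [hi, if_true, if_false] <;> infer_instance)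

open FirstOrder.Language in
theorem Sg.of_isSigma {A : Set M} {n k : ℕ} {φ : arith.BoundedFormula M k} (h : IsSigma n φ) :
    Sg A n fun w : ℕ → M => @BoundedFormula.Realize arith M (arithStructure A) M k φ id
      fun i : Fin k => w i := by
  induction h with
  | delta0 h => exact .delta0 (.of_isDelta0 h)
  | not _ h => exact .not h
  | @ex n k φ _ h =>
    let := arithStructure A
    simp only [BoundedFormula.realize_ex, snoc_eq]
    exact .ex (h.subst
      (s := fun i w => if i < k then w (i + 1) else w 0)
      fun i => by by_cases hi : i < k <;> simp only [hi, if_true, if_false] <;> infer_instance)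

open FirstOrder.Language in
theorem IsTerm.exists_term {t : (ℕ → M) → M} (ht : IsTerm t) (A : Set M) {k : ℕ}
    (σ : ℕ → M ⊕ Fin k) : ∃ T : arith.Term (M ⊕ Fin k), ∀ v : Fin k → M,
      @Term.realize arith M (arithStructure A) _ (Sum.elim id v) T =
        t fun i => Sum.elim id v (σ i) := by
  induction ht with
  | var i => exact ⟨.var (σ i), fun v => rfl⟩
  | const a => exact ⟨.var (.inl a), fun v => rfl⟩
  | add _ _ h₁ h₂ =>
    obtain ⟨T₁, h₁⟩ := h₁
    obtain ⟨T₂, h₂⟩ := h₂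
    refine ⟨Term.func (L := arith) ArithFunc.add ![T₁, T₂], fun v => ?_⟩
    simp only [← h₁, ← h₂]
    rfl
  | mul _ _ h₁ h₂ =>
    obtain ⟨T₁, h₁⟩ := h₁
    obtain ⟨T₂, h₂⟩ := h₂
    refine ⟨Term.func (L := arith) ArithFunc.mul ![T₁, T₂], fun v => ?_⟩
    simp only [← h₁, ← h₂]
    rfl

/-- The variable names under one more quantifier. -/
def liftName {k : ℕ} (σ : ℕ → M ⊕ Fin k) : ℕ → M ⊕ Fin (k + 1)
  | 0 => .inr (Fin.last k)
  | i + 1 => Sum.map id Fin.castSucc (σ i)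

theorem liftName_snoc {k : ℕ} (σ : ℕ → M ⊕ Fin k) (v : Fin k → M) (x : M) :
    (fun i => Sum.elim id (Fin.snoc v x : Fin (k + 1) → M) (liftName σ i)) =
      push x fun i => Sum.elim id v (σ i) := by
  funext i
  cases i with
  | zero => simp [liftName, push]
  | succ i =>
    simp only [liftName, push]
    cases σ i <;> simp

open FirstOrder.Language in
/-- A `Δ₀` predicate is defined by a formula, in which the variable `i` is named `σ i`. The names
`Sum.inl a` are the number parameters. -/
theorem D0.exists_formula {A : Set M} {P : (ℕ → M) → Prop} (hP : D0 A P) :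
    ∀ {k : ℕ} (σ : ℕ → M ⊕ Fin k), ∃ φ : arith.BoundedFormula M k, IsDelta0 φ ∧
      ∀ v : Fin k → M, @BoundedFormula.Realize arith M (arithStructure A) M k φ id v ↔
        P fun i => Sum.elim id v (σ i) := by
  let := arithStructure A
  induction hP with
  | falsum => exact fun σ => ⟨.falsum, .falsum, fun v => Iff.rfl⟩
  | lt h₁ h₂ =>
    intro k σ
    obtain ⟨T₁, h₁⟩ := h₁.exists_term A σ
    obtain ⟨T₂, h₂⟩ := h₂.exists_term A σ
    refine ⟨.rel (L := arith) ArithRel.lt ![T₁, T₂], .atomic (.rel _ _), fun v => ?_⟩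
    simp only [← h₁, ← h₂]
    rfl
  | eq h₁ h₂ =>
    intro k σ
    obtain ⟨T₁, h₁⟩ := h₁.exists_term A σ
    obtain ⟨T₂, h₂⟩ := h₂.exists_term A σ
    refine ⟨.equal T₁ T₂, .atomic (.equal _ _), fun v => ?_⟩
    simp only [← h₁, ← h₂]
    rfl
  | mem h =>
    intro k σ
    obtain ⟨T, h⟩ := h.exists_term A σ
    refine ⟨.rel (L := arith) ArithRel.mem ![T], .atomic (.rel _ _), fun v => ?_⟩
    simp only [← h]
    rfl
  | imp _ _ h₁ h₂ =>
    intro k σ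
    obtain ⟨φ, hφ, h₁⟩ := h₁ σ
    obtain ⟨ψ, hψ, h₂⟩ := h₂ σ
    exact ⟨φ.imp ψ, .imp hφ hψ, fun v => imp_congr (h₁ v) (h₂ v)⟩
  | ball ht _ h =>
    intro k σ
    obtain ⟨T, hT⟩ := ht.exists_term A σ
    obtain ⟨φ, hφ, h⟩ := h (liftName σ)
    refine ⟨RevRec.ball T φ, IsDelta0.ball T hφ, fun v => ?_⟩
    rw [realize_ball]
    refine forall_congr' fun x => imp_congr (by rw [hT]) ?_
    rw [h, liftName_snoc]

open FirstOrder.Language in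
theorem Sg.exists_formula {A : Set M} {n : ℕ} {P : (ℕ → M) → Prop} (hP : Sg A n P) :
    ∀ {k : ℕ} (σ : ℕ → M ⊕ Fin k), ∃ φ : arith.BoundedFormula M k, IsSigma n φ ∧
      ∀ v : Fin k → M, @BoundedFormula.Realize arith M (arithStructure A) M k φ id v ↔
        P fun i => Sum.elim id v (σ i) := by
  let := arithStructure A
  induction hP with
  | delta0 h =>
    intro k σ
    obtain ⟨φ, hφ, h⟩ := h.exists_formula σ
    exact ⟨φ, .delta0 hφ, h⟩
  | not _ h =>
    intro k σ
    obtain ⟨φ, hφ, h⟩ := h σ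
    exact ⟨φ.not, .not hφ, fun v => not_congr (h v)⟩
  | ex _ h =>
    intro k σ
    obtain ⟨φ, hφ, h⟩ := h (liftName σ)
    refine ⟨φ.ex, .ex hφ, fun v => ?_⟩
    rw [BoundedFormula.realize_ex]
    refine exists_congr fun x => ?_
    rw [h, liftName_snoc]

/-- A set is `Σₙ` iff membership of the variable `0` is a `Σₙ` predicate. -/
theorem sigmaSet_iff {n : ℕ} {A D : Set M} :
    SigmaSet n A D ↔ Sg A n fun w : ℕ → M => w 0 ∈ D := by
  constructor
  · rintro ⟨φ, hφ, h⟩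
    have := Sg.of_isSigma (A := A) hφ
    simp only [← h] at this
    exact this
  · intro h
    obtain ⟨φ, hφ, h⟩ := h.exists_formula (k := 1) fun _ => .inr 0
    exact ⟨φ, hφ, fun v => (h v).symm⟩

theorem Sg.of_sigmaRel {n : ℕ} {A : Set M} {R : M → M → Prop}
    (h : SigmaRel n A fun v : Fin 2 → M => R (v 0) (v 1)) :
    Sg A n fun w : ℕ → M => R (w 0) (w 1) := by
  obtain ⟨φ, hφ, h⟩ := h
  have := Sg.of_isSigma (A := A) hφ
  simp only [← h] at this
  exact this

theorem Sg.sigmaRel {n : ℕ} {A : Set M} {R : M → M → Prop}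
    (h : Sg A n fun w : ℕ → M => R (w 0) (w 1)) :
    SigmaRel n A fun v : Fin 2 → M => R (v 0) (v 1) := by
  obtain ⟨φ, hφ, h⟩ := h.exists_formula (k := 2) fun i => if i = 0 then .inr 0 else .inr 1
  refine ⟨φ, hφ, fun v => ?_⟩
  rw [h]
  simp

end

/-! ### Classes of predicates closed under bounded quantification -/

section

variable {M : Type u} [CommSemiring M] [LinearOrder M]

instance (priority := low) {t : (ℕ → M) → M} [ht : IsTerm t] (σ : ℕ → ℕ) :
    IsTerm fun w => t fun i => w (σ i) :=
  ht.subst (fun i w => w (σ i)) fun i => .var (σ i)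

/-- `P` belongs to the class `K` of predicates. A type class, so that definability of concrete
predicates is found by instance search. -/
class Dfn (K : ((ℕ → M) → Prop) → Prop) (P : (ℕ → M) → Prop) : Prop where
  out : K P

/-- `K` contains the atomic predicates of arithmetic and is closed under propositional connectives
and bounded quantification. -/
class Arith (K : ((ℕ → M) → Prop) → Prop) : Prop where
  falsum : K fun _ => False
  lt {s t : (ℕ → M) → M} : IsTerm s → IsTerm t → K fun w => s w < t w
  eq {s t : (ℕ → M) → M} : IsTerm s → IsTerm t → K fun w => s w = t w
  imp {P Q : (ℕ → M) → Prop} : K P → K Q → K fun w => P w → Q w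
  ball {t : (ℕ → M) → M} {P : (ℕ → M) → Prop} : IsTerm t → K P →
    K fun w => ∀ x < t w, P (push x w)

theorem Dfn.congr {K : ((ℕ → M) → Prop) → Prop} {P Q : (ℕ → M) → Prop} (h : Dfn K Q)
    (hPQ : ∀ w, P w ↔ Q w) : Dfn K P := by
  rwa [show P = Q from funext fun w => propext (hPQ w)]

/-- A class that contains membership in `A` contains everything that is `Δ₀` in `A`. -/
theorem D0.le {K : ((ℕ → M) → Prop) → Prop} [Arith K] {A : Set M}
    (hA : ∀ t : (ℕ → M) → M, IsTerm t → K fun w => t w ∈ A) {P : (ℕ → M) → Prop}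
    (hP : D0 A P) : K P := by
  induction hP with
  | falsum => exact Arith.falsum
  | lt h₁ h₂ => exact Arith.lt h₁ h₂
  | eq h₁ h₂ => exact Arith.eq h₁ h₂
  | mem h => exact hA _ h
  | imp _ _ h₁ h₂ => exact Arith.imp h₁ h₂
  | ball ht _ h => exact Arith.ball ht h

instance (A : Set M) : Arith (D0 A) := ⟨.falsum, .lt, .eq, .imp, .ball⟩

instance (A : Set M) {t : (ℕ → M) → M} [ht : IsTerm t] : Dfn (D0 A) fun w => t w ∈ A := ⟨.mem ht⟩

section

variable {K : ((ℕ → M) → Prop) → Prop} [hK : Arith K] {s t : (ℕ → M) → M} [hs : IsTerm s]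
  [ht : IsTerm t] {P Q : (ℕ → M) → Prop}

instance : Dfn K fun w => s w < t w := ⟨hK.lt hs ht⟩
instance : Dfn K fun w => s w = t w := ⟨hK.eq hs ht⟩
instance [hP : Dfn K P] [hQ : Dfn K Q] : Dfn K fun w => P w → Q w := ⟨hK.imp hP.out hQ.out⟩
instance [hP : Dfn K P] : Dfn K fun w => ¬ P w := ⟨hK.imp hP.out hK.falsum⟩
instance : Dfn K fun w => s w ≠ t w := inferInstanceAs (Dfn K fun w => ¬ s w = t w)
instance : Dfn K fun w => s w ≤ t w :=
  Dfn.congr (Q := fun w => ¬ t w < s w) inferInstance fun _ => not_lt.symm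
instance [hP : Dfn K P] [hQ : Dfn K Q] : Dfn K fun w => P w ∧ Q w :=
  Dfn.congr (Q := fun w => ¬ (P w → ¬ Q w)) inferInstance fun w => by tauto
instance [hP : Dfn K P] [hQ : Dfn K Q] : Dfn K fun w => P w ∨ Q w :=
  Dfn.congr (Q := fun w => ¬ P w → Q w) inferInstance fun w => by tauto
instance [hP : Dfn K P] [hQ : Dfn K Q] : Dfn K fun w => P w ↔ Q w :=
  Dfn.congr (Q := fun w => (P w → Q w) ∧ (Q w → P w)) inferInstance fun w => by tauto

instance instDfnBallLt {R : M → (ℕ → M) → Prop} [h : Dfn K fun w => R (w 0) fun i => w (i + 1)] :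
    Dfn K fun w => ∀ x < t w, R x w :=
  ⟨hK.ball ht h.out⟩
instance instDfnBexLt {R : M → (ℕ → M) → Prop} [h : Dfn K fun w => R (w 0) fun i => w (i + 1)] :
    Dfn K fun w => ∃ x < t w, R x w :=
  Dfn.congr (Q := fun w => ¬ ∀ x < t w, ¬ R x w) inferInstance fun w => by push Not; rfl

variable [PeanoMinus M]

theorem lt_succ_iff {a b : M} : a < b + 1 ↔ a ≤ b := by
  constructor
  · intro h
    by_contra hb
    obtain ⟨c, rfl⟩ := exists_add_of_le (not_le.1 hb).le
    have hc : 0 < c := by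
      by_contra hc
      rw [not_lt, nonpos_iff_eq_zero] at hc
      simp [hc] at hb
    have := PeanoMinus.one_le_of_pos c hc
    exact absurd h (not_lt.2 (add_le_add_right this b))
  · exact fun h => lt_of_le_of_lt h (lt_add_one b)

instance instDfnBallLe {R : M → (ℕ → M) → Prop} [h : Dfn K fun w => R (w 0) fun i => w (i + 1)] :
    Dfn K fun w => ∀ x ≤ t w, R x w :=
  Dfn.congr (Q := fun w => ∀ x < t w + 1, R x w) inferInstance fun w => by
    simp only [lt_succ_iff]
instance instDfnBexLe {R : M → (ℕ → M) → Prop} [h : Dfn K fun w => R (w 0) fun i => w (i + 1)] :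
    Dfn K fun w => ∃ x ≤ t w, R x w :=
  Dfn.congr (Q := fun w => ∃ x < t w + 1, R x w) inferInstance fun w => by
    simp only [lt_succ_iff]

end

variable [PeanoMinus M]

instance {s t : (ℕ → M) → M} [IsTerm s] [IsTerm t] : IsTerm fun w => pair (s w) (t w) := by
  unfold pair
  simp only [sq]
  infer_instance

instance {s e x y : (ℕ → M) → M} [IsTerm s] [IsTerm e] [IsTerm x] [IsTerm y] :
    IsTerm fun w => Line (s w) (e w) (x w) (y w) := by
  unfold Line
  infer_instance

theorem self_le_mul_of_pos {a b : M} (hb : 0 < b) : a ≤ a * b :=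
  le_mul_of_one_le_right zero_le (PeanoMinus.one_le_of_pos b hb)

theorem beta_iff {c d i v : M} : Beta c d i v ↔ v < 1 + (i + 1) * d ∧
    ∃ q ≤ c, c = q * (1 + (i + 1) * d) + v := by
  refine and_congr_right fun _ => ⟨?_, fun ⟨q, _, h⟩ => ⟨q, h⟩⟩
  rintro ⟨q, hq⟩
  refine ⟨q, ?_, hq⟩
  rw [hq]
  exact (self_le_mul_of_pos (by positivity)).trans (le_add_of_nonneg_right zero_le)

instance {K : ((ℕ → M) → Prop) → Prop} [Arith K] {c d i v : (ℕ → M) → M} [IsTerm c] [IsTerm d]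
    [IsTerm i] [IsTerm v] : Dfn K fun w => Beta (c w) (d w) (i w) (v w) := by
  simp only [beta_iff]
  infer_instance

/-- The pair `c`, `d` codes the powers of `2` with exponents up to `x`. -/
def PowSeq (c d x : M) : Prop :=
  Beta c d 0 1 ∧ ∀ i < x, ∃ v, Beta c d i v ∧ Beta c d (i + 1) (2 * v)

theorem Beta.le {c d i v : M} (h : Beta c d i v) : v ≤ c := by
  obtain ⟨_, q, hq⟩ := h
  rw [hq]
  exact le_add_of_nonneg_left zero_le

theorem powSeq_iff {c d x : M} : PowSeq c d x ↔
    Beta c d 0 1 ∧ ∀ i < x, ∃ v ≤ c, Beta c d i v ∧ Beta c d (i + 1) (2 * v) := by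
  refine and_congr_right fun _ => forall₂_congr fun i _ => ?_
  exact ⟨fun ⟨v, h⟩ => ⟨v, h.1.le, h⟩, fun ⟨v, _, h⟩ => ⟨v, h⟩⟩

instance {K : ((ℕ → M) → Prop) → Prop} [Arith K] {c d x : (ℕ → M) → M} [IsTerm c] [IsTerm d]
    [IsTerm x] : Dfn K fun w => PowSeq (c w) (d w) (x w) := by
  simp only [powSeq_iff]
  infer_instance

/-- The graph of exponentiation belongs to the class `K`. -/
class HasPow (K : ((ℕ → M) → Prop) → Prop) : Prop where
  out {x p : (ℕ → M) → M} : IsTerm x → IsTerm p → K fun w => IsPow2 (x w) (p w)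

instance {K : ((ℕ → M) → Prop) → Prop} [h : HasPow K] {x p : (ℕ → M) → M} [hx : IsTerm x]
    [hp : IsTerm p] : Dfn K fun w => IsPow2 (x w) (p w) :=
  ⟨h.out hx hp⟩

theorem bit_iff {x c : M} :
    Bit x c ↔ ∃ p ≤ c, ∃ q ≤ c, ∃ r ≤ c, IsPow2 x p ∧ r < p ∧ c = (2 * q + 1) * p + r := by
  constructor
  · rintro ⟨p, q, r, h, hr, rfl⟩
    have h1 : p ≤ (2 * q + 1) * p := by
      rw [mul_comm]; exact self_le_mul_of_pos (by positivity)
    have h2 : q ≤ (2 * q + 1) * p := by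
      have : q ≤ 2 * q + 1 := by
        have : q ≤ q * 2 := self_le_mul_of_pos (by norm_num)
        rw [mul_comm] at this
        exact this.trans (lt_add_one _).le
      exact this.trans (self_le_mul_of_pos (zero_le.trans_lt hr))
    exact ⟨p, h1.trans (le_add_of_nonneg_right zero_le), q,
      h2.trans (le_add_of_nonneg_right zero_le), r, le_add_of_nonneg_left zero_le, h, hr,
      rfl⟩
  · rintro ⟨p, _, q, _, r, _, h⟩
    exact ⟨p, q, r, h⟩

instance {K : ((ℕ → M) → Prop) → Prop} [Arith K] [HasPow K] {x c : (ℕ → M) → M} [IsTerm x]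
    [IsTerm c] : Dfn K fun w => Bit (x w) (c w) := by
  simp only [bit_iff]
  infer_instance

/-! ### Locally `Δ₀` predicates -/

/-- On assignments with bounded values, `P` coincides with a `Δ₀` predicate in the set parameter
`A`; the number parameters of the latter depend on the bound. -/
def Loc (A : Set M) (P : (ℕ → M) → Prop) : Prop :=
  ∀ N, ∃ Q, D0 A Q ∧ ∀ w : ℕ → M, (∀ i, w i < N) → (P w ↔ Q w)

theorem Loc.of_d0 {A : Set M} {P : (ℕ → M) → Prop} (h : D0 A P) : Loc A P :=
  fun _ => ⟨P, h, fun _ _ => Iff.rfl⟩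

theorem IsTerm.exists_bound {t : (ℕ → M) → M} (ht : IsTerm t) (N : M) :
    ∃ b, ∀ w : ℕ → M, (∀ i, w i < N) → t w ≤ b := by
  induction ht with
  | var i => exact ⟨N, fun w h => (h i).le⟩
  | const a => exact ⟨a, fun _ _ => le_rfl⟩
  | add _ _ h₁ h₂ =>
    obtain ⟨b₁, h₁⟩ := h₁
    obtain ⟨b₂, h₂⟩ := h₂
    exact ⟨b₁ + b₂, fun w h => add_le_add (h₁ w h) (h₂ w h)⟩
  | mul _ _ h₁ h₂ =>
    obtain ⟨b₁, h₁⟩ := h₁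
    obtain ⟨b₂, h₂⟩ := h₂
    exact ⟨b₁ * b₂, fun w h => mul_le_mul' (h₁ w h) (h₂ w h)⟩

/-- Values of terms are bounded on bounded assignments, so bounded quantifiers lead to assignments that
are bounded again. -/
instance (A : Set M) : Arith (Loc A) where
  falsum := .of_d0 .falsum
  lt h₁ h₂ := .of_d0 (.lt h₁ h₂)
  eq h₁ h₂ := .of_d0 (.eq h₁ h₂)
  imp h₁ h₂ := fun N => by
    obtain ⟨Q₁, hQ₁, h₁⟩ := h₁ N
    obtain ⟨Q₂, hQ₂, h₂⟩ := h₂ N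
    exact ⟨_, hQ₁.imp hQ₂, fun w hw => imp_congr (h₁ w hw) (h₂ w hw)⟩
  ball ht h := fun N => by
    obtain ⟨b, hb⟩ := ht.exists_bound N
    obtain ⟨Q, hQ, h⟩ := h (max b N)
    refine ⟨_, .ball ht hQ, fun w hw => forall₂_congr fun x hx => h _ fun i => ?_⟩
    cases i with
    | zero => exact lt_max_of_lt_left (hx.trans_le (hb w hw))
    | succ i => exact lt_max_of_lt_right (hw i)

instance {A : Set M} {t : (ℕ → M) → M} [ht : IsTerm t] : Dfn (Loc A) fun w => t w ∈ A :=
  ⟨.of_d0 (.mem ht)⟩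

/-- The induction axiom, for locally `Δ₀` properties. -/
theorem Loc.induction {A : Set M} (hA : ISigma 0 {A}) {P : M → Prop}
    (hP : Dfn (Loc A) fun w => P (w 0)) (h0 : P 0) (hs : ∀ x, P x → P (x + 1)) (x : M) : P x := by
  obtain ⟨Q, hQ, h⟩ := hP.out (x + 1)
  have h' (y : M) (hy : y ≤ x) : P y ↔ Q (push y fun _ => 0) := h (push y fun _ => 0) fun i => by
    cases i with
    | zero => exact lt_succ_iff.2 hy
    | succ i => exact lt_succ_iff.2 zero_le
  have hD : SigmaSet 0 A {y | y ≤ x → Q (push y fun _ => 0)} := by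
    rw [sigmaSet_iff]
    refine .delta0 (.imp ?_ ?_)
    · exact (inferInstance : Dfn (D0 A) fun w => w 0 ≤ x).out
    · have := hQ.subst (s := fun i w => if i = 0 then w 0 else 0) fun i => by
        by_cases hi : i = 0 <;> simp only [hi, if_true, if_false] <;> infer_instance
      convert this using 3 with w i
      funext i
      cases i <;> rfl
  refine (h' x le_rfl).2 (hA A rfl _ hD (fun h => (h' 0 h).1 h0) (fun y hy hyx => ?_) x le_rfl)
  exact (h' _ hyx).1 (hs y ((h' y ((lt_add_one y).le.trans hyx)).2 (hy ((lt_add_one y).le.trans hyx))))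

/-- The least number principle, for locally `Δ₀` properties. -/
theorem Loc.exists_least {A : Set M} (hA : ISigma 0 {A}) {P : M → Prop}
    (hP : Dfn (Loc A) fun w => P (w 0)) {a : M} (ha : P a) : ∃ x, P x ∧ ∀ y < x, ¬ P y := by
  by_contra! hcon
  have key := Loc.induction hA (P := fun x => ∀ y < x, ¬ P y) inferInstance
    (fun y hy => absurd hy (not_lt.2 zero_le)) fun x hx y hy hPy => by
      obtain ⟨z, hz, hPz⟩ := hcon y hPy
      exact hx z (hz.trans_le (lt_succ_iff.1 hy)) hPz
  exact key (a + 1) a (lt_add_one a) ha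

/-- Nonempty bounded locally `Δ₀` sets have a greatest element. -/
theorem Loc.exists_greatest {A : Set M} (hA : ISigma 0 {A}) {P : M → Prop}
    (hP : Dfn (Loc A) fun w => P (w 0)) {a b : M} (ha : P a) (hab : a ≤ b) :
    ∃ x ≤ b, P x ∧ ∀ y ≤ b, P y → y ≤ x := by
  obtain ⟨x, hx, hmin⟩ := Loc.exists_least hA (P := fun x => ∀ y ≤ b, P y → y ≤ x) inferInstance
    (a := b) fun y hy _ => hy
  have hax := hx a hab ha
  by_cases hPx : x ≤ b ∧ P x
  · exact ⟨x, hPx.1, hPx.2, hx⟩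
  · exfalso
    have h0 : 0 < x := by
      refine pos_of_ne_zero ?_
      rintro rfl
      rw [nonpos_iff_eq_zero] at hax
      exact hPx ⟨zero_le, hax ▸ ha⟩
    obtain ⟨y, rfl⟩ := exists_add_of_le (PeanoMinus.one_le_of_pos x h0)
    rw [add_comm] at *
    refine hmin y (lt_add_one y) fun z hz hPz => lt_succ_iff.1 (lt_of_le_of_ne (hx z hz hPz) ?_)
    rintro rfl
    exact hPx ⟨hz, hPz⟩

theorem ISigma.zero_of_d0 {A B : Set M} (hB : ISigma 0 {B}) (h : D0 B fun w => w 0 ∈ A) :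
    ISigma 0 {A} := by
  rintro _ rfl D hD
  rw [sigmaSet_iff] at hD
  refine hB B rfl D (sigmaSet_iff.2 ?_)
  cases hD with
  | delta0 hD =>
    refine .delta0 (hD.le fun t ht => ?_)
    exact h.subst (s := fun _ => t) fun _ => ht

theorem ISigma.zero_empty {A : Set M} (hA : ISigma 0 {A}) : ISigma 0 {(∅ : Set M)} :=
  hA.zero_of_d0 .falsum

end

/-! ### Powers of two and binary expansions -/

section

variable {M : Type u} [CommSemiring M] [LinearOrder M] [PeanoMinus M]

/-- `M` is a model of elementary arithmetic: `IΔ₀` and `exp`. -/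
class Elementary (M : Type u) [CommSemiring M] [LinearOrder M] : Prop where
  exp : Exp M
  induction : ISigma 0 {(∅ : Set M)}

theorem even_ne_odd (a b : M) : 2 * a ≠ 2 * b + 1 := by
  intro h
  rcases le_or_gt a b with hab | hab
  · exact absurd h (ne_of_lt (lt_succ_iff.2 (by gcongr)))
  · obtain ⟨k, rfl⟩ := exists_add_of_le hab.le
    have hk : 0 < k := pos_of_ne_zero (by rintro rfl; simp at hab)
    rw [mul_add] at h
    have h1 := add_left_cancel h
    have h2 := PeanoMinus.one_le_of_pos k hk
    have : (1 : M) < 2 * k := by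
      rw [two_mul]; exact lt_of_le_of_lt h2 (lt_add_of_pos_left _ hk)
    exact absurd h1.symm this.ne

theorem div_unique {b q q' r r' : M} (hr : r < b) (hr' : r' < b) (h : q * b + r = q' * b + r') :
    q = q' ∧ r = r' := by
  have aux {q q' r r' : M} (hr : r < b) (h : q * b + r = q' * b + r') : ¬ q < q' := by
    intro hq
    obtain ⟨k, rfl⟩ := exists_add_of_le hq.le
    have hk : 0 < k := pos_of_ne_zero (by rintro rfl; simp at hq)
    have h1 : b ≤ b * k := self_le_mul_of_pos hk
    rw [add_mul, add_assoc] at h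
    have h2 := add_left_cancel h
    have h3 : b ≤ r := by
      rw [h2, mul_comm k b]
      exact h1.trans (le_add_of_nonneg_right zero_le)
    exact absurd hr (not_lt.2 h3)
  have : q = q' := le_antisymm (not_lt.1 (aux hr' h.symm)) (not_lt.1 (aux hr h))
  subst this
  exact ⟨rfl, add_left_cancel h⟩

theorem exists_div (hM : ISigma 0 {(∅ : Set M)}) (a : M) {b : M} (hb : 0 < b) :
    ∃ q r, r < b ∧ a = q * b + r := by
  have key := Loc.induction hM (P := fun a => ∃ q ≤ a, ∃ r < b, a = q * b + r) inferInstance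
    ⟨0, le_rfl, 0, hb, by simp⟩ (by
      rintro a ⟨q, hq, r, hr, h⟩
      by_cases hr' : r + 1 < b
      · exact ⟨q, hq.trans (lt_add_one a).le, r + 1, hr', by rw [h]; ring⟩
      · have : r + 1 = b := le_antisymm
          (lt_succ_iff.1 (by simpa using hr)) (not_lt.1 hr')
        refine ⟨q + 1, by simpa using hq, 0, hb, ?_⟩
        rw [h, ← this]
        ring) a
  obtain ⟨q, _, r, h⟩ := key
  exact ⟨q, r, h⟩

theorem Beta.unique {c d i v v' : M} (h : Beta c d i v) (h' : Beta c d i v') : v = v' := by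
  obtain ⟨hv, q, hq⟩ := h
  obtain ⟨hv', q', hq'⟩ := h'
  exact (div_unique hv hv' (hq.symm.trans hq')).2

theorem PowSeq.mono {c d x y : M} (h : PowSeq c d x) (hy : y ≤ x) : PowSeq c d y :=
  ⟨h.1, fun i hi => h.2 i (hi.trans_le hy)⟩

theorem PowSeq.agree (hM : ISigma 0 {(∅ : Set M)}) {c d c' d' x : M} (h : PowSeq c d x)
    (h' : PowSeq c' d' x) {i : M} (hi : i ≤ x) : ∃ v, Beta c d i v ∧ Beta c' d' i v := by
  have key := Loc.induction hM (P := fun i => i ≤ x → ∃ v ≤ c, Beta c d i v ∧ Beta c' d' i v)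
    inferInstance (fun _ => ⟨1, h.1.le, h.1, h'.1⟩) (fun i ih hi => by
      have hi' := (lt_add_one i).trans_le hi
      obtain ⟨v, _, hv, hv'⟩ := ih hi'.le
      obtain ⟨u, hu, hu1⟩ := h.2 i hi'
      obtain ⟨u', hu', hu1'⟩ := h'.2 i hi'
      obtain rfl := hu.unique hv
      obtain rfl := hu'.unique hv'
      exact ⟨_, hu1.le, hu1, hu1'⟩) i hi
  obtain ⟨v, _, hv⟩ := key
  exact ⟨v, hv⟩

theorem isPow2_iff_powSeq {x p : M} : IsPow2 x p ↔ ∃ c d, PowSeq c d x ∧ Beta c d x p := by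
  simp only [IsPow2, PowSeq, and_assoc]

section

variable [hM : Elementary M]

theorem IsPow2.unique {x p p' : M} (h : IsPow2 x p) (h' : IsPow2 x p') : p = p' := by
  rw [isPow2_iff_powSeq] at h h'
  obtain ⟨c, d, h, hp⟩ := h
  obtain ⟨c', d', h', hp'⟩ := h'
  obtain ⟨v, hv, hv'⟩ := h.agree hM.induction h' le_rfl
  rw [hp.unique hv, hp'.unique hv']

/-- The power `2 ^ x` in a model of elementary arithmetic. -/
noncomputable def pow2 (x : M) : M := (hM.exp x).choose

theorem isPow2_pow2 (x : M) : IsPow2 x (pow2 x) := (hM.exp x).choose_spec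

theorem isPow2_iff {x p : M} : IsPow2 x p ↔ p = pow2 x :=
  ⟨fun h => h.unique (isPow2_pow2 x), fun h => h ▸ isPow2_pow2 x⟩

/-- One pair of numbers codes all powers with exponents below a bound. -/
theorem exists_powCode (N : M) : ∃ c d : M, ∀ x ≤ N, ∀ p, Beta c d x p ↔ p = pow2 x := by
  obtain ⟨c, d, h, _⟩ := isPow2_iff_powSeq.1 (isPow2_pow2 N)
  refine ⟨c, d, fun x hx p => ?_⟩
  obtain ⟨v, hv, _⟩ := h.agree hM.induction h hx
  have : v = pow2 x := isPow2_iff.1 (isPow2_iff_powSeq.2 ⟨c, d, h.mono hx, hv⟩)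
  exact ⟨fun hp => (hp.unique hv).trans this, fun hp => (hp.trans this.symm) ▸ hv⟩

/-- A predicate that is locally equal to locally `Δ₀` predicates is locally `Δ₀`. -/
theorem Loc.of_local {A : Set M} {P : (ℕ → M) → Prop}
    (h : ∀ N, ∃ Q, Dfn (Loc A) Q ∧ ∀ w : ℕ → M, (∀ i, w i < N) → (P w ↔ Q w)) :
    Dfn (Loc A) P := by
  refine ⟨fun N => ?_⟩
  obtain ⟨Q, hQ, h⟩ := h N
  obtain ⟨Q', hQ', h'⟩ := hQ.out N
  exact ⟨Q', hQ', fun w hw => (h w hw).trans (h' w hw)⟩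

instance (A : Set M) : HasPow (Loc A) where
  out {x p} hx hp := by
    refine (Loc.of_local fun N => ?_).out
    obtain ⟨b, hb⟩ := hx.exists_bound N
    obtain ⟨c, d, h⟩ := exists_powCode b
    exact ⟨fun w => Beta c d (x w) (p w), inferInstance, fun w hw =>
      isPow2_iff.trans (h _ (hb w hw) _).symm⟩

theorem Loc.dfn_pow {A : Set M} {R : M → (ℕ → M) → Prop} {t : (ℕ → M) → M} [ht : IsTerm t]
    [Dfn (Loc A) fun w => R (w 0) fun i => w (i + 1)] :
    Dfn (Loc A) fun w => R (pow2 (t w)) w := by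
  refine Loc.of_local fun N => ?_
  obtain ⟨b, hb⟩ := ht.exists_bound N
  obtain ⟨c, d, h⟩ := exists_powCode b
  refine ⟨fun w => ∃ p ≤ c, Beta c d (t w) p ∧ R p w, inferInstance, fun w hw => ?_⟩
  simp only [h _ (hb w hw)]
  constructor
  · exact fun hR => ⟨_, ((h _ (hb w hw) _).2 rfl).le, rfl, hR⟩
  · rintro ⟨_, _, rfl, hR⟩
    exact hR

theorem pow2_zero : pow2 (0 : M) = 1 := by
  obtain ⟨c, d, h, h'⟩ := isPow2_iff_powSeq.1 (isPow2_pow2 (0 : M))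
  exact h'.unique h.1

theorem pow2_succ (x : M) : pow2 (x + 1) = 2 * pow2 x := by
  obtain ⟨c, d, h, h'⟩ := isPow2_iff_powSeq.1 (isPow2_pow2 (x + 1))
  obtain ⟨v, hv, hv'⟩ := h.2 x (lt_add_one x)
  have := isPow2_iff.1 (isPow2_iff_powSeq.2 ⟨c, d, h.mono (lt_add_one x).le, hv⟩)
  rw [← this]
  exact h'.unique hv'

theorem lt_pow2 (x : M) : x < pow2 x := by
  have := Loc.induction hM.induction (P := fun x => ¬ ∃ p ≤ x, IsPow2 x p) inferInstance
    (by simp [isPow2_iff, pow2_zero]) (fun x hx => by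
      simp only [isPow2_iff, exists_eq_right, not_le] at hx ⊢
      rw [pow2_succ, two_mul]
      have : 1 ≤ pow2 x := PeanoMinus.one_le_of_pos _ (zero_le.trans_lt hx)
      exact add_lt_add_of_lt_of_le hx this) x
  simpa [isPow2_iff] using this

theorem pow2_pos (x : M) : 0 < pow2 x := zero_le.trans_lt (lt_pow2 x)

/-- Powers with larger exponents are even multiples of powers with smaller ones. -/
theorem exists_pow2_eq {x y : M} (h : x < y) : ∃ k, 0 < k ∧ pow2 y = 2 * pow2 x * k := by
  have key := Loc.induction hM.induction
    (P := fun y => x < y → ∃ k ≤ pow2 y, 0 < k ∧ pow2 y = 2 * pow2 x * k)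
    (Loc.dfn_pow (R := fun p w => x < w 0 → ∃ k ≤ p, 0 < k ∧ p = 2 * pow2 x * k))
    (fun h => absurd h (not_lt.2 zero_le)) (fun y ih hy => by
      rcases (lt_succ_iff.1 hy).lt_or_eq with hy | rfl
      · obtain ⟨k, hk, hk0, h⟩ := ih hy
        refine ⟨2 * k, ?_, by positivity, ?_⟩
        · rw [pow2_succ]; gcongr
        · rw [pow2_succ, h]; ring
      · exact ⟨1, PeanoMinus.one_le_of_pos _ (pow2_pos _), one_pos, by rw [pow2_succ, mul_one]⟩) y h
  obtain ⟨k, _, h⟩ := key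
  exact ⟨k, h⟩

theorem pow2_lt_pow2 {x y : M} (h : x < y) : pow2 x < pow2 y := by
  obtain ⟨k, hk, h⟩ := exists_pow2_eq h
  rw [h]
  calc pow2 x < 2 * pow2 x := by rw [two_mul]; exact lt_add_of_pos_left _ (pow2_pos x)
    _ ≤ 2 * pow2 x * k := self_le_mul_of_pos hk

theorem bit_iff_pow2 {x c : M} : Bit x c ↔ ∃ q r, r < pow2 x ∧ c = (2 * q + 1) * pow2 x + r := by
  simp only [Bit, isPow2_iff]
  constructor
  · rintro ⟨_, q, r, rfl, h⟩
    exact ⟨q, r, h⟩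
  · rintro ⟨q, r, h⟩
    exact ⟨_, q, r, rfl, h⟩

theorem Bit.pow2_le {x c : M} (h : Bit x c) : pow2 x ≤ c := by
  obtain ⟨q, r, _, rfl⟩ := bit_iff_pow2.1 h
  refine le_trans ?_ (le_add_of_nonneg_right zero_le)
  rw [mul_comm]
  exact self_le_mul_of_pos (by positivity)

theorem Bit.lt {x c : M} (h : Bit x c) : x < c := (lt_pow2 x).trans_le h.pow2_le

theorem Bit.lt_of_lt_pow2 {x c n : M} (h : Bit x c) (hc : c < pow2 n) : x < n := by
  by_contra hx
  rcases (not_lt.1 hx).lt_or_eq with hx | rfl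
  · exact absurd (h.pow2_le.trans_lt hc) (not_lt.2 (pow2_lt_pow2 hx).le)
  · exact absurd (h.pow2_le.trans_lt hc) (lt_irrefl _)

theorem bit_zero (x : M) : ¬ Bit x 0 := fun h => absurd h.lt (not_lt.2 zero_le)

theorem bit_add_mul {x c k : M} : Bit x (c + 2 * pow2 x * k) ↔ Bit x c := by
  constructor
  · intro h
    obtain ⟨q, r, hr, h⟩ := bit_iff_pow2.1 h
    obtain ⟨a, r', hr', hc⟩ := exists_div hM.induction c (pow2_pos x)
    obtain ⟨b, e, he, ha⟩ := exists_div hM.induction a (two_pos (α := M))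
    have h1 := div_unique hr' hr (q := a + 2 * k) (q' := 2 * q + 1)
      (by rw [← h, hc]; ring)
    rcases lt_succ_iff.1 ((one_add_one_eq_two (R := M)).symm ▸ he) |>.lt_or_eq with h0 | rfl
    · have : e = 0 := nonpos_iff_eq_zero.1 (lt_succ_iff.1 ((zero_add (1 : M)).symm ▸ h0))
      refine absurd ?_ (even_ne_odd (b + k) q)
      rw [← h1.1, ha, this]
      ring
    · exact bit_iff_pow2.2 ⟨b, r', hr', by rw [hc, ha]; ring⟩
  · intro h
    obtain ⟨q, r, hr, h⟩ := bit_iff_pow2.1 h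
    exact bit_iff_pow2.2 ⟨q + k, r, hr, by rw [h]; ring⟩

/-- Bounded comprehension: a bounded part of a locally `Δ₀` class is coded by a number. -/
theorem exists_code {A : Set M} (hA : ISigma 0 {A}) {P : M → Prop}
    (hP : Dfn (Loc A) fun w => P (w 0)) (N : M) :
    ∃ c < pow2 N, ∀ x, Bit x c ↔ x < N ∧ P x := by
  have hP1 : Dfn (Loc A) fun w => P (w 0) := hP
  obtain ⟨c, hc, h⟩ := Loc.induction hA
    (P := fun n => ∃ c < pow2 n, ∀ x < n, Bit x c ↔ P x)
    (Loc.dfn_pow (R := fun p w => ∃ c < p, ∀ x < w 0, Bit x c ↔ P x))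
    ⟨0, pow2_pos 0, fun x hx => absurd hx (not_lt.2 zero_le)⟩ (by
      rintro n ⟨c, hc, h⟩
      by_cases hn : P n
      · refine ⟨c + pow2 n, by rw [pow2_succ, two_mul]; gcongr, fun x hx => ?_⟩
        rcases (lt_succ_iff.1 hx).lt_or_eq with hx | rfl
        · obtain ⟨k, _, hk⟩ := exists_pow2_eq hx
          rw [hk, bit_add_mul, h x hx]
        · exact iff_of_true (bit_iff_pow2.2 ⟨0, c, hc, by ring⟩) hn
      · refine ⟨c, hc.trans (pow2_lt_pow2 (lt_add_one n)), fun x hx => ?_⟩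
        rcases (lt_succ_iff.1 hx).lt_or_eq with hx | rfl
        · exact h x hx
        · exact iff_of_false (fun hb => lt_irrefl _ (hb.lt_of_lt_pow2 hc)) hn) N
  exact ⟨c, hc, fun x => ⟨fun hb => ⟨hb.lt_of_lt_pow2 hc, (h x (hb.lt_of_lt_pow2 hc)).1 hb⟩,
    fun hx => (h x hx.1).2 hx.2⟩⟩

theorem mfinite_of_loc {A : Set M} (hA : ISigma 0 {A}) {P : M → Prop}
    (hP : Dfn (Loc A) fun w => P (w 0)) {N : M} (hN : ∀ x, P x → x < N) : MFinite {x | P x} := by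
  obtain ⟨c, _, h⟩ := exists_code hA hP N
  exact ⟨c, fun x => ⟨fun hx => (h x).2 ⟨hN x hx, hx⟩, fun hx => ((h x).1 hx).2⟩⟩

theorem MFinite.exists_bound {D : Set M} (h : MFinite D) : ∃ N, ∀ x ∈ D, x < N := by
  obtain ⟨c, hc⟩ := h
  exact ⟨c, fun x hx => ((hc x).1 hx).lt⟩

theorem MFinite.loc {D : Set M} (h : MFinite D) (A : Set M) {t : (ℕ → M) → M} [IsTerm t] :
    Dfn (Loc A) fun w => t w ∈ D := by
  obtain ⟨c, hc⟩ := h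
  simp only [hc]
  infer_instance

theorem MFinite.union {D E : Set M} (hD : MFinite D) (hE : MFinite E) : MFinite (D ∪ E) := by
  obtain ⟨N, hN⟩ := hD.exists_bound
  obtain ⟨N', hN'⟩ := hE.exists_bound
  have := hD.loc (∅ : Set M) (t := fun w => w 0)
  have := hE.loc (∅ : Set M) (t := fun w => w 0)
  refine mfinite_of_loc hM.induction (P := fun x => x ∈ D ∨ x ∈ E) inferInstance (N := max N N') ?_
  rintro x (hx | hx)
  · exact lt_max_of_lt_left (hN x hx)
  · exact lt_max_of_lt_right (hN' x hx)

theorem MFinite.singleton (a : M) : MFinite {a} :=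
  mfinite_of_loc hM.induction (P := fun x => x = a) inferInstance (N := a + 1)
    fun _ hx => hx ▸ lt_add_one a

theorem Regular.of_loc {A D : Set M} (hA : ISigma 0 {A}) (hD : Dfn (Loc A) fun w => w 0 ∈ D) :
    Regular D := fun n =>
  mfinite_of_loc hA (P := fun x => x ∈ D ∧ x < n) inferInstance fun _ hx => hx.2

/-- Over elementary arithmetic, induction for `Δ₀` formulas with a regular set parameter holds. -/
theorem Regular.iSigma {A : Set M} (h : Regular A) : ISigma 0 {A} := by
  have hloc (t : (ℕ → M) → M) (ht : IsTerm t) : Loc ∅ fun w => t w ∈ A := by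
    refine (Loc.of_local fun N => ?_).out
    obtain ⟨b, hb⟩ := ht.exists_bound N
    refine ⟨_, (h (b + 1)).loc ∅ (t := t), fun w hw => ?_⟩
    exact ⟨fun h => ⟨h, lt_succ_iff.2 (hb w hw)⟩, fun h => h.1⟩
  rintro _ rfl D hD h0 hs x
  rw [sigmaSet_iff] at hD
  cases hD with
  | delta0 hD => exact Loc.induction hM.induction ⟨hD.le hloc⟩ h0 hs x

end

end

/-! ### Pairs and computations -/

section

variable {M : Type u} [CommSemiring M] [LinearOrder M] [PeanoMinus M]

theorem pair_inj {a b a' b' : M} : pair a b = pair a' b' ↔ a = a' ∧ b = b' := by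
  refine ⟨fun h => ?_, fun h => by rw [h.1, h.2]⟩
  have aux {a b a' b' : M} (h : pair a b = pair a' b') : ¬ a + b < a' + b' := by
    intro hlt
    have h1 : a + b + 1 ≤ a' + b' := by
      rwa [← lt_succ_iff, add_lt_add_iff_right]
    have h2 : pair a b < (a + b + 1) ^ 2 := by
      have : (a + b + 1) ^ 2 = (a + b) ^ 2 + a + (a + (b + b) + 1) := by ring
      rw [this, pair]
      exact lt_add_of_pos_right _ (zero_le.trans_lt (lt_add_one _))
    have h3 : (a + b + 1) ^ 2 ≤ pair a' b' :=
      (pow_le_pow_left₀ zero_le h1 2).trans (le_add_of_nonneg_right zero_le)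
    exact absurd h (h2.trans_le h3).ne
  have hs : a + b = a' + b' := le_antisymm (not_lt.1 (aux h.symm)) (not_lt.1 (aux h))
  have ha : a = a' := by
    rw [pair, pair, hs] at h
    exact add_left_cancel h
  subst ha
  exact ⟨rfl, add_left_cancel hs⟩

theorem self_le_sq (a : M) : a ≤ a ^ 2 := by
  rcases (zero_le (a := a)).eq_or_lt with rfl | h
  · exact zero_le
  · rw [sq]; exact self_le_mul_of_pos h

theorem left_le_pair (a b : M) : a ≤ pair a b := le_add_of_nonneg_left zero_le

theorem right_le_pair (a b : M) : b ≤ pair a b :=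
  (le_add_of_nonneg_left zero_le).trans ((self_le_sq (a + b)).trans (le_add_of_nonneg_right zero_le))

theorem pair_le_pair {a b a' b' : M} (ha : a ≤ a') (hb : b ≤ b') : pair a b ≤ pair a' b' :=
  add_le_add (pow_le_pow_left₀ zero_le (add_le_add ha hb) 2) ha

theorem line_inj {s e x y s' e' x' y' : M} :
    Line s e x y = Line s' e' x' y' ↔ s = s' ∧ e = e' ∧ x = x' ∧ y = y' := by
  simp only [Line, pair_inj]

theorem le_line (s e x y : M) :
    s ≤ Line s e x y ∧ e ≤ Line s e x y ∧ x ≤ Line s e x y ∧ y ≤ Line s e x y := by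
  have h1 := right_le_pair s (pair e (pair x y))
  have h2 := (right_le_pair e (pair x y)).trans h1
  exact ⟨left_le_pair _ _, (left_le_pair _ _).trans h1, (left_le_pair _ _).trans h2,
    (right_le_pair _ _).trans h2⟩

theorem justified_iff {A D : Set M} {s e x y : M} : Justified A D s e x y ↔
    e = pair 0 y ∨ (e = pair 1 0 ∧ y = x) ∨
    (e = pair 2 0 ∧ ∃ b ≤ x, x = pair y b) ∨ (e = pair 3 0 ∧ ∃ a ≤ x, x = pair a y) ∨
    (e = pair 4 0 ∧ ∃ a ≤ x, ∃ b ≤ x, x = pair a b ∧ y = a + b) ∨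
    (e = pair 5 0 ∧ ∃ a ≤ x, ∃ b ≤ x, x = pair a b ∧ y = a * b) ∨
    (e = pair 6 0 ∧ ∃ a ≤ x, ∃ b ≤ x, x = pair a b ∧ (a < b ∧ y = 1 ∨ ¬ a < b ∧ y = 0)) ∨
    (e = pair 7 0 ∧ (x ∈ A ∧ y = 1 ∨ x ∉ A ∧ y = 0)) ∨
    (∃ f ≤ e, ∃ g ≤ e, e = pair 8 (pair f g) ∧
      ∃ u ≤ y, ∃ v ≤ y, y = pair u v ∧ Before D s f x u ∧ Before D s g x v) ∨
    (∃ f ≤ e, ∃ g ≤ e, e = pair 9 (pair f g) ∧ ∃ u, Before D s g x u ∧ Before D s f u y) ∨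
    (∃ f ≤ e, e = pair 10 f ∧ Before D s f (pair x y) 0 ∧
      ∀ z < y, ∃ v, v ≠ 0 ∧ Before D s f (pair x z) v) := by
  constructor
  · intro h
    cases h with
    | const k x => exact Or.inl rfl
    | ident x => simp
    | left a b => exact Or.inr (Or.inr (Or.inl ⟨rfl, b, right_le_pair _ _, rfl⟩))
    | right a b => exact Or.inr (Or.inr (Or.inr (Or.inl ⟨rfl, a, left_le_pair _ _, rfl⟩)))
    | add a b =>
      exact Or.inr (Or.inr (Or.inr (Or.inr (Or.inl
        ⟨rfl, a, left_le_pair _ _, b, right_le_pair _ _, rfl, rfl⟩))))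
    | mul a b =>
      exact Or.inr (Or.inr (Or.inr (Or.inr (Or.inr (Or.inl
        ⟨rfl, a, left_le_pair _ _, b, right_le_pair _ _, rfl, rfl⟩)))))
    | less a b h =>
      exact Or.inr (Or.inr (Or.inr (Or.inr (Or.inr (Or.inr (Or.inl
        ⟨rfl, a, left_le_pair _ _, b, right_le_pair _ _, rfl, Or.inl ⟨h, rfl⟩⟩))))))
    | not_less a b h =>
      exact Or.inr (Or.inr (Or.inr (Or.inr (Or.inr (Or.inr (Or.inl
        ⟨rfl, a, left_le_pair _ _, b, right_le_pair _ _, rfl, Or.inr ⟨h, rfl⟩⟩))))))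
    | oracle x h =>
      exact Or.inr (Or.inr (Or.inr (Or.inr (Or.inr (Or.inr (Or.inr (Or.inl
        ⟨rfl, Or.inl ⟨h, rfl⟩⟩)))))))
    | not_oracle x h =>
      exact Or.inr (Or.inr (Or.inr (Or.inr (Or.inr (Or.inr (Or.inr (Or.inl
        ⟨rfl, Or.inr ⟨h, rfl⟩⟩)))))))
    | pairing f g x u v h₁ h₂ =>
      exact Or.inr (Or.inr (Or.inr (Or.inr (Or.inr (Or.inr (Or.inr (Or.inr (Or.inl
        ⟨f, (left_le_pair _ _).trans (right_le_pair _ _), g,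
          (right_le_pair _ _).trans (right_le_pair _ _), rfl, u, left_le_pair _ _, v,
          right_le_pair _ _, rfl, h₁, h₂⟩))))))))
    | comp f g x u y h₁ h₂ =>
      exact Or.inr (Or.inr (Or.inr (Or.inr (Or.inr (Or.inr (Or.inr (Or.inr (Or.inr (Or.inl
        ⟨f, (left_le_pair _ _).trans (right_le_pair _ _), g,
          (right_le_pair _ _).trans (right_le_pair _ _), rfl, u, h₁, h₂⟩)))))))))
    | minim f x y h₁ h₂ =>
      exact Or.inr (Or.inr (Or.inr (Or.inr (Or.inr (Or.inr (Or.inr (Or.inr (Or.inr (Or.inr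
        ⟨f, right_le_pair _ _, rfl, h₁, h₂⟩)))))))))
  · rintro (rfl | ⟨rfl, rfl⟩ | ⟨rfl, b, -, rfl⟩ | ⟨rfl, a, -, rfl⟩ | ⟨rfl, a, -, b, -, rfl, rfl⟩ |
      ⟨rfl, a, -, b, -, rfl, rfl⟩ | ⟨rfl, a, -, b, -, rfl, ⟨h, rfl⟩ | ⟨h, rfl⟩⟩ |
      ⟨rfl, ⟨h, rfl⟩ | ⟨h, rfl⟩⟩ | ⟨f, -, g, -, rfl, u, -, v, -, rfl, h₁, h₂⟩ |
      ⟨f, -, g, -, rfl, u, h₁, h₂⟩ | ⟨f, -, rfl, h₁, h₂⟩)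
    · exact .const _ _
    · exact .ident _
    · exact .left _ _
    · exact .right _ _
    · exact .add _ _
    · exact .mul _ _
    · exact .less _ _ h
    · exact .not_less _ _ h
    · exact .oracle _ h
    · exact .not_oracle _ h
    · exact .pairing _ _ _ _ _ h₁ h₂
    · exact .comp _ _ _ _ _ h₁ h₂
    · exact .minim _ _ _ h₁ h₂

theorem Before.mono {D E : Set M} {s e x y : M} (h : Before D s e x y) (hDE : D ⊆ E) :
    Before E s e x y := by
  obtain ⟨t, ht, h⟩ := h
  exact ⟨t, ht, hDE h⟩

theorem Justified.mono {A D E : Set M} {s e x y : M} (h : Justified A D s e x y) (hDE : D ⊆ E) :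
    Justified A E s e x y := by
  cases h with
  | const => exact .const _ _
  | ident => exact .ident _
  | left => exact .left _ _
  | right => exact .right _ _
  | add => exact .add _ _
  | mul => exact .mul _ _
  | less _ _ h => exact .less _ _ h
  | not_less _ _ h => exact .not_less _ _ h
  | oracle _ h => exact .oracle _ h
  | not_oracle _ h => exact .not_oracle _ h
  | pairing _ _ _ _ _ h₁ h₂ => exact .pairing _ _ _ _ _ (h₁.mono hDE) (h₂.mono hDE)
  | comp _ _ _ _ _ h₁ h₂ => exact .comp _ _ _ _ _ (h₁.mono hDE) (h₂.mono hDE)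
  | minim _ _ _ h₁ h₂ =>
    refine .minim _ _ _ (h₁.mono hDE) fun z hz => ?_
    obtain ⟨v, hv, h⟩ := h₂ z hz
    exact ⟨v, hv, h.mono hDE⟩

/-- In a computation, every line has been computed. -/
theorem IsComputation.computes {A D : Set M} (hD : IsComputation A D) {s e x y : M}
    (h : Before D s e x y) : Computes A e x y := by
  obtain ⟨t, _, h⟩ := h
  exact ⟨D, hD, t, h⟩

theorem Computes.exists_justified {A : Set M} {e x y : M} (h : Computes A e x y) :
    ∃ D s, IsComputation A D ∧ Justified A D s e x y := by
  obtain ⟨D, hD, s, h⟩ := h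
  exact ⟨D, s, hD, hD.2 s e x y h⟩

theorem computes_const {A : Set M} {k x y : M} (h : Computes A (pair 0 k) x y) : y = k := by
  obtain ⟨D, s, hD, h⟩ := h.exists_justified
  simpa [justified_iff, pair_inj, eq_comm] using h

theorem computes_left {A : Set M} {x y : M} (h : Computes A (pair 2 0) x y) :
    ∃ b, x = pair y b := by
  obtain ⟨D, s, hD, h⟩ := h.exists_justified
  simp [justified_iff, pair_inj] at h
  obtain ⟨b, _, h⟩ := h
  exact ⟨b, h⟩

theorem computes_right {A : Set M} {x y : M} (h : Computes A (pair 3 0) x y) :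
    ∃ a, x = pair a y := by
  obtain ⟨D, s, hD, h⟩ := h.exists_justified
  simp [justified_iff, pair_inj] at h
  obtain ⟨b, _, h⟩ := h
  exact ⟨b, h⟩

theorem computes_add {A : Set M} {x y : M} (h : Computes A (pair 4 0) x y) :
    ∃ a b, x = pair a b ∧ y = a + b := by
  obtain ⟨D, s, hD, h⟩ := h.exists_justified
  simp [justified_iff, pair_inj] at h
  obtain ⟨a, _, b, _, h⟩ := h
  exact ⟨a, b, h⟩

theorem computes_mul {A : Set M} {x y : M} (h : Computes A (pair 5 0) x y) :
    ∃ a b, x = pair a b ∧ y = a * b := by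
  obtain ⟨D, s, hD, h⟩ := h.exists_justified
  simp [justified_iff, pair_inj] at h
  obtain ⟨a, _, b, _, h⟩ := h
  exact ⟨a, b, h⟩

theorem computes_less {A : Set M} {x y : M} (h : Computes A (pair 6 0) x y) :
    ∃ a b, x = pair a b ∧ (a < b ∧ y = 1 ∨ ¬ a < b ∧ y = 0) := by
  obtain ⟨D, s, hD, h⟩ := h.exists_justified
  simp [justified_iff, pair_inj, -not_lt] at h
  obtain ⟨a, _, b, _, h⟩ := h
  exact ⟨a, b, h⟩

theorem computes_oracle {A : Set M} {x y : M} (h : Computes A (pair 7 0) x y) :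
    x ∈ A ∧ y = 1 ∨ x ∉ A ∧ y = 0 := by
  obtain ⟨D, s, hD, h⟩ := h.exists_justified
  simpa [justified_iff, pair_inj] using h

theorem computes_pairing {A : Set M} {f g x y : M}
    (h : Computes A (pair 8 (pair f g)) x y) :
    ∃ u v, y = pair u v ∧ Computes A f x u ∧ Computes A g x v := by
  obtain ⟨D, s, hD, h⟩ := h.exists_justified
  simp [justified_iff, pair_inj] at h
  obtain ⟨_, _, u, _, v, _, h, h₁, h₂⟩ := h
  exact ⟨u, v, h, hD.computes h₁, hD.computes h₂⟩

theorem computes_comp {A : Set M} {f g x y : M} (h : Computes A (pair 9 (pair f g)) x y) :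
    ∃ u, Computes A g x u ∧ Computes A f u y := by
  obtain ⟨D, s, hD, h⟩ := h.exists_justified
  simp [justified_iff, pair_inj] at h
  obtain ⟨_, _, u, h₁, h₂⟩ := h
  exact ⟨u, hD.computes h₁, hD.computes h₂⟩

theorem computes_minim {A : Set M} {f x y : M} (h : Computes A (pair 10 f) x y) :
    Computes A f (pair x y) 0 ∧ ∀ z < y, ∃ v, v ≠ 0 ∧ Computes A f (pair x z) v := by
  obtain ⟨D, s, hD, h⟩ := h.exists_justified
  simp [justified_iff, pair_inj] at h
  obtain ⟨_, h₁, h₂⟩ := h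
  refine ⟨hD.computes h₁, fun z hz => ?_⟩
  obtain ⟨v, hv, h⟩ := h₂ z hz
  exact ⟨v, hv, hD.computes h⟩

section

variable [hM : Elementary M]

theorem IsComputation.extend {A D E : Set M} (hD : IsComputation A D) (hE : MFinite E)
    (h : ∀ s e x y, Line s e x y ∈ E → Justified A D s e x y) : IsComputation A (D ∪ E) := by
  refine ⟨hD.1.union hE, ?_⟩
  rintro s e x y (hs | hs)
  · exact (hD.2 s e x y hs).mono Set.subset_union_left
  · exact (h s e x y hs).mono Set.subset_union_left

theorem IsComputation.union {A D E : Set M} (hD : IsComputation A D) (hE : IsComputation A E) :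
    IsComputation A (D ∪ E) := by
  refine ⟨hD.1.union hE.1, ?_⟩
  rintro s e x y (hs | hs)
  · exact (hD.2 s e x y hs).mono Set.subset_union_left
  · exact (hE.2 s e x y hs).mono Set.subset_union_right

theorem isComputation_empty (A : Set M) : IsComputation A ∅ :=
  ⟨⟨0, fun x => iff_of_false id (bit_zero x)⟩, fun _ _ _ _ h => h.elim⟩

/-- The stages of the lines in a finite set are bounded. -/
theorem IsComputation.exists_stage {A D : Set M} (hD : IsComputation A D) :
    ∃ S, ∀ s e x y, Line s e x y ∈ D → Before D S e x y := by
  obtain ⟨S, hS⟩ := hD.1.exists_bound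
  exact ⟨S, fun s e x y h => ⟨s, (le_line s e x y).1.trans_lt (hS _ h), h⟩⟩

theorem Justified.computes {A D : Set M} {s e x y : M} (h : Justified A D s e x y)
    (hD : IsComputation A D) : Computes A e x y := by
  refine ⟨_, hD.extend (MFinite.singleton (Line s e x y)) ?_, s, Set.mem_union_right _ rfl⟩
  intro s' e' x' y' h'
  obtain ⟨rfl, rfl, rfl, rfl⟩ := line_inj.1 h'
  exact h

theorem Computes.comp {A : Set M} {f g x u y : M} (hg : Computes A g x u)
    (hf : Computes A f u y) : Computes A (pair 9 (pair f g)) x y := by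
  obtain ⟨D, hD, s, hs⟩ := hg
  obtain ⟨E, hE, t, ht⟩ := hf
  obtain ⟨S, hS⟩ := (hD.union hE).exists_stage
  exact (Justified.comp f g x u y (hS s g x u (Or.inl hs)) (hS t f u y (Or.inr ht))).computes
    (hD.union hE)

theorem Computes.pairing {A : Set M} {f g x u v : M} (hf : Computes A f x u)
    (hg : Computes A g x v) : Computes A (pair 8 (pair f g)) x (pair u v) := by
  obtain ⟨D, hD, s, hs⟩ := hf
  obtain ⟨E, hE, t, ht⟩ := hg
  obtain ⟨S, hS⟩ := (hD.union hE).exists_stage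
  exact (Justified.pairing f g x u v (hS s f x u (Or.inl hs)) (hS t g x v (Or.inr ht))).computes
    (hD.union hE)

theorem Computes.const (A : Set M) (k x : M) : Computes A (pair 0 k) x k :=
  (Justified.const (s := 0) k x).computes (isComputation_empty A)

/-- An index, computed from `e` and `x`, of the constant partial function with value `Φ_e(x)`. -/
def applyIndex (e x : M) : M := pair 9 (pair e (pair 0 x))

theorem applyIndex_mem_jump {A : Set M} {e x : M} :
    applyIndex e x ∈ jump A ↔ ∃ y, Computes A e x y := by
  refine exists_congr fun y => ⟨fun h => ?_, fun h => (Computes.const A x _).comp h⟩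
  obtain ⟨u, hu, h⟩ := computes_comp h
  rwa [computes_const hu] at h

instance {s t : (ℕ → M) → M} [IsTerm s] [IsTerm t] : IsTerm fun w => applyIndex (s w) (t w) := by
  unfold applyIndex
  infer_instance

theorem three_ne_pair (a b : M) : (0 : M) + 3 ≠ pair a b := by
  intro h
  rcases le_or_gt (a + b) 1 with hab | hab
  · have h1 : a ≤ 1 := (le_add_of_nonneg_right zero_le).trans hab
    have h2 : pair a b ≤ 1 ^ 2 + 1 := add_le_add (pow_le_pow_left₀ zero_le hab 2) h1
    rw [← h] at h2
    norm_num at h2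
  · have h1 : (1 : M) + 1 ≤ a + b := by rwa [← lt_succ_iff, add_lt_add_iff_right]
    have h2 : ((1 : M) + 1) ^ 2 ≤ pair a b :=
      (pow_le_pow_left₀ zero_le h1 2).trans (le_add_of_nonneg_right zero_le)
    rw [← h] at h2
    norm_num at h2

/-- The set `A` is many-one reducible to its jump by a polynomial. -/
theorem exists_mem_iff_mem_jump (A : Set M) : ∃ e, ∀ x, x ∈ A ↔ applyIndex e x ∈ jump A := by
  -- The function `x ↦ ((A(x) + 3) unpaired)₀`: here `4 = ⟨0, 2⟩` is a pair and `3` is not.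
  refine ⟨pair 9 (pair (pair 2 0) (pair 9 (pair (pair 4 0)
    (pair 8 (pair (pair 7 0) (pair 0 3)))))), fun x => ?_⟩
  rw [applyIndex_mem_jump]
  constructor
  · intro hx
    have h1 : Computes A (pair 7 0) x 1 :=
      (Justified.oracle (s := 0) x hx).computes (isComputation_empty A)
    have h2 : Computes A (pair 4 0) (pair 1 3) (1 + 3) :=
      (Justified.add (s := 0) 1 3).computes (isComputation_empty A)
    have h3 : Computes A (pair 2 0) (pair 0 2) 0 :=
      (Justified.left (s := 0) 0 2).computes (isComputation_empty A)
    have h4 : pair (0 : M) 2 = 1 + 3 := by norm_num [pair]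
    rw [h4] at h3
    exact ⟨0, ((h1.pairing (Computes.const A 3 x)).comp h2).comp h3⟩
  · rintro ⟨y, h⟩
    obtain ⟨u, h, hu⟩ := computes_comp h
    obtain ⟨b, rfl⟩ := computes_left hu
    obtain ⟨v, h, hv⟩ := computes_comp h
    obtain ⟨a, c, h1, h2⟩ := computes_add hv
    obtain ⟨a', c', h3, h4, h5⟩ := computes_pairing h
    rw [h1, pair_inj] at h3
    obtain ⟨rfl, rfl⟩ := h3
    rw [computes_const h5] at h2
    rcases computes_oracle h4 with h | h
    · exact h.1
    · rw [h.2] at h2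
      exact absurd h2.symm (three_ne_pair y b)

theorem ISigma.of_jump {A : Set M} (h : ISigma 0 {jump A}) : ISigma 0 {A} := by
  obtain ⟨e, he⟩ := exists_mem_iff_mem_jump A
  refine h.zero_of_d0 ?_
  simp only [he]
  exact (inferInstance : Dfn (D0 (jump A)) fun w => applyIndex e (w 0) ∈ jump A).out

end

end

/-! ### Indices with uniformly finite computations -/

section

variable {M : Type u} [CommSemiring M] [LinearOrder M] [PeanoMinus M] [hM : Elementary M]

/-- A locally bounded existential quantifier preserves local `Δ₀` definability. -/
theorem Loc.dfn_ex {A : Set M} {R : M → (ℕ → M) → Prop}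
    (h : Dfn (Loc A) fun w => R (w 0) fun i => w (i + 1))
    (hb : ∀ N, ∃ b, ∀ w : ℕ → M, (∀ i, w i < N) → ∀ u, R u w → u < b) :
    Dfn (Loc A) fun w => ∃ u, R u w := by
  refine Loc.of_local fun N => ?_
  obtain ⟨b, hb⟩ := hb N
  refine ⟨fun w => ∃ u < b, R u w, inferInstance, fun w hw => ?_⟩
  exact exists_congr fun u => ⟨fun h => ⟨hb w hw u h, h⟩, fun h => h.2⟩

/-- On the domain `S`, the index `e` computes at most the partial function with graph `G`, and a
single finite computation gives all values at arguments below a given bound. The graph is locally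
`Δ₀` and its values are locally bounded. No recursion happens at such indices, so that the stage of
a line can be chosen as a function of its index only. -/
structure Simple (A : Set M) (S : M → Prop) (e : M) (G : M → M → Prop) : Prop where
  dom {x y : M} : G x y → S x
  sound {x y : M} : S x → Computes A e x y → G x y
  unif (N : M) : ∃ D, IsComputation A D ∧ ∀ x < N, ∀ y, G x y → ∃ s, Line s e x y ∈ D
  bound (N : M) : ∃ b, ∀ x < N, ∀ y, G x y → y < b
  dfn (s t : (ℕ → M) → M) [IsTerm s] [IsTerm t] : Dfn (Loc A) fun w => G (s w) (t w)

/-- If all values at arguments below any bound are justified by one computation, the lines that record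
them may be added to it, all with the same stage. -/
theorem Simple.of_step {A : Set M} (hA : ISigma 0 {A}) {S : M → Prop} {e : M} {G : M → M → Prop}
    (dom : ∀ x y, G x y → S x)
    (sound : ∀ x y, S x → Computes A e x y → G x y)
    (bound : ∀ N, ∃ b, ∀ x < N, ∀ y, G x y → y < b)
    (dfn : ∀ (s t : (ℕ → M) → M) [IsTerm s] [IsTerm t], Dfn (Loc A) fun w => G (s w) (t w))
    (step : ∀ N, ∃ D s, IsComputation A D ∧ ∀ x < N, ∀ y, G x y → Justified A D s e x y) :
    Simple A S e G := by
  refine ⟨dom _ _, sound _ _, fun N => ?_, bound, dfn⟩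
  obtain ⟨D, s, hD, h⟩ := step N
  obtain ⟨b, hb⟩ := bound N
  have := dfn (fun w => w 1) (fun w => w 0)
  have hfin := mfinite_of_loc hA (P := fun z => ∃ x < N, ∃ y < b, G x y ∧ z = Line s e x y)
    inferInstance (N := Line s e N b + 1) (by
      rintro _ ⟨x, hx, y, hy, _, rfl⟩
      exact lt_succ_iff.2 (pair_le_pair le_rfl (pair_le_pair le_rfl (pair_le_pair hx.le hy.le))))
  refine ⟨_, hD.extend hfin ?_, fun x hx y hG => ⟨s, Or.inr ⟨x, hx, y, hb x hx y hG, hG, rfl⟩⟩⟩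
  rintro s' e' x' y' ⟨x, hx, y, hy, hG, hl⟩
  obtain ⟨rfl, rfl, rfl, rfl⟩ := line_inj.1 hl
  exact h x' hx y' hG

theorem Simple.const {A : Set M} (hA : ISigma 0 {A}) {S : M → Prop}
    (hS : ∀ (s : (ℕ → M) → M) [IsTerm s], Dfn (Loc A) fun w => S (s w)) (k : M) :
    Simple A S (pair 0 k) fun x y => S x ∧ y = k := by
  refine .of_step hA (fun _ _ h => h.1) (fun x y hx h => ⟨hx, computes_const h⟩)
    (fun N => ⟨k + 1, fun x _ y h => h.2 ▸ lt_add_one k⟩) (fun s t _ _ => ?_)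
    fun N => ⟨∅, 0, isComputation_empty A, ?_⟩
  · have := hS s
    infer_instance
  · rintro x _ y ⟨_, rfl⟩
    exact .const _ _

theorem Simple.left {A : Set M} (hA : ISigma 0 {A}) :
    Simple A (fun _ => True) (pair 2 0) fun x y => ∃ b ≤ x, x = pair y b := by
  refine .of_step hA (fun _ _ _ => trivial) (fun x y _ h => ?_) (fun N => ⟨N, ?_⟩)
    (fun s t _ _ => inferInstance) fun N => ⟨∅, 0, isComputation_empty A, ?_⟩
  · obtain ⟨b, rfl⟩ := computes_left h
    exact ⟨b, right_le_pair _ _, rfl⟩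
  · rintro _ hx y ⟨b, _, rfl⟩
    exact (left_le_pair _ _).trans_lt hx
  · rintro _ _ y ⟨b, _, rfl⟩
    exact .left _ _

theorem Simple.right {A : Set M} (hA : ISigma 0 {A}) :
    Simple A (fun _ => True) (pair 3 0) fun x y => ∃ a ≤ x, x = pair a y := by
  refine .of_step hA (fun _ _ _ => trivial) (fun x y _ h => ?_) (fun N => ⟨N, ?_⟩)
    (fun s t _ _ => inferInstance) fun N => ⟨∅, 0, isComputation_empty A, ?_⟩
  · obtain ⟨b, rfl⟩ := computes_right h
    exact ⟨b, left_le_pair _ _, rfl⟩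
  · rintro _ hx y ⟨b, _, rfl⟩
    exact (right_le_pair _ _).trans_lt hx
  · rintro _ _ y ⟨b, _, rfl⟩
    exact .right _ _

theorem Simple.add {A : Set M} (hA : ISigma 0 {A}) :
    Simple A (fun _ => True) (pair 4 0) fun x y => ∃ a ≤ x, ∃ b ≤ x, x = pair a b ∧ y = a + b := by
  refine .of_step hA (fun _ _ _ => trivial) (fun x y _ h => ?_) (fun N => ⟨N + N + 1, ?_⟩)
    (fun s t _ _ => inferInstance) fun N => ⟨∅, 0, isComputation_empty A, ?_⟩
  · obtain ⟨a, b, rfl, rfl⟩ := computes_add h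
    exact ⟨a, left_le_pair _ _, b, right_le_pair _ _, rfl, rfl⟩
  · rintro _ hx y ⟨a, ha, b, hb, rfl, rfl⟩
    exact lt_succ_iff.2 (add_le_add (ha.trans hx.le) (hb.trans hx.le))
  · rintro _ _ y ⟨a, _, b, _, rfl, rfl⟩
    exact .add _ _

theorem Simple.mul {A : Set M} (hA : ISigma 0 {A}) :
    Simple A (fun _ => True) (pair 5 0) fun x y => ∃ a ≤ x, ∃ b ≤ x, x = pair a b ∧ y = a * b := by
  refine .of_step hA (fun _ _ _ => trivial) (fun x y _ h => ?_) (fun N => ⟨N * N + 1, ?_⟩)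
    (fun s t _ _ => inferInstance) fun N => ⟨∅, 0, isComputation_empty A, ?_⟩
  · obtain ⟨a, b, rfl, rfl⟩ := computes_mul h
    exact ⟨a, left_le_pair _ _, b, right_le_pair _ _, rfl, rfl⟩
  · rintro _ hx y ⟨a, ha, b, hb, rfl, rfl⟩
    exact lt_succ_iff.2 (mul_le_mul' (ha.trans hx.le) (hb.trans hx.le))
  · rintro _ _ y ⟨a, _, b, _, rfl, rfl⟩
    exact .mul _ _

theorem Simple.less {A : Set M} (hA : ISigma 0 {A}) :
    Simple A (fun _ => True) (pair 6 0) fun x y =>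
      ∃ a ≤ x, ∃ b ≤ x, x = pair a b ∧ (a < b ∧ y = 1 ∨ ¬ a < b ∧ y = 0) := by
  refine .of_step hA (fun _ _ _ => trivial) (fun x y _ h => ?_) (fun N => ⟨1 + 1, ?_⟩)
    (fun s t _ _ => inferInstance) fun N => ⟨∅, 0, isComputation_empty A, ?_⟩
  · obtain ⟨a, b, rfl, h'⟩ := computes_less h
    exact ⟨a, left_le_pair _ _, b, right_le_pair _ _, rfl, h'⟩
  · rintro _ _ y ⟨a, _, b, _, rfl, ⟨_, rfl⟩ | ⟨_, rfl⟩⟩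
    · exact lt_add_one _
    · positivity
  · rintro _ _ y ⟨a, _, b, _, rfl, ⟨h, rfl⟩ | ⟨h, rfl⟩⟩
    · exact .less _ _ h
    · exact .not_less _ _ h

theorem Simple.oracle {A : Set M} (hA : ISigma 0 {A}) :
    Simple A (fun _ => True) (pair 7 0) fun x y => x ∈ A ∧ y = 1 ∨ ¬ x ∈ A ∧ y = 0 := by
  refine .of_step hA (fun _ _ _ => trivial) (fun x y _ h => computes_oracle h)
    (fun N => ⟨1 + 1, ?_⟩) (fun s t _ _ => inferInstance)
    fun N => ⟨∅, 0, isComputation_empty A, ?_⟩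
  · rintro _ _ y (⟨_, rfl⟩ | ⟨_, rfl⟩)
    · exact lt_add_one _
    · positivity
  · rintro _ _ y (⟨h, rfl⟩ | ⟨h, rfl⟩)
    · exact .oracle _ h
    · exact .not_oracle _ h

theorem Simple.pairing {A : Set M} (hA : ISigma 0 {A}) {S : M → Prop} {f g : M}
    {F G : M → M → Prop} (hf : Simple A S f F) (hg : Simple A S g G) :
    Simple A S (pair 8 (pair f g)) fun x y => ∃ u ≤ y, ∃ v ≤ y, y = pair u v ∧ F x u ∧ G x v := by
  refine .of_step hA ?_ (fun x y hx h => ?_) (fun N => ?_) (fun s t _ _ => ?_) fun N => ?_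
  · rintro x y ⟨u, _, v, _, _, h, _⟩
    exact hf.dom h
  · obtain ⟨u, v, rfl, hu, hv⟩ := computes_pairing h
    exact ⟨u, left_le_pair _ _, v, right_le_pair _ _, rfl, hf.sound hx hu, hg.sound hx hv⟩
  · obtain ⟨b, hb⟩ := hf.bound N
    obtain ⟨c, hc⟩ := hg.bound N
    refine ⟨pair b c + 1, ?_⟩
    rintro x hx _ ⟨u, _, v, _, rfl, hu, hv⟩
    exact lt_succ_iff.2 (pair_le_pair (hb x hx u hu).le (hc x hx v hv).le)
  · have : Dfn (Loc A) fun w => F (s fun i => w (i + 2)) (w 1) := hf.dfn _ _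
    have : Dfn (Loc A) fun w => G (s fun i => w (i + 2)) (w 0) := hg.dfn _ _
    infer_instance
  · obtain ⟨D, hD, h⟩ := hf.unif N
    obtain ⟨E, hE, h'⟩ := hg.unif N
    obtain ⟨s, hs⟩ := (hD.union hE).exists_stage
    refine ⟨_, s, hD.union hE, ?_⟩
    rintro x hx _ ⟨u, _, v, _, rfl, hu, hv⟩
    obtain ⟨_, hu⟩ := h x hx u hu
    obtain ⟨_, hv⟩ := h' x hx v hv
    exact .pairing _ _ _ _ _ (hs _ _ _ _ (Or.inl hu)) (hs _ _ _ _ (Or.inr hv))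

theorem Simple.comp {A : Set M} (hA : ISigma 0 {A}) {S T : M → Prop} {f g : M}
    {F G : M → M → Prop} (hf : Simple A T f F) (hg : Simple A S g G)
    (hT : ∀ x y, G x y → T y) :
    Simple A S (pair 9 (pair f g)) fun x y => ∃ u, G x u ∧ F u y := by
  refine .of_step hA ?_ (fun x y hx h => ?_) (fun N => ?_) (fun s t hs _ => ?_) fun N => ?_
  · rintro x y ⟨u, h, _⟩
    exact hg.dom h
  · obtain ⟨u, hu, h⟩ := computes_comp h
    exact ⟨u, hg.sound hx hu, hf.sound (hT _ _ (hg.sound hx hu)) h⟩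
  · obtain ⟨b, hb⟩ := hg.bound N
    obtain ⟨c, hc⟩ := hf.bound b
    refine ⟨c, ?_⟩
    rintro x hx y ⟨u, hu, h⟩
    exact hc u (hb x hx u hu) y h
  · have : Dfn (Loc A) fun w => G (s fun i => w (i + 1)) (w 0) := hg.dfn _ _
    have : Dfn (Loc A) fun w => F (w 0) (t fun i => w (i + 1)) := hf.dfn _ _
    refine Loc.dfn_ex (R := fun u w => G (s w) u ∧ F u (t w)) inferInstance fun N => ?_
    obtain ⟨b, hb⟩ := hs.exists_bound N
    obtain ⟨c, hc⟩ := hg.bound (b + 1)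
    exact ⟨c, fun w hw u hu => hc _ (lt_succ_iff.2 (hb w hw)) u hu.1⟩
  · obtain ⟨b, hb⟩ := hg.bound N
    obtain ⟨D, hD, h⟩ := hg.unif N
    obtain ⟨E, hE, h'⟩ := hf.unif b
    obtain ⟨s, hs⟩ := (hD.union hE).exists_stage
    refine ⟨_, s, hD.union hE, ?_⟩
    rintro x hx y ⟨u, hu, hy⟩
    obtain ⟨_, hy⟩ := h' u (hb x hx u hu) y hy
    obtain ⟨_, hu⟩ := h x hx u hu
    exact .comp _ _ _ _ _ (hs _ _ _ _ (Or.inl hu)) (hs _ _ _ _ (Or.inr hy))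

/-- Minimization. By the hypothesis `bound`, the search stays below a bound, so a single computation for
`f` serves it. -/
theorem Simple.minim {A : Set M} (hA : ISigma 0 {A}) {S T : M → Prop} {f : M}
    {F : M → M → Prop} (hf : Simple A T f F)
    (hS : ∀ (s : (ℕ → M) → M) [IsTerm s], Dfn (Loc A) fun w => S (s w))
    (hT : ∀ x y, S x → T (pair x y))
    (bound : ∀ N, ∃ b, ∀ x < N, S x → ∀ y, F (pair x y) 0 →
      (∀ z < y, ∃ v, v ≠ 0 ∧ F (pair x z) v) → y < b) :
    Simple A S (pair 10 f) fun x y =>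
      S x ∧ F (pair x y) 0 ∧ ∀ z < y, ∃ v, v ≠ 0 ∧ F (pair x z) v := by
  refine .of_step hA (fun _ _ h => h.1) (fun x y hx h => ?_) (fun N => ?_) (fun s t hs ht => ?_)
    fun N => ?_
  · obtain ⟨h, h'⟩ := computes_minim h
    refine ⟨hx, hf.sound (hT _ _ hx) h, fun z hz => ?_⟩
    obtain ⟨v, hv, h⟩ := h' z hz
    exact ⟨v, hv, hf.sound (hT _ _ hx) h⟩
  · obtain ⟨b, hb⟩ := bound N
    exact ⟨b, fun x hx y h => hb x hx h.1 y h.2.1 h.2.2⟩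
  · have := hS s
    have := hf.dfn (fun w => pair (s w) (t w)) fun w => 0
    have : Dfn (Loc A) fun w => F (pair (s fun i => w (i + 2)) (w 1)) (w 0) :=
      hf.dfn (fun w => pair (s fun i => w (i + 2)) (w 1)) _
    have : Dfn (Loc A) fun w => ∃ v, v ≠ 0 ∧ F (pair (s fun i => w (i + 1)) (w 0)) v := by
      refine Loc.dfn_ex (R := fun v w => v ≠ 0 ∧ F (pair (s fun i => w (i + 1)) (w 0)) v)
        inferInstance fun N => ?_
      obtain ⟨b, hb⟩ := hs.exists_bound N
      obtain ⟨c, hc⟩ := hf.bound (pair b N + 1)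
      exact ⟨c, fun w hw v hv => hc _ (lt_succ_iff.2 (pair_le_pair (hb _ fun i => hw _)
        (hw 0).le)) v hv.2⟩
    infer_instance
  · obtain ⟨b, hb⟩ := bound N
    obtain ⟨D, hD, h⟩ := hf.unif (pair N b + 1)
    obtain ⟨s, hs⟩ := hD.exists_stage
    refine ⟨D, s, hD, ?_⟩
    rintro x hx y ⟨hx', hy, hy'⟩
    have hyb := hb x hx hx' y hy hy'
    have hlt (z : M) (hz : z ≤ y) : pair x z < pair N b + 1 :=
      lt_succ_iff.2 (pair_le_pair hx.le (hz.trans hyb.le))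
    refine .minim _ _ _ ?_ fun z hz => ?_
    · obtain ⟨_, h⟩ := h _ (hlt y le_rfl) 0 hy
      exact hs _ _ _ _ h
    · obtain ⟨v, hv, hz'⟩ := hy' z hz
      obtain ⟨_, h⟩ := h _ (hlt z hz.le) v hz'
      exact ⟨v, hv, hs _ _ _ _ h⟩

end

/-! ### Many-one reduction of `Σ₁` predicates to the jump -/

section

variable {M : Type u} [CommSemiring M] [LinearOrder M] [PeanoMinus M]

/-- A `Σ₁` predicate is defined by a single unbounded quantifier in front of a `Δ₀` predicate. -/
theorem Sg.exists_d0 {A : Set M} {P : (ℕ → M) → Prop} (hP : Sg A 1 P) :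
    ∃ Q, D0 A Q ∧ ∀ w, P w ↔ ∃ z, Q (push z w) := by
  generalize hn : 1 = n at hP
  induction hP with
  | delta0 => exact absurd hn one_ne_zero
  | @not _ P hP _ =>
    obtain rfl : _ = 0 := by simpa using hn.symm
    cases hP with
    | delta0 hP =>
      refine ⟨fun w => ¬ P fun i => w (i + 1), ?_, fun w => ?_⟩
      · exact .imp (hP.subst (s := fun i w => w (i + 1)) fun i => .var (i + 1)) .falsum
      · exact ⟨fun h => ⟨0, h⟩, fun ⟨_, h⟩ => h⟩
  | @ex _ P _ ih =>
    obtain ⟨Q, hQ, h⟩ := ih hn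
    have hQ' : Dfn (D0 A) fun w => Q (push (w 0) (push (w 1) fun i => w (i + 3))) := by
      constructor
      have := hQ.subst (s := fun i => match i with
        | 0 => fun w => w 0
        | 1 => fun w => w 1
        | i + 2 => fun w => w (i + 3)) fun i => by
          match i with
          | 0 => exact .var 0
          | 1 => exact .var 1
          | i + 2 => exact .var (i + 3)
      convert this using 3 with w i
      funext i
      match i with
      | 0 => rfl
      | 1 => rfl
      | i + 2 => rfl
    refine ⟨fun w => ∃ x < w 0, ∃ z < w 0, Q (push z (push x fun i => w (i + 1))), ?_, fun w => ?_⟩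
    · exact (inferInstance : Dfn (D0 A) fun w => ∃ x < w 0, ∃ z < w 0,
        Q (push z (push x fun i => w (i + 1)))).out
    · simp only [h]
      constructor
      · rintro ⟨x, z, hz⟩
        exact ⟨max x z + 1, x, lt_succ_iff.2 (le_max_left _ _), z,
          lt_succ_iff.2 (le_max_right _ _), hz⟩
      · rintro ⟨u, x, _, z, _, hz⟩
        exact ⟨x, z, hz⟩

theorem Sg.of_d0 {A : Set M} {P : (ℕ → M) → Prop} (hP : D0 A P) : ∀ n, Sg A n P
  | 0 => .delta0 hP
  | n + 1 => by
    have := Sg.not (Sg.of_d0 (hP.imp .falsum) n)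
    convert this using 2 with w
    exact not_not.symm

theorem Sg.one_iff {A : Set M} {P : (ℕ → M) → Prop} :
    Sg A 1 P ↔ ∃ Q, D0 A Q ∧ ∀ w, P w ↔ ∃ z, Q (push z w) := by
  refine ⟨Sg.exists_d0, fun ⟨Q, hQ, h⟩ => ?_⟩
  rw [show P = _ from funext fun w => propext (h w)]
  exact .ex (.of_d0 hQ 1)

/-- The code of the values of the first `k` variables. -/
def envCode : ℕ → (ℕ → M) → M
  | 0, _ => 0
  | k + 1, w => pair (envCode k fun i => w (i + 1)) (w 0)

/-- The numbers that are codes of the values of `k` variables. -/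
def IsEnvCode : ℕ → M → Prop
  | 0, x => x = 0
  | k + 1, x => ∃ a ≤ x, ∃ b ≤ x, x = pair a b ∧ IsEnvCode k a

theorem isTerm_envCode (k : ℕ) : IsTerm fun w : ℕ → M => envCode k w := by
  induction k with
  | zero => exact .const 0
  | succ k ih =>
    have := ih.subst (fun i w => w (i + 1)) fun i => .var (i + 1)
    unfold envCode
    infer_instance

theorem isEnvCode_envCode (k : ℕ) : ∀ w : ℕ → M, IsEnvCode k (envCode k w) := by
  induction k with
  | zero => exact fun w => rfl
  | succ k ih => exact fun w => ⟨_, left_le_pair _ _, _, right_le_pair _ _, rfl, ih _⟩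

theorem IsEnvCode.exists_eq {k : ℕ} : ∀ {x : M}, IsEnvCode k x →
    ∃ w, x = envCode k w ∧ ∀ i, w i ≤ x := by
  induction k with
  | zero => exact fun h => ⟨fun _ => 0, h, fun _ => zero_le⟩
  | succ k ih =>
    rintro x ⟨a, ha, b, hb, rfl, h⟩
    obtain ⟨w, rfl, hw⟩ := ih h
    refine ⟨push b w, rfl, fun i => ?_⟩
    cases i with
    | zero => exact hb
    | succ i => exact (hw i).trans ha

instance {K : ((ℕ → M) → Prop) → Prop} [Arith K] (k : ℕ) (s : (ℕ → M) → M) [IsTerm s] :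
    Dfn K fun w => IsEnvCode k (s w) := by
  induction k generalizing s with
  | zero =>
    unfold IsEnvCode
    infer_instance
  | succ k ih =>
    unfold IsEnvCode
    have := ih fun w => w 1
    infer_instance

variable [hM : Elementary M]

/-- The function `f` of the values of the first `k` variables is computed by a simple index. -/
def Comp (A : Set M) (k : ℕ) (f : (ℕ → M) → M) : Prop :=
  ∃ e G, Simple A (IsEnvCode k) e G ∧ ∀ w y, G (envCode k w) y ↔ y = f w

/-- The characteristic function of a predicate. -/
noncomputable def ind (P : (ℕ → M) → Prop) (w : ℕ → M) : M :=
  open Classical in if P w then 1 else 0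

theorem Comp.congr {A : Set M} {k : ℕ} {f g : (ℕ → M) → M} (hf : Comp A k f)
    (h : ∀ w, f w = g w) : Comp A k g := by
  rwa [← show f = g from funext h]

theorem Comp.congr_ind {A : Set M} {k : ℕ} {P Q : (ℕ → M) → Prop} (hP : Comp A k (ind P))
    (h : ∀ w, P w ↔ Q w) : Comp A k (ind Q) := by
  rwa [← show P = Q from funext fun w => propext (h w)]

section

variable {A : Set M} (hA : ISigma 0 {A})
include hA

theorem Comp.const (k : ℕ) (a : M) : Comp A k fun _ => a :=
  ⟨_, _, Simple.const hA (fun _ _ => inferInstance) a, fun w y => by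
    simp [isEnvCode_envCode]⟩

theorem Comp.pairing {k : ℕ} {f g : (ℕ → M) → M} (hf : Comp A k f) (hg : Comp A k g) :
    Comp A k fun w => pair (f w) (g w) := by
  obtain ⟨e, F, he, hF⟩ := hf
  obtain ⟨e', G, he', hG⟩ := hg
  refine ⟨_, _, he.pairing hA he', fun w y => ?_⟩
  simp only [hF, hG]
  constructor
  · rintro ⟨_, _, _, _, rfl, rfl, rfl⟩
    rfl
  · rintro rfl
    exact ⟨_, left_le_pair _ _, _, right_le_pair _ _, rfl, rfl, rfl⟩

/-- Composition with a basic function. -/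
theorem Comp.basic {k : ℕ} {f g : (ℕ → M) → M} {e : M} {F : M → M → Prop}
    (he : Simple A (fun _ => True) e F) (hf : Comp A k f) (h : ∀ w y, F (f w) y ↔ y = g w) :
    Comp A k g := by
  obtain ⟨e', G, he', hG⟩ := hf
  exact ⟨_, _, he.comp hA he' fun _ _ _ => trivial, fun w y => by simp [hG, h]⟩

theorem Simple.restrict {T S : M → Prop} {e : M} {G : M → M → Prop}
    (h : Simple A T e G) (hST : ∀ x, S x → T x)
    (hS : ∀ (s : (ℕ → M) → M) [IsTerm s], Dfn (Loc A) fun w => S (s w)) :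
    Simple A S e fun x y => S x ∧ G x y where
  dom h := h.1
  sound hx hc := ⟨hx, h.sound (hST _ hx) hc⟩
  unif N := by
    obtain ⟨D, hD, h⟩ := h.unif N
    exact ⟨D, hD, fun x hx y hG => h x hx y hG.2⟩
  bound N := by
    obtain ⟨b, h⟩ := h.bound N
    exact ⟨b, fun x hx y hG => h x hx y hG.2⟩
  dfn s t _ _ := by
    have := hS s
    have := h.dfn s t
    infer_instance

theorem Comp.var {k i : ℕ} (hi : i < k) : Comp A k fun w => w i := by
  induction k generalizing i with
  | zero => exact absurd hi (Nat.not_lt_zero i)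
  | succ k ih =>
    cases i with
    | zero =>
      refine ⟨_, _, (Simple.right hA).restrict hA (S := IsEnvCode (k + 1)) (fun _ _ => trivial)
        fun _ _ => inferInstance, fun w y => ?_⟩
      simp only [isEnvCode_envCode, true_and]
      simp only [envCode, pair_inj]
      constructor
      · rintro ⟨_, _, _, rfl⟩
        rfl
      · rintro rfl
        exact ⟨_, left_le_pair _ _, rfl, rfl⟩
    | succ i =>
      obtain ⟨e, G, he, hG⟩ := ih (Nat.lt_of_succ_lt_succ hi)
      refine ⟨_, _, he.comp hA ((Simple.left hA).restrict hA (S := IsEnvCode (k + 1))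
        (fun _ _ => trivial) fun _ _ => inferInstance) ?_, fun w y => ?_⟩
      · rintro x y ⟨⟨a, _, b, _, rfl, ha⟩, c, _, h⟩
        rw [← (pair_inj.1 h).1]
        exact ha
      · simp only [isEnvCode_envCode, true_and]
        simp only [envCode, pair_inj]
        constructor
        · rintro ⟨_, ⟨_, _, rfl, _⟩, h⟩
          exact (hG _ y).1 h
        · rintro h
          exact ⟨_, ⟨_, right_le_pair _ _, rfl, rfl⟩, (hG _ y).2 h⟩

theorem Comp.add {k : ℕ} {f g : (ℕ → M) → M} (hf : Comp A k f) (hg : Comp A k g) :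
    Comp A k fun w => f w + g w := by
  refine .basic hA (.add hA) (hf.pairing hA hg) fun w y => ?_
  simp only [pair_inj]
  constructor
  · rintro ⟨_, _, _, _, ⟨rfl, rfl⟩, rfl⟩
    rfl
  · rintro rfl
    exact ⟨_, left_le_pair _ _, _, right_le_pair _ _, ⟨rfl, rfl⟩, rfl⟩

theorem Comp.mul {k : ℕ} {f g : (ℕ → M) → M} (hf : Comp A k f) (hg : Comp A k g) :
    Comp A k fun w => f w * g w := by
  refine .basic hA (.mul hA) (hf.pairing hA hg) fun w y => ?_
  simp only [pair_inj]
  constructor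
  · rintro ⟨_, _, _, _, ⟨rfl, rfl⟩, rfl⟩
    rfl
  · rintro rfl
    exact ⟨_, left_le_pair _ _, _, right_le_pair _ _, ⟨rfl, rfl⟩, rfl⟩

theorem Comp.less {k : ℕ} {f g : (ℕ → M) → M} (hf : Comp A k f) (hg : Comp A k g) :
    Comp A k (ind fun w => f w < g w) := by
  refine .basic hA (.less hA) (hf.pairing hA hg) fun w y => ?_
  simp only [pair_inj, ind]
  constructor
  · rintro ⟨_, _, _, _, ⟨rfl, rfl⟩, ⟨h, rfl⟩ | ⟨h, rfl⟩⟩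
    · rw [if_pos h]
    · rw [if_neg h]
  · rintro rfl
    refine ⟨_, left_le_pair _ _, _, right_le_pair _ _, ⟨rfl, rfl⟩, ?_⟩
    by_cases h : f w < g w <;> simp [h, -not_lt]

theorem Comp.oracle {k : ℕ} {f : (ℕ → M) → M} (hf : Comp A k f) :
    Comp A k (ind fun w => f w ∈ A) := by
  refine .basic hA (.oracle hA) hf fun w y => ?_
  by_cases h : f w ∈ A <;> simp [h, ind]

theorem Comp.not {k : ℕ} {P : (ℕ → M) → Prop} (hP : Comp A k (ind P)) :
    Comp A k (ind fun w => ¬ P w) := by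
  refine (hP.less hA (.const hA k 1)).congr_ind fun w => ?_
  by_cases h : P w <;> simp [h, ind]

theorem Comp.imp {k : ℕ} {P Q : (ℕ → M) → Prop} (hP : Comp A k (ind P)) (hQ : Comp A k (ind Q)) :
    Comp A k (ind fun w => P w → Q w) := by
  refine ((hQ.less hA hP).not hA).congr_ind fun w => ?_
  by_cases h : P w <;> by_cases h' : Q w <;> simp [h, h', ind]

/-- Bounded quantification, by minimization: the search for the least counterexample ends at the bound
at the latest. -/
theorem Comp.ball {k : ℕ} {t : (ℕ → M) → M} {P : (ℕ → M) → Prop} (ht : IsTerm t)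
    (hk : Comp A k t) (hk' : Comp A (k + 1) fun w => t fun i => w (i + 1)) (hP : D0 A P)
    (hPk : Comp A (k + 1) (ind P)) : Comp A k (ind fun w => ∀ x < t w, P (push x w)) := by
  -- The search is for the least `y` such that `y < t` and `P` do not both hold.
  have hQ : Comp A (k + 1) (ind fun w => ¬ (w 0 < t (fun i => w (i + 1)) → ¬ P w)) :=
    Comp.not hA (.imp hA (.less hA (.var hA k.succ_pos) hk') (.not hA hPk))
  obtain ⟨e, F, he, hF⟩ := hQ
  have hF' (w : ℕ → M) (z v : M) : F (pair (envCode k w) z) v ↔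
      v = ind (fun w => ¬ (w 0 < t (fun i => w (i + 1)) → ¬ P w)) (push z w) := hF (push z w) v
  have hF0 (w : ℕ → M) (z : M) :
      F (pair (envCode k w) z) 0 ↔ ¬ (z < t w ∧ P (push z w)) := by
    rw [hF']
    by_cases h : z < t w <;> by_cases h' : P (push z w) <;> simp [ind, push, h, h', -not_lt]
  have hF1 (w : ℕ → M) (z : M) :
      (∃ v, v ≠ 0 ∧ F (pair (envCode k w) z) v) ↔ z < t w ∧ P (push z w) := by
    rw [← not_iff_not, ← hF0]
    simp only [hF']
    constructor
    · intro h
      by_contra h'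
      exact h ⟨_, Ne.symm h', rfl⟩
    · rintro h ⟨v, hv, rfl⟩
      exact hv h.symm
  have hmin (w : ℕ → M) : ∃ y, ¬ (y < t w ∧ P (push y w)) ∧ ∀ z < y, z < t w ∧ P (push z w) := by
    have hP' := hP.subst (s := fun i v => push (v 0) w i) fun i => by
      cases i <;> unfold push <;> infer_instance
    have hP'' : Dfn (Loc A) fun v => P (push (v 0) w) := ⟨.of_d0 hP'⟩
    obtain ⟨y, hy, h⟩ := Loc.exists_least hA (P := fun y => ¬ (y < t w ∧ P (push y w)))
      inferInstance (a := t w) fun h => lt_irrefl _ h.1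
    exact ⟨y, hy, fun z hz => not_not.1 (h z hz)⟩
  choose m hm hm' using hmin
  have hmk : Comp A k m := by
    refine ⟨_, _, he.minim hA (S := IsEnvCode k) (fun s _ => inferInstance)
      (fun x y hx => ⟨x, left_le_pair _ _, y, right_le_pair _ _, rfl, hx⟩) fun N => ?_,
      fun w y => ?_⟩
    · obtain ⟨b, hb⟩ := ht.exists_bound N
      refine ⟨b + 1, fun x hx hxk y _ hy => ?_⟩
      obtain ⟨w, rfl, hw⟩ := hxk.exists_eq
      refine lt_succ_iff.2 (le_trans ?_ (hb w fun i => (hw i).trans_lt hx))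
      by_contra hlt
      exact lt_irrefl _ ((hF1 w _).1 (hy _ (not_le.1 hlt))).1
    · simp only [isEnvCode_envCode, true_and, hF0, hF1]
      constructor
      · rintro ⟨h, h'⟩
        refine le_antisymm (not_lt.1 fun hlt => hm w (h' _ hlt)) (not_lt.1 fun hlt => h (hm' w _ hlt))
      · rintro rfl
        exact ⟨hm w, hm' w⟩
  refine ((hmk.less hA hk).not hA).congr_ind fun w => ?_
  constructor
  · intro h x hx
    exact (hm' w x (hx.trans_le (not_lt.1 h))).2
  · intro h hlt
    exact hm w ⟨hlt, h _ hlt⟩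

theorem IsTerm.comp {t : (ℕ → M) → M} (ht : IsTerm t) :
    ∃ k₀, ∀ k ≥ k₀, Comp A k t := by
  induction ht with
  | var i => exact ⟨i + 1, fun k hk => .var hA hk⟩
  | const a => exact ⟨0, fun k _ => .const hA k a⟩
  | add _ _ h₁ h₂ =>
    obtain ⟨k₁, h₁⟩ := h₁
    obtain ⟨k₂, h₂⟩ := h₂
    exact ⟨max k₁ k₂, fun k hk => .add hA (h₁ k (le_of_max_le_left hk))
      (h₂ k (le_of_max_le_right hk))⟩
  | mul _ _ h₁ h₂ =>
    obtain ⟨k₁, h₁⟩ := h₁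
    obtain ⟨k₂, h₂⟩ := h₂
    exact ⟨max k₁ k₂, fun k hk => .mul hA (h₁ k (le_of_max_le_left hk))
      (h₂ k (le_of_max_le_right hk))⟩

/-- The characteristic functions of `Δ₀` predicates are computed by simple indices. -/
theorem D0.comp {P : (ℕ → M) → Prop} (hP : D0 A P) : ∃ k₀, ∀ k ≥ k₀, Comp A k (ind P) := by
  induction hP with
  | falsum => exact ⟨0, fun k _ => (Comp.const hA k 0).congr fun w => by simp [ind]⟩
  | lt h₁ h₂ =>
    obtain ⟨k₁, h₁⟩ := h₁.comp hA
    obtain ⟨k₂, h₂⟩ := h₂.comp hA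
    exact ⟨max k₁ k₂, fun k hk => .less hA (h₁ k (le_of_max_le_left hk))
      (h₂ k (le_of_max_le_right hk))⟩
  | eq h₁ h₂ =>
    obtain ⟨k₁, h₁⟩ := h₁.comp hA
    obtain ⟨k₂, h₂⟩ := h₂.comp hA
    refine ⟨max k₁ k₂, fun k hk => ?_⟩
    have h₁ := h₁ k (le_of_max_le_left hk)
    have h₂ := h₂ k (le_of_max_le_right hk)
    refine (((h₁.less hA h₂).not hA).imp hA (h₂.less hA h₁) |>.not hA).congr_ind fun w => ?_
    rw [Classical.not_imp, not_lt, not_lt, ← le_antisymm_iff, eq_comm]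
  | mem h =>
    obtain ⟨k₁, h⟩ := h.comp hA
    exact ⟨k₁, fun k hk => .oracle hA (h k hk)⟩
  | imp _ _ h₁ h₂ =>
    obtain ⟨k₁, h₁⟩ := h₁
    obtain ⟨k₂, h₂⟩ := h₂
    exact ⟨max k₁ k₂, fun k hk => .imp hA (h₁ k (le_of_max_le_left hk))
      (h₂ k (le_of_max_le_right hk))⟩
  | ball ht hP h =>
    obtain ⟨k₁, h₁⟩ := ht.comp hA
    obtain ⟨k₂, h₂⟩ := (ht.subst (fun i w => w (i + 1)) fun i => .var (i + 1)).comp hA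
    obtain ⟨k₃, h₃⟩ := h
    refine ⟨max k₁ (max k₂ k₃), fun k hk => .ball hA ht (h₁ k (le_of_max_le_left hk))
      (h₂ _ (Nat.le_succ_of_le (le_of_max_le_left (le_of_max_le_right hk)))) hP
      (h₃ _ (Nat.le_succ_of_le (le_of_max_le_right (le_of_max_le_right hk))))⟩

/-- Every `Σ₁` predicate is many-one reducible to the jump, by a polynomial. -/
theorem Sg.exists_mem_jump {P : (ℕ → M) → Prop} (hP : Sg A 1 P) :
    ∃ t, IsTerm t ∧ ∀ w, P w ↔ t w ∈ jump A := by
  obtain ⟨Q, hQ, h⟩ := hP.exists_d0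
  obtain ⟨k, hk⟩ := (hQ.imp .falsum).comp hA
  obtain ⟨e, F, he, hF⟩ := hk (k + 1) k.le_succ
  have hF' (w : ℕ → M) (z v : M) : F (pair (envCode k w) z) v ↔
      v = ind (fun w => Q w → False) (push z w) := hF (push z w) v
  have := isTerm_envCode (M := M) k
  refine ⟨fun w => applyIndex (pair 10 e) (envCode k w), inferInstance, fun w => ?_⟩
  rw [h, applyIndex_mem_jump]
  constructor
  · rintro ⟨z, hz⟩
    have hQ' := hQ.subst (s := fun i v => push (v 0) w i) fun i => by
      cases i <;> unfold push <;> infer_instance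
    obtain ⟨y, hy, hlt⟩ := Loc.exists_least hA (P := fun y => Q (push y w))
      ⟨.of_d0 hQ'⟩ hz
    obtain ⟨D, hD, hDu⟩ := he.unif (pair (envCode k w) y + 1)
    obtain ⟨s, hs⟩ := hD.exists_stage
    refine ⟨y, Justified.computes (s := s) (.minim _ _ _ ?_ fun z hz => ?_) hD⟩
    · obtain ⟨_, h⟩ := hDu _ (lt_add_one _) 0 ((hF' w y 0).2 (by simp [ind, hy]))
      exact hs _ _ _ _ h
    · obtain ⟨_, h⟩ := hDu _ (lt_succ_iff.2 (pair_le_pair le_rfl hz.le)) 1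
        ((hF' w z 1).2 (by simp [ind, hlt z hz]))
      exact ⟨1, one_ne_zero, hs _ _ _ _ h⟩
  · rintro ⟨y, hy⟩
    have h := he.sound (x := pair (envCode k w) y)
      ⟨_, left_le_pair _ _, _, right_le_pair _ _, rfl, isEnvCode_envCode k w⟩ (computes_minim hy).1
    refine ⟨y, ?_⟩
    by_contra hcon
    rw [hF'] at h
    simp [ind, hcon] at h

theorem Sg.d0_jump {P : (ℕ → M) → Prop} (hP : Sg A 1 P) : D0 (jump A) P := by
  obtain ⟨t, ht, h⟩ := hP.exists_mem_jump hA
  rw [show P = _ from funext fun w => propext (h w)]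
  exact .mem ht

/-- One half of Post's theorem: passing to the jump of the set parameter removes a quantifier. -/
theorem Sg.jump {n : ℕ} {P : (ℕ → M) → Prop} (hP : Sg A (n + 1) P) : Sg (RevRec.jump A) n P := by
  induction n generalizing P with
  | zero => exact .delta0 (hP.d0_jump hA)
  | succ n ih =>
    generalize hm : n + 1 + 1 = m at hP
    induction hP with
    | delta0 => exact absurd hm (Nat.succ_ne_zero _)
    | not hP _ =>
      obtain rfl := Nat.succ.inj hm
      exact .not (ih hP)
    | ex _ h => exact .ex (h hm)

end

end

/-! ### `Δ₁` predicates under `Σ₁` induction -/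

section

variable {M : Type u} [CommSemiring M] [LinearOrder M] [PeanoMinus M]

theorem isTerm_push {t : (ℕ → M) → M} (ht : IsTerm t) {s : ℕ → (ℕ → M) → M}
    (hs : ∀ i, IsTerm (s i)) (i : ℕ) : IsTerm fun w => push (t w) (fun j => s j w) i := by
  cases i with
  | zero => exact ht
  | succ i => exact hs i

theorem D0.subst_push {A : Set M} {Q : (ℕ → M) → Prop} (hQ : D0 A Q) {t : (ℕ → M) → M}
    (ht : IsTerm t) {s : ℕ → (ℕ → M) → M} (hs : ∀ i, IsTerm (s i)) :
    D0 A fun w => Q (push (t w) fun i => s i w) :=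
  hQ.subst (isTerm_push ht hs)

theorem Sg.or {A : Set M} {P Q : (ℕ → M) → Prop} (hP : Sg A 1 P) (hQ : Sg A 1 Q) :
    Sg A 1 fun w => P w ∨ Q w := by
  rw [Sg.one_iff] at *
  obtain ⟨P', hP', h⟩ := hP
  obtain ⟨Q', hQ', h'⟩ := hQ
  have := Dfn.mk hP'
  have := Dfn.mk hQ'
  refine ⟨_, (inferInstance : Dfn (D0 A) fun w => P' w ∨ Q' w).out, fun w => ?_⟩
  rw [h, h', exists_or]

theorem Sg.and {A : Set M} {P Q : (ℕ → M) → Prop} (hP : Sg A 1 P) (hQ : Sg A 1 Q) :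
    Sg A 1 fun w => P w ∧ Q w := by
  rw [Sg.one_iff] at hP hQ
  obtain ⟨P', hP', h⟩ := hP
  obtain ⟨Q', hQ', h'⟩ := hQ
  have := Dfn.mk (hP'.subst_push (.var 1) fun i => .var (i + 2))
  have := Dfn.mk (hQ'.subst_push (.var 0) fun i => .var (i + 2))
  have := Sg.ex (.ex (.of_d0 (inferInstance : Dfn (D0 A) fun w =>
    P' (push (w 1) fun i => w (i + 2)) ∧ Q' (push (w 0) fun i => w (i + 2))).out 1))
  convert this using 2 with w
  rw [h, h']
  constructor
  · rintro ⟨⟨x, hx⟩, y, hy⟩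
    exact ⟨x, y, hx, hy⟩
  · rintro ⟨x, y, hx, hy⟩
    exact ⟨⟨x, hx⟩, y, hy⟩

/-- The induction axiom for `Σ₁` properties. -/
theorem Sg.induction {A : Set M} (hA : ISigma 1 {A}) {P : M → Prop}
    (hP : Dfn (Sg A 1) fun w => P (w 0)) (h0 : P 0) (hs : ∀ x, P x → P (x + 1)) (x : M) : P x :=
  hA A rfl {x | P x} (sigmaSet_iff.2 hP.out) h0 hs x

/-- Collection: a bounded universal quantifier in front of a `Σ₁` predicate. -/
theorem Sg.ball {A : Set M} (hA : ISigma 1 {A}) {t : (ℕ → M) → M} {P : (ℕ → M) → Prop}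
    (ht : IsTerm t) (hP : Sg A 1 P) : Sg A 1 fun w => ∀ x < t w, P (push x w) := by
  obtain ⟨Q, hQ, h⟩ := hP.exists_d0
  refine Sg.one_iff.2 ⟨fun w => ∀ x < t (fun i => w (i + 1)), ∃ z < w 0,
    Q (push z (push x fun i => w (i + 1))), ?_, fun w => ?_⟩
  · have := Dfn.mk (hQ.subst_push (.var 0) (isTerm_push (.var 1) fun i => .var (i + 3)))
    exact (inferInstance : Dfn (D0 A) fun w => ∀ x < t (fun i => w (i + 1)), ∃ z < w 0,
      Q (push z fun i => push x (fun i => w (i + 1)) i)).out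
  · simp only [h]
    constructor
    · intro hw
      have := Dfn.mk (hQ.subst_push (.var 0) (isTerm_push (.var 1) fun i => .const (w i)))
      have hD : Dfn (D0 A) fun v : ℕ → M => ∀ x < v 1, x < t w → ∃ z < v 0,
        Q (push z fun i => push x (fun i => w i) i) := inferInstance
      have key := Sg.induction hA (P := fun u => ∃ b, ∀ x < u, x < t w → ∃ z < b,
        Q (push z (push x w))) ⟨.ex (.of_d0 hD.out 1)⟩
        ⟨0, fun x hx => absurd hx (not_lt.2 zero_le)⟩ (by
          rintro u ⟨b, hb⟩
          by_cases hu : u < t w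
          · obtain ⟨z, hz⟩ := hw u hu
            refine ⟨max b (z + 1), fun x hx hxt => ?_⟩
            rcases (lt_succ_iff.1 hx).lt_or_eq with hx | rfl
            · obtain ⟨z, hzb, hz⟩ := hb x hx hxt
              exact ⟨z, lt_max_of_lt_left hzb, hz⟩
            · exact ⟨z, lt_max_of_lt_right (lt_add_one z), hz⟩
          · refine ⟨b, fun x hx hxt => hb x ?_ hxt⟩
            exact lt_of_le_of_ne (lt_succ_iff.1 hx) fun h => hu (h ▸ hxt)) (t w)
      obtain ⟨b, hb⟩ := key
      exact ⟨b, fun x hx => hb x hx hx⟩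
    · rintro ⟨b, hb⟩ x hx
      obtain ⟨z, _, hz⟩ := hb x hx
      exact ⟨z, hz⟩

/-- The predicates that are `Δ₁` in `A`. -/
def D1 (A : Set M) (P : (ℕ → M) → Prop) : Prop := Sg A 1 P ∧ Sg A 1 fun w => ¬ P w

theorem D1.of_d0 {A : Set M} {P : (ℕ → M) → Prop} (h : D0 A P) : D1 A P :=
  ⟨.of_d0 h 1, .of_d0 (.imp h .falsum) 1⟩

instance (A : Set M) [hA : Fact (ISigma 1 {A})] : Arith (D1 A) where
  falsum := .of_d0 .falsum
  lt h₁ h₂ := .of_d0 (.lt h₁ h₂)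
  eq h₁ h₂ := .of_d0 (.eq h₁ h₂)
  imp h₁ h₂ := by
    constructor
    · convert h₁.2.or h₂.1 using 2
      tauto
    · convert h₁.1.and h₂.2 using 2
      tauto
  ball {t P} ht h := by
    refine ⟨h.1.ball hA.out ht, ?_⟩
    have := (inferInstance : Dfn (D0 A) fun w => w 0 < t fun i => w (i + 1)).out
    convert ((Sg.of_d0 this 1).and h.2).ex using 2 with w
    push Not
    rfl

theorem DeltaSet.d1 {A D : Set M} (h : DeltaSet 1 A D) (t : (ℕ → M) → M) (ht : IsTerm t) :
    D1 A fun w => t w ∈ D :=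
  ⟨(sigmaSet_iff.1 h.1).subst (s := fun _ => t) fun _ => ht,
    (sigmaSet_iff.1 h.2).subst (s := fun _ => t) fun _ => ht⟩

theorem D1.deltaSet {A D : Set M} (h : D1 A fun w => w 0 ∈ D) : DeltaSet 1 A D :=
  ⟨sigmaSet_iff.2 h.1, sigmaSet_iff.2 h.2⟩

theorem deltaSet_of_d0 {A D : Set M} (h : D0 A fun w => w 0 ∈ D) : DeltaSet 1 A D :=
  (D1.of_d0 h).deltaSet

/-- Relativization: what is `Σ₁` in a set that is `Δ₁` in `A` is `Σ₁` in `A`. -/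
theorem Sg.trans {A B : Set M} (hA : ISigma 1 {A}) (hB : DeltaSet 1 A B) {P : (ℕ → M) → Prop}
    (hP : Sg B 1 P) : Sg A 1 P := by
  have := Fact.mk hA
  obtain ⟨Q, hQ, h⟩ := hP.exists_d0
  rw [show P = _ from funext fun w => propext (h w)]
  exact .ex (hQ.le hB.d1).1

theorem DeltaSet.trans {A B D : Set M} (hA : ISigma 1 {A}) (hB : DeltaSet 1 A B)
    (hD : DeltaSet 1 B D) : DeltaSet 1 A D := by
  simp only [DeltaSet, sigmaSet_iff] at hD ⊢
  exact ⟨hD.1.trans hA hB, hD.2.trans hA hB⟩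

/-- A set parameter may be replaced by one in which it is `Δ₀`. -/
theorem Sg.of_d0_param {A B : Set M} (hB : D0 A fun w => w 0 ∈ B) {n : ℕ} {P : (ℕ → M) → Prop}
    (hP : Sg B n P) : Sg A n P := by
  induction hP with
  | delta0 h => exact .delta0 (h.le fun t ht => hB.subst (s := fun _ => t) fun _ => ht)
  | not _ h => exact .not h
  | ex _ h => exact .ex h

theorem DeltaSet.of_d0_param {A B D : Set M} (hB : D0 A fun w => w 0 ∈ B) {n : ℕ}
    (hD : DeltaSet n B D) : DeltaSet n A D := by
  simp only [DeltaSet, sigmaSet_iff] at hD ⊢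
  exact ⟨hD.1.of_d0_param hB, hD.2.of_d0_param hB⟩

theorem Sg.of_one {A : Set M} {n : ℕ} {P : (ℕ → M) → Prop} (hP : Sg A 1 P) : Sg A (n + 1) P := by
  obtain ⟨Q, hQ, h⟩ := hP.exists_d0
  rw [show P = _ from funext fun w => propext (h w)]
  exact .ex (.of_d0 hQ _)

theorem DeltaSet.of_one {A D : Set M} {n : ℕ} (h : DeltaSet 1 A D) : DeltaSet (n + 1) A D := by
  simp only [DeltaSet, sigmaSet_iff] at h ⊢
  exact ⟨h.1.of_one, h.2.of_one⟩

theorem ISigma.zero_of_one {A : Set M} (h : ISigma 1 {A}) : ISigma 0 {A} := by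
  rintro _ rfl D hD
  rw [sigmaSet_iff] at hD
  cases hD with
  | delta0 hD => exact h _ rfl D (sigmaSet_iff.2 (.of_d0 hD 1))

/-! ### Definability of computations -/

/-- The finite set coded by `c`. -/
def bits (c : M) : Set M := {x | Bit x c}

theorem mfinite_iff {D : Set M} : MFinite D ↔ ∃ c, D = bits c :=
  exists_congr fun _ => Set.ext_iff.symm

theorem mem_join {A B : Set M} {x : M} :
    x ∈ join A B ↔ (∃ a ≤ x, a ∈ A ∧ x = 2 * a) ∨ ∃ b ≤ x, b ∈ B ∧ x = 2 * b + 1 := by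
  have h (a : M) : a ≤ 2 * a := by rw [mul_comm]; exact self_le_mul_of_pos (by norm_num)
  constructor
  · rintro (⟨a, ha, rfl⟩ | ⟨b, hb, rfl⟩)
    · exact Or.inl ⟨a, h a, ha, rfl⟩
    · exact Or.inr ⟨b, (h b).trans (lt_add_one _).le, hb, rfl⟩
  · rintro (⟨a, -, h⟩ | ⟨b, -, h⟩)
    · exact Or.inl ⟨a, h⟩
    · exact Or.inr ⟨b, h⟩

theorem two_mul_mem_join {A B : Set M} {x : M} : 2 * x ∈ join A B ↔ x ∈ A := by
  constructor
  · rintro (⟨a, ha, h⟩ | ⟨b, hb, h⟩)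
    · rwa [mul_left_cancel₀ two_ne_zero h]
    · exact absurd h (even_ne_odd x b)
  · exact fun h => Or.inl ⟨x, h, rfl⟩

theorem two_mul_add_one_mem_join {A B : Set M} {x : M} : 2 * x + 1 ∈ join A B ↔ x ∈ B := by
  constructor
  · rintro (⟨a, ha, h⟩ | ⟨b, hb, h⟩)
    · exact absurd h.symm (even_ne_odd a x)
    · rwa [mul_left_cancel₀ two_ne_zero (add_right_cancel h)]
  · exact fun h => Or.inr ⟨x, h, rfl⟩

theorem d0_join_left (A B : Set M) : D0 (join A B) fun w => w 0 ∈ A := by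
  simp only [← two_mul_mem_join (A := A) (B := B)]
  exact .mem inferInstance

theorem d0_join_right (A B : Set M) : D0 (join A B) fun w => w 0 ∈ B := by
  simp only [← two_mul_add_one_mem_join (A := A) (B := B)]
  exact .mem inferInstance

/-- Membership in the sets of the family `O` belongs to the class `K`. -/
class DfnFamily (K : ((ℕ → M) → Prop) → Prop) (O : M → Set M) : Prop where
  out (s t : (ℕ → M) → M) : IsTerm s → IsTerm t → K fun w => s w ∈ O (t w)

instance {K : ((ℕ → M) → Prop) → Prop} {O : M → Set M} [h : DfnFamily K O] {s t : (ℕ → M) → M}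
    [hs : IsTerm s] [ht : IsTerm t] : Dfn K fun w => s w ∈ O (t w) :=
  ⟨h.out s t hs ht⟩

section

variable {K : ((ℕ → M) → Prop) → Prop} [Arith K] [HasPow K]

instance {s c : (ℕ → M) → M} [IsTerm s] [IsTerm c] : Dfn K fun w => s w ∈ bits (c w) :=
  inferInstanceAs (Dfn K fun w => Bit (s w) (c w))

instance {O : M → Set M} [DfnFamily K O] : DfnFamily K fun c => join (O c) (bits c) where
  out s t _ _ := by
    simp only [mem_join]
    have : Dfn K fun w => (∃ a ≤ s w, a ∈ O (t w) ∧ s w = 2 * a) ∨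
      ∃ b ≤ s w, b ∈ bits (t w) ∧ s w = 2 * b + 1 := inferInstance
    exact this.out

instance {c s e x y : (ℕ → M) → M} [IsTerm c] [IsTerm s] [IsTerm e] [IsTerm x] [IsTerm y] :
    Dfn K fun w => Before (bits (c w)) (s w) (e w) (x w) (y w) := by
  unfold Before
  infer_instance

variable [hM : Elementary M]

theorem Before.lt {c s e x y : M} (h : Before (bits c) s e x y) : x < c ∧ y < c := by
  obtain ⟨t, _, h⟩ := h
  have hl := le_line t e x y
  exact ⟨hl.2.2.1.trans_lt (Bit.lt h), hl.2.2.2.trans_lt (Bit.lt h)⟩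

set_option synthInstance.maxHeartbeats 400000 in
set_option synthInstance.maxSize 2000 in
instance {O : M → Set M} [DfnFamily K O] {p c s e x y : (ℕ → M) → M} [IsTerm p] [IsTerm c]
    [IsTerm s] [IsTerm e] [IsTerm x] [IsTerm y] :
    Dfn K fun w => Justified (O (p w)) (bits (c w)) (s w) (e w) (x w) (y w) := by
  have h1 (c s f g x y : M) : (∃ u, Before (bits c) s g x u ∧ Before (bits c) s f u y) ↔
      ∃ u < c, Before (bits c) s g x u ∧ Before (bits c) s f u y :=
    exists_congr fun u => ⟨fun h => ⟨h.1.lt.2, h⟩, fun h => h.2⟩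
  have h2 (c s f x z : M) : (∃ v, v ≠ 0 ∧ Before (bits c) s f (pair x z) v) ↔
      ∃ v < c, v ≠ 0 ∧ Before (bits c) s f (pair x z) v :=
    exists_congr fun u => ⟨fun h => ⟨h.2.lt.2, h⟩, fun h => h.2⟩
  simp only [justified_iff, h1, h2]
  infer_instance

theorem isComputation_bits {A : Set M} {c : M} : IsComputation A (bits c) ↔
    ∀ z < c, z ∈ bits c → ∀ s ≤ z, ∀ e ≤ z, ∀ x ≤ z, ∀ y ≤ z, z = Line s e x y →
      Justified A (bits c) s e x y := by
  constructor
  · rintro ⟨_, h⟩ _ _ hz s _ e _ x _ y _ rfl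
    exact h s e x y hz
  · intro h
    refine ⟨⟨c, fun x => Iff.rfl⟩, fun s e x y hl => ?_⟩
    have := le_line s e x y
    exact h _ (Bit.lt hl) hl s this.1 e this.2.1 x this.2.2.1 y this.2.2.2 rfl

instance instDfnIsComputation {O : M → Set M} [DfnFamily K O] {p c : (ℕ → M) → M} [IsTerm p]
    [IsTerm c] : Dfn K fun w => IsComputation (O (p w)) (bits (c w)) := by
  simp only [isComputation_bits]
  infer_instance

end

theorem sg_isPow2 (A : Set M) {x p : (ℕ → M) → M} (hx : IsTerm x) (hp : IsTerm p) :
    Sg A 1 fun w => IsPow2 (x w) (p w) := by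
  have h := Sg.ex (.ex (.of_d0 (inferInstance : Dfn (D0 A) fun w =>
    PowSeq (w 1) (w 0) (x fun i => w (i + 2)) ∧
      Beta (w 1) (w 0) (x fun i => w (i + 2)) (p fun i => w (i + 2))).out 1))
  convert h using 2 with w
  rw [isPow2_iff_powSeq]
  rfl

section

variable [hM : Elementary M]

/-- The graph of exponentiation is `Σ₁`, and so is its complement, as exponentiation is total. -/
instance (A : Set M) [Fact (ISigma 1 {A})] : HasPow (D1 A) where
  out {x p} hx hp := by
    refine ⟨sg_isPow2 A hx hp, ?_⟩
    have hx' : Sg A 1 fun w => IsPow2 (x fun i => w (i + 1)) (w 0) :=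
      sg_isPow2 A (hx.subst _ fun i => .var (i + 1)) (.var 0)
    have h' := Sg.ex (hx'.and (.of_d0
      (inferInstance : Dfn (D0 A) fun w => w 0 ≠ p fun i => w (i + 1)).out 1))
    convert h' using 2 with w
    constructor
    · exact fun hw => ⟨pow2 (x w), isPow2_pow2 _, fun heq => hw (isPow2_iff.2 heq.symm)⟩
    · rintro ⟨q, hq, hne⟩ hw
      exact hne (hq.unique hw)

theorem computes_iff {A : Set M} {e x y : M} : Computes A e x y ↔
    ∃ c, IsComputation A (bits c) ∧ ∃ s < c, Line s e x y ∈ bits c := by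
  constructor
  · rintro ⟨D, hD, s, hs⟩
    obtain ⟨c, rfl⟩ := mfinite_iff.1 hD.1
    exact ⟨c, hD, s, (le_line s e x y).1.trans_lt (Bit.lt hs), hs⟩
  · rintro ⟨c, hc, s, _, hs⟩
    exact ⟨_, hc, s, hs⟩

/-- The jump of a set that is `Δ₁` in `A` is `Σ₁` in `A`. -/
theorem sg_jump {A B : Set M} (hA : ISigma 1 {A}) (hB : DeltaSet 1 A B) :
    Sg A 1 fun w => w 0 ∈ jump B := by
  have := Fact.mk hA
  have : DfnFamily (D1 A) fun _ => B := ⟨fun s _ hs _ => hB.d1 s hs⟩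
  have : Dfn (D1 A) fun w => IsComputation B (bits (w 0)) :=
    instDfnIsComputation (O := fun _ => B) (p := fun _ => 0)
  have h : Dfn (D1 A) fun w => IsComputation B (bits (w 0)) ∧
    ∃ s < w 0, Line s (w 2) (w 2) (w 1) ∈ bits (w 0) := inferInstance
  convert Sg.ex (.ex h.out.1) using 2 with w
  exact exists_congr fun y => computes_iff

theorem ISigma.one_of_jump {A : Set M} (h : ISigma 0 {jump A}) : ISigma 1 {A} := by
  rintro _ rfl D hD
  refine h _ rfl D (sigmaSet_iff.2 ?_)
  exact (sigmaSet_iff.1 hD).jump h.of_jump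

/-- The jump is monotone: if `B` is `Δ₁` in `A`, then a polynomial reduces `B'` to `A'`. -/
theorem exists_jump_iff {A B : Set M} (hA : ISigma 0 {jump A}) (hB : DeltaSet 1 A B) :
    ∃ t : (ℕ → M) → M, IsTerm t ∧ ∀ w, w 0 ∈ jump B ↔ t w ∈ jump A :=
  (sg_jump hA.one_of_jump hB).exists_mem_jump hA.of_jump

theorem d0_jump_of_deltaSet {A B : Set M} (hA : ISigma 0 {jump A}) (hB : DeltaSet 1 A B) :
    D0 (jump A) fun w => w 0 ∈ jump B :=
  (sg_jump hA.one_of_jump hB).d0_jump hA.of_jump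

end

end

/-! ### Forcing the jump -/

section

variable {M : Type u} [CommSemiring M] [LinearOrder M] [PeanoMinus M]

/-- The class `K` contains all predicates that are `Σ₁` in `A`. -/
class HasSigma (A : Set M) (K : ((ℕ → M) → Prop) → Prop) : Prop where
  out {P : (ℕ → M) → Prop} : Sg A 1 P → K P

theorem HasSigma.hasPow {A : Set M} {K : ((ℕ → M) → Prop) → Prop} (h : HasSigma A K) : HasPow K :=
  ⟨fun hx hp => h.out (sg_isPow2 A hx hp)⟩

/-- The sets `S` and `T` have the same elements below `m`. -/
def Agree (S T : Set M) (m : M) : Prop := ∀ x < m, x ∈ S ↔ x ∈ T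

theorem Agree.symm {S T : Set M} {m : M} (h : Agree S T m) : Agree T S m :=
  fun x hx => (h x hx).symm

theorem Agree.trans {S T U : Set M} {m : M} (h : Agree S T m) (h' : Agree T U m) : Agree S U m :=
  fun x hx => (h x hx).trans (h' x hx)

theorem Agree.mono {S T : Set M} {m n : M} (h : Agree S T m) (hn : n ≤ m) : Agree S T n :=
  fun x hx => h x (hx.trans_le hn)

instance {K : ((ℕ → M) → Prop) → Prop} [Arith K] {O O' : M → Set M} [DfnFamily K O]
    [DfnFamily K O'] {p q m : (ℕ → M) → M} [IsTerm p] [IsTerm q] [IsTerm m] :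
    Dfn K fun w => Agree (O (p w)) (O' (q w)) (m w) := by
  unfold Agree
  infer_instance

instance {K : ((ℕ → M) → Prop) → Prop} [Arith K] [HasPow K] : DfnFamily K (bits (M := M)) where
  out s t _ _ := (inferInstance : Dfn K fun w => Bit (s w) (t w)).out

/-- The string of length `m` whose entries are the bits of `t` decides that `e` belongs to the jump
of the join of `A` and any set that extends the string. -/
def Conv (A : Set M) (e t m : M) : Prop :=
  ∃ c < m, IsComputation (join A (bits t)) (bits c) ∧ ∃ s < c, ∃ y < c, Line s e e y ∈ bits c

/-- Some string that extends `(t, m)` decides that `e` belongs to the jump. -/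
def CanConv (A : Set M) (e t m : M) : Prop :=
  ∃ t' m', m ≤ m' ∧ Agree (bits t') (bits t) m ∧ Conv A e t' m'

theorem Justified.congr_oracle {A A' D : Set M} {s e x y : M} (h : Justified A D s e x y)
    (hA : x ∈ A ↔ x ∈ A') : Justified A' D s e x y := by
  rw [justified_iff] at h ⊢
  rwa [← hA]

variable [hM : Elementary M]

theorem IsComputation.congr_oracle {A A' : Set M} {c : M} (h : IsComputation A (bits c))
    (hA : Agree A A' c) : IsComputation A' (bits c) :=
  ⟨h.1, fun s e x y hl => (h.2 s e x y hl).congr_oracle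
    (hA x ((le_line s e x y).2.2.1.trans_lt (Bit.lt hl)))⟩

theorem Agree.join {A S T : Set M} {m : M} (h : Agree S T m) : Agree (join A S) (join A T) m := by
  intro x hx
  rw [mem_join, mem_join]
  refine or_congr_right (exists_congr fun b => and_congr_right fun hb => ?_)
  rw [h b (hb.trans_lt hx)]

theorem Conv.mono {A : Set M} {e t t' m m' : M} (h : Conv A e t m) (hm : m ≤ m')
    (ht : Agree (bits t) (bits t') m) : Conv A e t' m' := by
  obtain ⟨c, hc, h, h'⟩ := h
  exact ⟨c, hc.trans_le hm, h.congr_oracle (ht.mono hc.le).join, h'⟩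

theorem Conv.mem_jump {A B : Set M} {e t m : M} (h : Conv A e t m)
    (ht : Agree (bits t) B m) : e ∈ jump (RevRec.join A B) := by
  obtain ⟨c, hc, h, s, hs, y, _, hl⟩ := h
  exact ⟨y, computes_iff.2 ⟨c, h.congr_oracle (ht.mono hc.le).join, s, hs, hl⟩⟩

theorem exists_conv {A B : Set M} {e : M} (h : e ∈ jump (join A B)) :
    ∃ c, ∀ t m, c < m → Agree B (bits t) m → Conv A e t m := by
  obtain ⟨y, hy⟩ := h
  obtain ⟨c, hc, s, hs, hl⟩ := computes_iff.1 hy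
  exact ⟨c, fun t m hm ht => ⟨c, hm, hc.congr_oracle (ht.mono hm.le).join, s, hs, y,
    (le_line s e e y).2.2.2.trans_lt (Bit.lt hl), hl⟩⟩

section

variable {A : Set M} [hA : Fact (ISigma 1 {A})]

instance : DfnFamily (D1 A) fun c => join A (bits c) :=
  have : DfnFamily (D1 A) fun _ => A := ⟨fun _ _ hs _ => .of_d0 (.mem hs)⟩
  inferInstanceAs (DfnFamily (D1 A) fun c => join ((fun _ => A) c) (bits c))

instance dfn_conv_d1 {e t m : (ℕ → M) → M} [IsTerm e] [IsTerm t] [IsTerm m] :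
    Dfn (D1 A) fun w => Conv A (e w) (t w) (m w) := by
  unfold Conv
  have : Dfn (D1 A) fun w => IsComputation (join A (bits (t fun i => w (i + 1)))) (bits (w 0)) :=
    instDfnIsComputation (O := fun c => join A (bits c)) (p := fun w => t fun i => w (i + 1))
  infer_instance

variable {K : ((ℕ → M) → Prop) → Prop} [hK : HasSigma A K]

instance dfn_conv {e t m : (ℕ → M) → M} [IsTerm e] [IsTerm t] [IsTerm m] :
    Dfn K fun w => Conv A (e w) (t w) (m w) :=
  ⟨hK.out dfn_conv_d1.out.1⟩

instance dfn_canConv {e t m : (ℕ → M) → M} [IsTerm e] [IsTerm t] [IsTerm m] :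
    Dfn K fun w => CanConv A (e w) (t w) (m w) := by
  have h : Dfn (D1 A) fun w => m (fun i => w (i + 2)) ≤ w 0 ∧
    Agree (bits (w 1)) (bits (t fun i => w (i + 2))) (m fun i => w (i + 2)) ∧
      Conv A (e fun i => w (i + 2)) (w 1) (w 0) := inferInstance
  exact ⟨hK.out (.ex (.ex h.out.1))⟩

end

/-- The string `(t, m)` properly extends the initial segment of `S` of length `l`, and decides the
jump below `l`. -/
def Forces (A S : Set M) (l t m : M) : Prop :=
  l < m ∧ t < pow2 m ∧ Agree (bits t) S l ∧ ∀ e < l, Conv A e t m ∨ ¬ CanConv A e t m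

/-- The string `(t, m)` is the one with the least code that decides the jump below `l` and properly
extends the initial segment of `S` of length `l`. -/
def Next (A S : Set M) (l t m : M) : Prop :=
  Forces A S l t m ∧
    ∀ t' ≤ pair t m, ∀ m' ≤ pair t m, pair t' m' < pair t m → ¬ Forces A S l t' m'

theorem Forces.congr {A S S' : Set M} {l t m : M} (h : Forces A S l t m) (hS : Agree S S' l) :
    Forces A S' l t m :=
  ⟨h.1, h.2.1, h.2.2.1.trans hS, h.2.2.2⟩

theorem Next.congr {A S S' : Set M} {l t m : M} (h : Next A S l t m) (hS : Agree S S' l) :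
    Next A S' l t m :=
  ⟨h.1.congr hS, fun t' ht m' hm hlt h' => h.2 t' ht m' hm hlt (h'.congr hS.symm)⟩

theorem Next.unique {A S : Set M} {l t m t' m' : M} (h : Next A S l t m) (h' : Next A S l t' m') :
    t = t' ∧ m = m' := by
  rw [← pair_inj]
  refine le_antisymm (not_lt.1 fun hlt => ?_) (not_lt.1 fun hlt => ?_)
  · exact h.2 t' ((left_le_pair _ _).trans hlt.le) m' ((right_le_pair _ _).trans hlt.le) hlt h'.1
  · exact h'.2 t ((left_le_pair _ _).trans hlt.le) m ((right_le_pair _ _).trans hlt.le) hlt h.1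

section

variable {A : Set M} [hA : Fact (ISigma 1 {A})] {K : ((ℕ → M) → Prop) → Prop} [Arith K] [HasPow K]

instance {t m : (ℕ → M) → M} [IsTerm t] [IsTerm m] : Dfn K fun w => t w < pow2 (m w) :=
  Dfn.congr (Q := fun w => ∀ p ≤ t w, ¬ IsPow2 (m w) p) inferInstance fun w => by
    simp only [isPow2_iff]
    exact ⟨fun h p hp heq => absurd (heq ▸ hp) (not_le.2 h), fun h => not_le.1 fun hp => h _ hp rfl⟩

variable [hK : HasSigma A K] {O : M → Set M} [DfnFamily K O] {p l t m : (ℕ → M) → M} [IsTerm p]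
  [IsTerm l] [IsTerm t] [IsTerm m]

instance : Dfn K fun w => Forces A (O (p w)) (l w) (t w) (m w) := by
  unfold Forces
  infer_instance

instance instDfnNext : Dfn K fun w => Next A (O (p w)) (l w) (t w) (m w) := by
  unfold Next
  infer_instance

end

section

variable {A : Set M} [hA : Fact (ISigma 1 {A})]

instance (A : Set M) [hA : Fact (ISigma 0 {jump A})] : HasSigma A (Loc (jump A)) :=
  ⟨fun h => .of_d0 (h.d0_jump hA.out.of_jump)⟩

/-- The predicate that some string extending the string `(s, l)` puts into the jump all bits
of `f`, and also `j` if it is below `l`. -/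
def Attains (A : Set M) (s l f j : M) : Prop :=
  ∃ t m, l < m ∧ Agree (bits t) (bits s) l ∧ ∀ e < l, Bit e f ∨ e = j → Conv A e t m

instance {K : ((ℕ → M) → Prop) → Prop} [hK : HasSigma A K] {s l f j : (ℕ → M) → M} [IsTerm s]
    [IsTerm l] [IsTerm f] [IsTerm j] : Dfn K fun w => Attains A (s w) (l w) (f w) (j w) := by
  have h : Dfn (D1 A) fun w => l (fun i => w (i + 2)) < w 0 ∧
    Agree (bits (w 1)) (bits (s fun i => w (i + 2))) (l fun i => w (i + 2)) ∧
      ∀ e < l fun i => w (i + 2), Bit e (f fun i => w (i + 2)) ∨ e = j (fun i => w (i + 2)) →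
        Conv A e (w 1) (w 0) := inferInstance
  exact ⟨hK.out (.ex (.ex h.out.1))⟩

/-- Every string has an extension that decides the jump below its length: extend it so as to put a
maximal set of numbers into the jump. -/
theorem exists_forces [hA' : Fact (ISigma 0 {jump A})] (s l : M) :
    ∃ t m, Forces A (bits s) l t m := by
  -- The number `l` stands for a vacuous `j`, as only numbers below `l` matter.
  obtain ⟨f, _, ⟨t, m, hm, ht, hf⟩, hmax⟩ := Loc.induction hA'.out
    (P := fun j => ∃ f < pow2 l, Attains A s l f l ∧
      ∀ e < j, e < l → ¬ Bit e f → ¬ Attains A s l f e) inferInstance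
    ⟨0, pow2_pos l, ⟨s, l + 1, lt_add_one l, fun _ _ => Iff.rfl, fun e he h =>
      (h.resolve_left (bit_zero e) ▸ he).ne rfl |>.elim⟩, fun e he => absurd he (not_lt.2 zero_le)⟩
    (by
      rintro j ⟨f, hfl, hf, hmax⟩
      by_cases hj : j < l ∧ ¬ Bit j f ∧ Attains A s l f j
      · obtain ⟨hjl, _, t, m, hm, ht, hc⟩ := hj
        obtain ⟨f', hfl', hf'⟩ := exists_code hM.induction (P := fun e => Bit e f ∨ e = j)
          inferInstance l
        refine ⟨f', hfl', ⟨t, m, hm, ht, fun e he h => hc e he ?_⟩, fun e he hel hef => ?_⟩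
        · exact ((hf' e).1 (h.resolve_right he.ne)).2
        · have hne : ¬ (Bit e f ∨ e = j) := fun h => hef ((hf' e).2 ⟨hel, h⟩)
          rintro ⟨t, m, hm, ht, hc⟩
          refine hmax e (lt_of_le_of_ne (lt_succ_iff.1 he) fun h => hne (Or.inr h)) hel
            (fun h => hne (Or.inl h)) ⟨t, m, hm, ht, fun e' he' h => hc e' he' ?_⟩
          exact h.imp_left fun h => (hf' e').2 ⟨he', Or.inl h⟩
      · refine ⟨f, hfl, hf, fun e he hel hef hat => ?_⟩
        rcases (lt_succ_iff.1 he).lt_or_eq with he | rfl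
        · exact hmax e he hel hef hat
        · exact hj ⟨hel, hef, hat⟩) l
  obtain ⟨t', ht', htt⟩ := exists_code hM.induction (P := fun x => Bit x t) inferInstance m
  have htt' : Agree (bits t) (bits t') m := fun x hx => ⟨fun h => (htt x).2 ⟨hx, h⟩,
    fun h => ((htt x).1 h).2⟩
  refine ⟨t', m, hm, ht', (htt'.symm.mono hm.le).trans ht, fun e he => ?_⟩
  by_cases hef : Bit e f
  · exact Or.inl ((hf e he (Or.inl hef)).mono le_rfl htt')
  · refine Or.inr ?_
    rintro ⟨u, n, hn, hu, hc⟩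
    refine hmax e he he hef ⟨u, n, hm.trans_le hn,
      (hu.mono hm.le).trans ((htt'.symm.mono hm.le).trans ht), fun e' he' h => ?_⟩
    rcases h with h | rfl
    · exact (hf e' he' (Or.inl h)).mono hn (htt'.trans hu.symm)
    · exact hc

theorem exists_next [hA' : Fact (ISigma 0 {jump A})] (s l : M) :
    ∃ t m, Next A (bits s) l t m := by
  obtain ⟨t, m, h⟩ := exists_forces (A := A) s l
  obtain ⟨_, ⟨t, _, m, _, rfl, h⟩, hmin⟩ := Loc.exists_least hA'.out
    (P := fun u => ∃ t ≤ u, ∃ m ≤ u, u = pair t m ∧ Forces A (bits s) l t m) inferInstance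
    (a := pair t m) ⟨t, left_le_pair _ _, m, right_le_pair _ _, rfl, h⟩
  exact ⟨t, m, h, fun t' _ m' _ hlt h' => hmin _ hlt
    ⟨t', left_le_pair _ _, m', right_le_pair _ _, rfl, h'⟩⟩

end

end

/-! ### Jump inversion -/

section

variable {M : Type u} [CommSemiring M] [LinearOrder M] [PeanoMinus M] [hM : Elementary M]

/-- Up to `b`, the set `S` is built by blocks, and `L` is the set of the ends of blocks. After a
block that ends at `l` there comes the part of the string `(t, m) = Next A S l` from `l` on,
and then a part of length `l`, whose entries satisfy `T`: `T (m + x) x` is a condition on the entry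
with number `x` of that part. The codes `t` are smaller than `u`. -/
def Chain (A S L : Set M) (b u : M) (T : M → M → Prop) : Prop :=
  0 ∈ L ∧ b ∈ L ∧ ∀ l < b, l ∈ L → ∃ l' ≤ b, l < l' ∧ l' ∈ L ∧ (∀ x < l', l < x → ¬ x ∈ L) ∧
    ∃ t < u, ∃ m ≤ b, Next A S l t m ∧ l' = m + l ∧ Agree S (bits t) m ∧ ∀ x < l, T (m + x) x

theorem Chain.congr {A S S' L : Set M} {b u : M} {T T' : M → M → Prop} (h : Chain A S L b u T)
    (hS : Agree S S' b) (hT : ∀ p < b, ∀ x, T p x → T' p x) : Chain A S' L b u T' := by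
  refine ⟨h.1, h.2.1, fun l hl hlL => ?_⟩
  obtain ⟨l', hl', hlt, hl'L, hno, t, ht, m, hm, hnext, rfl, hagree, hTx⟩ := h.2.2 l hl hlL
  refine ⟨_, hl', hlt, hl'L, hno, t, ht, m, hm, hnext.congr (hS.mono hl.le), rfl,
    (hS.symm.mono hm).trans hagree, fun x hx => hT _ ?_ _ (hTx x hx)⟩
  exact lt_of_lt_of_le (by gcongr) hl'

/-- Two chains coincide as far as both go, when the entries not determined by `Next` do. -/
theorem Chain.compare {A Z S S' L L' : Set M} {b b' u u' : M} {T T' : M → M → Prop}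
    (hZ : ISigma 0 {Z}) [Dfn (Loc Z) fun w => w 0 ∈ S] [Dfn (Loc Z) fun w => w 0 ∈ S']
    [Dfn (Loc Z) fun w => w 0 ∈ L] [Dfn (Loc Z) fun w => w 0 ∈ L']
    (h : Chain A S L b u T) (h' : Chain A S' L' b' u' T') (hb : b ≤ b')
    (hT : ∀ p x, T p x → T' p x → (p ∈ S ↔ p ∈ S')) : Agree S S' b ∧ Agree L L' (b + 1) := by
  obtain ⟨l, hlb, ⟨hl, hl', hSl, hLl⟩, hmax⟩ := Loc.exists_greatest hZ
    (P := fun l => l ∈ L ∧ l ∈ L' ∧ (∀ x < l, x ∈ S ↔ x ∈ S') ∧ ∀ x < l + 1, x ∈ L ↔ x ∈ L')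
    inferInstance (a := 0) (b := b) ⟨h.1, h'.1, fun x hx => absurd hx (not_lt.2 zero_le),
      fun x hx => by
        obtain rfl := nonpos_iff_eq_zero.1 (lt_succ_iff.1 hx)
        exact iff_of_true h.1 h'.1⟩ zero_le
  rcases hlb.eq_or_lt with rfl | hlb
  · exact ⟨hSl, hLl⟩
  · exfalso
    obtain ⟨l₁, hl₁, hlt, hlL, hno, t, ht, m, hm, hnext, rfl, hagree, hTx⟩ := h.2.2 l hlb hl
    obtain ⟨l₂, hl₂, hlt', hlL', hno', t', ht', m', hm', hnext', rfl, hagree', hTx'⟩ :=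
      h'.2.2 l (hlb.trans_le hb) hl'
    obtain ⟨rfl, rfl⟩ := (hnext.congr hSl).unique hnext'
    refine absurd (hmax _ hl₁ ⟨hlL, hlL', fun x hx => ?_, fun x hx => ?_⟩) (not_le.2 hlt)
    · rcases lt_or_ge x m with hxm | hxm
      · exact (hagree x hxm).trans (hagree' x hxm).symm
      · obtain ⟨y, rfl⟩ := exists_add_of_le hxm
        have hy : y < l := lt_of_add_lt_add_left hx
        exact hT _ _ (hTx y hy) (hTx' y hy)
    · rcases lt_or_ge x (l + 1) with hxl | hxl
      · exact hLl x hxl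
      · have hxl' : l < x := (lt_add_one l).trans_le hxl
        rcases (lt_succ_iff.1 hx).lt_or_eq with hx | rfl
        · exact iff_of_false (hno x hx hxl') (hno' x hx hxl')
        · exact iff_of_true hlL hlL'

theorem pow2_mono {x y : M} (h : x ≤ y) : pow2 x ≤ pow2 y := by
  rcases h.eq_or_lt with rfl | h
  · exact le_rfl
  · exact (pow2_lt_pow2 h).le

/-- The numbers `s` and `l` code a finite chain with end `b`, in which the entries not
determined by `Next` are those of `C`. -/
def Hist (A C : Set M) (s l b u : M) : Prop :=
  Chain A (bits s) (bits l) b u fun p x => p ∈ bits s ↔ x ∈ C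

section

variable {A C : Set M} [hA : Fact (ISigma 1 {A})] [hA' : Fact (ISigma 0 {jump A})]

instance : HasSigma A (D0 (join (jump A) C)) :=
  ⟨fun h => (h.d0_jump hA'.out.of_jump).le fun t ht =>
    (d0_join_left (jump A) C).subst (s := fun _ => t) fun _ => ht⟩

instance : HasPow (D0 (join (jump A) C)) :=
  (inferInstance : HasSigma A (D0 (join (jump A) C))).hasPow

instance {t : (ℕ → M) → M} [ht : IsTerm t] : Dfn (D0 (join (jump A) C)) fun w => t w ∈ C :=
  ⟨(d0_join_right (jump A) C).subst (s := fun _ => t) fun _ => ht⟩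

set_option synthInstance.maxHeartbeats 400000 in
set_option synthInstance.maxSize 2000 in
instance {s l b u : (ℕ → M) → M} [IsTerm s] [IsTerm l] [IsTerm b] [IsTerm u] :
    Dfn (D0 (join (jump A) C)) fun w => Hist A C (s w) (l w) (b w) (u w) := by
  simp only [Hist, Chain]
  infer_instance

theorem Hist.compare {s l b u s' l' b' u' : M} (h : Hist A C s l b u) (h' : Hist A C s' l' b' u')
    (hb : b ≤ b') : Agree (bits s) (bits s') b :=
  (Chain.compare hM.induction h h' hb fun _ _ h h' => h.trans h'.symm).1

/-- A history is prolonged by one block; the codes of the longer history are below explicit bounds,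
which keeps the induction in `exists_hist` within `Δ₀`. -/
theorem Hist.extend (hW : ISigma 0 {join (jump A) C}) {s l b u : M} (h : Hist A C s l b u) :
    ∃ s' l' b', s' < pow2 b' ∧ l' < pow2 (b' + 1) ∧ b < b' ∧ b ∈ bits l' ∧
      Hist A C s' l' b' (pow2 b') := by
  obtain ⟨t, m, hnext⟩ := exists_next (A := A) s b
  obtain ⟨s', hs', hs⟩ := exists_code hW (P := fun x => x < m ∧ x ∈ bits t ∨
    ∃ y < b, x = m + y ∧ y ∈ C)
    ⟨.of_d0 (inferInstance : Dfn (D0 (join (jump A) C)) fun w => w 0 < m ∧ w 0 ∈ bits t ∨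
      ∃ y < b, w 0 = m + y ∧ y ∈ C).out⟩ (m + b)
  obtain ⟨l', hl', hl⟩ := exists_code hM.induction (P := fun x => x ≤ b ∧ x ∈ bits l ∨ x = m + b)
    inferInstance (m + b + 1)
  have hbm : b < m := hnext.1.1
  have hbb : b < m + b := hbm.trans_le (le_add_of_nonneg_right zero_le)
  have hmb : m ≤ m + b := le_add_of_nonneg_right zero_le
  have hs't : Agree (bits s') (bits t) m := fun x hx => by
    refine (hs x).trans ⟨?_, fun h => ⟨hx.trans_le hmb, Or.inl ⟨hx, h⟩⟩⟩
    rintro ⟨_, h | ⟨y, _, rfl, _⟩⟩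
    · exact h.2
    · exact absurd hx (not_lt.2 (le_add_of_nonneg_right zero_le))
  have hs'C (y : M) (hy : y < b) : m + y ∈ bits s' ↔ y ∈ C := by
    refine (hs _).trans ⟨?_, fun h => ⟨by gcongr, Or.inr ⟨y, hy, rfl, h⟩⟩⟩
    rintro ⟨_, h | ⟨z, _, hz, h⟩⟩
    · exact absurd h.1 (not_lt.2 (le_add_of_nonneg_right zero_le))
    · rwa [add_left_cancel hz]
  have hs's : Agree (bits s) (bits s') b := ((hs't.mono hbm.le).trans hnext.1.2.2.1).symm
  have hll (x : M) (hx : x ≤ b) : x ∈ bits l' ↔ x ∈ bits l := by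
    refine (hl x).trans ⟨?_, fun h => ⟨(hx.trans_lt hbb).trans (lt_add_one _), Or.inl ⟨hx, h⟩⟩⟩
    rintro ⟨_, h | rfl⟩
    · exact h.2
    · exact absurd hx (not_le.2 hbb)
  have hend : m + b ∈ bits l' := (hl _).2 ⟨lt_add_one _, Or.inr rfl⟩
  refine ⟨s', l', m + b, hs', hl', hbb, (hll b le_rfl).2 h.2.1, (hll 0 zero_le).2 h.1, hend, ?_⟩
  have h' := Chain.congr (S' := bits s') (T' := fun p x => p ∈ bits s' ↔ x ∈ C) h hs's
    fun p hp x hx => (hs's p hp).symm.trans hx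
  intro k hk hkl
  have hkb : k ≤ b := by
    rcases ((hl k).1 hkl).2 with h | h
    · exact h.1
    · exact absurd hk (not_lt.2 h.ge)
  rcases hkb.lt_or_eq with hkb | rfl
  · obtain ⟨k', hk', hlt, hk'L, hno, t', _, m', hm', hnext', hkm, hrest⟩ :=
      h'.2.2 k hkb ((hll k hkb.le).1 hkl)
    refine ⟨k', hk'.trans hbb.le, hlt, (hll k' hk').2 hk'L, fun x hx hkx hxl => ?_, t', ?_, m',
      hm'.trans hbb.le, hnext', hkm, hrest⟩
    · exact hno x hx hkx ((hll x (hx.le.trans hk')).1 hxl)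
    · exact hnext'.1.2.1.trans_le (pow2_mono (hm'.trans hbb.le))
  · refine ⟨m + k, le_rfl, hbb, hend, fun x hx hkx hxl => ?_, t, hnext.1.2.1.trans_le (pow2_mono hmb),
      m, hmb, hnext.congr hs's, rfl, hs't, hs'C⟩
    rcases ((hl x).1 hxl).2 with h | h
    · exact absurd hkx (not_lt.2 h.1)
    · exact hx.ne h

/-- The ends of histories are unbounded: a greatest one below a given bound exists by induction for
`Δ₀` formulas, and it has an extension. -/
theorem exists_hist (hW : ISigma 0 {join (jump A) C}) (N : M) :
    ∃ s l b u, N < b ∧ Hist A C s l b u := by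
  obtain ⟨l, hl, h⟩ := exists_code hM.induction (P := fun x => x = 0) inferInstance (N + 1)
  have h0 : (0 : M) ∈ bits l := (h 0).2 ⟨lt_succ_iff.2 zero_le, rfl⟩
  obtain ⟨b, hbN, ⟨s, hs, l, hl, hist⟩, hmax⟩ := Loc.exists_greatest hW
    (P := fun b => ∃ s < pow2 (N + 1), ∃ l < pow2 (N + 1), Hist A C s l b (pow2 N))
    ⟨.of_d0 (inferInstance : Dfn (D0 (join (jump A) C)) fun w =>
      ∃ s < pow2 (N + 1), ∃ l < pow2 (N + 1), Hist A C s l (w 0) (pow2 N)).out⟩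
    ⟨0, pow2_pos _, l, hl, h0, h0, fun l hl => absurd hl (not_lt.2 zero_le)⟩ (zero_le (a := N))
  obtain ⟨s', l', b', hs', hl', hbb, _, hist'⟩ := hist.extend hW
  refine ⟨s', l', b', _, ?_, hist'⟩
  by_contra hb'
  rw [not_lt] at hb'
  refine absurd (hmax b' hb' ⟨s', hs'.trans_le (pow2_mono (hb'.trans (lt_add_one N).le)), l',
    hl'.trans_le (pow2_mono (by gcongr)), hist'.1, hist'.2.1, fun k hk hkl => ?_⟩) (not_le.2 hbb)
  obtain ⟨k', hk', hlt, hkL, hno, t, ht, h⟩ := hist'.2.2 k hk hkl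
  exact ⟨k', hk', hlt, hkL, hno, t, ht.trans_le (pow2_mono hb'), h⟩

/-- The set built by the histories. -/
def histSet (A C : Set M) : Set M :=
  {x | ∃ s l b u, Hist A C s l b u ∧ x < b ∧ x ∈ bits s}

theorem Hist.agree {s l b u : M} (h : Hist A C s l b u) : Agree (bits s) (histSet A C) b := by
  refine fun x hx => ⟨fun hxs => ⟨s, l, b, u, h, hx, hxs⟩, ?_⟩
  rintro ⟨s', l', b', u', h', hx', hxs⟩
  rcases le_total b b' with hb | hb
  · exact (h.compare h' hb x hx).2 hxs
  · exact (h'.compare h hb x hx').1 hxs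

/-- A history with a given number below the beginning of its last block. -/
theorem exists_hist_block (hW : ISigma 0 {join (jump A) C}) (N : M) :
    ∃ s l b u, Hist A C s l b u ∧ ∃ k < b, k ∈ bits l ∧ N < k := by
  obtain ⟨s, l, b, u, hb, h⟩ := exists_hist hW N
  obtain ⟨s', l', b', _, _, hbb, hbl, h'⟩ := h.extend hW
  exact ⟨s', l', b', _, h', b, hbb, hbl, hb⟩

/-- A block of a history decides the jump. -/
theorem Hist.mem_jump_iff (hW : ISigma 0 {join (jump A) C}) {s l b u k e : M}
    (h : Hist A C s l b u) (hk : k < b) (hkl : k ∈ bits l) (he : e < k) :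
    e ∈ jump (join A (histSet A C)) ↔ Conv A e s b := by
  refine ⟨fun hj => ?_, fun hc => hc.mem_jump h.agree⟩
  obtain ⟨_, _, _, _, _, t, _, m, hm, hnext, _, hagree, _⟩ := h.2.2 k hk hkl
  rcases hnext.1.2.2.2 e he with hc | hc
  · exact hc.mono hm hagree.symm
  · obtain ⟨c, hconv⟩ := exists_conv hj
    obtain ⟨s', l', b', u', hb', h'⟩ := exists_hist hW (max b c)
    refine absurd ⟨s', b', hm.trans ((le_max_left b c).trans hb'.le), ?_,
      hconv s' b' ((le_max_right b c).trans_lt hb') h'.agree.symm⟩ hc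
    exact ((h.compare h' ((le_max_left b c).trans hb'.le)).mono hm).symm.trans hagree

/-- To decide whether `e` is in the jump, find a history with a block that begins above `e`. -/
theorem deltaSet_jump_join_histSet (hW : ISigma 0 {join (jump A) C}) :
    DeltaSet 1 (join (jump A) C) (jump (join A (histSet A C))) := by
  have h1 : Dfn (D0 (join (jump A) C)) fun w => Hist A C (w 3) (w 2) (w 1) (w 0) ∧
    (∃ k < w 1, k ∈ bits (w 2) ∧ w 4 < k) ∧ Conv A (w 4) (w 3) (w 1) := inferInstance
  have h2 : Dfn (D0 (join (jump A) C)) fun w => Hist A C (w 3) (w 2) (w 1) (w 0) ∧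
    (∃ k < w 1, k ∈ bits (w 2) ∧ w 4 < k) ∧ ¬ Conv A (w 4) (w 3) (w 1) := inferInstance
  refine D1.deltaSet ⟨?_, ?_⟩
  · convert Sg.ex (.ex (.ex (.ex (.of_d0 h1.out 1)))) using 2 with w
    constructor
    · intro hj
      obtain ⟨s, l, b, u, h, k, hk, hkl, hwk⟩ := exists_hist_block hW (w 0)
      exact ⟨s, l, b, u, h, ⟨k, hk, hkl, hwk⟩, (h.mem_jump_iff hW hk hkl hwk).1 hj⟩
    · rintro ⟨s, l, b, u, h, ⟨k, hk, hkl, hwk⟩, hc⟩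
      exact (h.mem_jump_iff hW hk hkl hwk).2 hc
  · convert Sg.ex (.ex (.ex (.ex (.of_d0 h2.out 1)))) using 2 with w
    constructor
    · intro hj
      obtain ⟨s, l, b, u, h, k, hk, hkl, hwk⟩ := exists_hist_block hW (w 0)
      exact ⟨s, l, b, u, h, ⟨k, hk, hkl, hwk⟩, fun hc => hj ((h.mem_jump_iff hW hk hkl hwk).2 hc)⟩
    · rintro ⟨s, l, b, u, h, ⟨k, hk, hkl, hwk⟩, hc⟩ hj
      exact hc ((h.mem_jump_iff hW hk hkl hwk).1 hj)

theorem regular_jump_join_histSet (hW : ISigma 0 {join (jump A) C}) :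
    Regular (jump (join A (histSet A C))) := by
  intro n
  obtain ⟨s, l, b, u, h, k, hk, hkl, hnk⟩ := exists_hist_block hW n
  have hd : Dfn (D0 (join (jump A) C)) fun w => w 0 < n ∧ Conv A (w 0) s b := inferInstance
  convert mfinite_of_loc hW (P := fun x => x < n ∧ Conv A x s b) ⟨.of_d0 hd.out⟩
    (fun x hx => hx.1) using 2 with x
  funext x
  refine propext ((and_comm).trans (and_congr_right fun hx => ?_))
  exact h.mem_jump_iff hW hk hkl (hx.trans hnk)

/-- The set `C` is decoded from the constructed set with the help of `A'`. -/
theorem mem_iff_exists_chain (hW : ISigma 0 {join (jump A) C})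
    (hJ : ISigma 0 {jump (join A (histSet A C))})
    (hB : D0 (jump (join A (histSet A C))) fun w => w 0 ∈ histSet A C) (x : M) :
    (x ∈ C ↔ ∃ l b u, Chain A (histSet A C) (bits l) b u (fun _ _ => True) ∧
      ∃ k < b, k ∈ bits l ∧ x < k ∧ ∃ t < u, ∃ m ≤ b, Next A (histSet A C) k t m ∧
        m + x ∈ histSet A C) ∧
    (x ∉ C ↔ ∃ l b u, Chain A (histSet A C) (bits l) b u (fun _ _ => True) ∧
      ∃ k < b, k ∈ bits l ∧ x < k ∧ ∃ t < u, ∃ m ≤ b, Next A (histSet A C) k t m ∧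
        m + x ∉ histSet A C) := by
  have hBd : Dfn (Loc (jump (join A (histSet A C)))) fun w => w 0 ∈ histSet A C := ⟨.of_d0 hB⟩
  -- The same pair `(t, m)` occurs in all chains.
  have key (l b u : M) (h : Chain A (histSet A C) (bits l) b u fun _ _ => True) (k : M)
      (hk : k < b) (hkl : k ∈ bits l) (hxk : x < k) (t m : M) (hnext : Next A (histSet A C) k t m) :
      m + x ∈ histSet A C ↔ x ∈ C := by
    obtain ⟨s', l', b', u', hb', h'⟩ := exists_hist hW b
    have h'' := Chain.congr (S' := histSet A C) (T' := fun p x => p ∈ histSet A C ↔ x ∈ C) h'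
      h'.agree fun p hp x hx => (h'.agree p hp).symm.trans hx
    have hL := (h.compare hJ h'' hb'.le fun _ _ _ _ => Iff.rfl).2
    obtain ⟨_, _, _, _, _, t', _, m', _, hnext', _, _, hC⟩ := h''.2.2 k (hk.trans hb')
      ((hL k (hk.trans (lt_add_one b))).1 hkl)
    rw [(hnext.unique hnext').2]
    exact hC x hxk
  have hex : ∃ l b u, Chain A (histSet A C) (bits l) b u (fun _ _ => True) ∧
      ∃ k < b, k ∈ bits l ∧ x < k ∧ ∃ t < u, ∃ m ≤ b, Next A (histSet A C) k t m := by
    obtain ⟨s, l, b, u, h, k, hk, hkl, hxk⟩ := exists_hist_block hW x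
    have h' := Chain.congr (S' := histSet A C) (T' := fun _ _ => True) h h.agree
      fun _ _ _ _ => trivial
    obtain ⟨_, _, _, _, _, t, ht, m, hm, hnext, _⟩ := h'.2.2 k hk hkl
    exact ⟨l, b, u, h', k, hk, hkl, hxk, t, ht, m, hm, hnext⟩
  constructor
  · constructor
    · intro hx
      obtain ⟨l, b, u, h, k, hk, hkl, hxk, t, ht, m, hm, hnext⟩ := hex
      exact ⟨l, b, u, h, k, hk, hkl, hxk, t, ht, m, hm, hnext,
        (key l b u h k hk hkl hxk t m hnext).2 hx⟩
    · rintro ⟨l, b, u, h, k, hk, hkl, hxk, t, _, m, _, hnext, hmx⟩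
      exact (key l b u h k hk hkl hxk t m hnext).1 hmx
  · constructor
    · intro hx
      obtain ⟨l, b, u, h, k, hk, hkl, hxk, t, ht, m, hm, hnext⟩ := hex
      exact ⟨l, b, u, h, k, hk, hkl, hxk, t, ht, m, hm, hnext,
        fun hmx => hx ((key l b u h k hk hkl hxk t m hnext).1 hmx)⟩
    · rintro ⟨l, b, u, h, k, hk, hkl, hxk, t, _, m, _, hnext, hmx⟩ hx
      exact hmx ((key l b u h k hk hkl hxk t m hnext).2 hx)

set_option synthInstance.maxHeartbeats 400000 in
set_option synthInstance.maxSize 2000 in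
/-- The search of `mem_iff_exists_chain` succeeds for elements and for non-elements of `C`. -/
theorem d1_coded (hW : ISigma 0 {join (jump A) C})
    (hJ : ISigma 0 {jump (join A (histSet A C))}) :
    D1 (jump (join A (histSet A C))) fun w => w 0 ∈ C := by
  have : Fact (ISigma 0 {jump (join A (histSet A C))}) := ⟨hJ⟩
  have hAJ : HasSigma A (D0 (jump (join A (histSet A C)))) :=
    ⟨fun h => (h.of_d0_param (d0_join_left A _)).d0_jump hJ.of_jump⟩
  have := hAJ.hasPow
  have hB : D0 (jump (join A (histSet A C))) fun w => w 0 ∈ histSet A C :=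
    (Sg.of_d0 (d0_join_right A _) 1).d0_jump hJ.of_jump
  have hBt (t : (ℕ → M) → M) [ht : IsTerm t] :
      Dfn (D0 (jump (join A (histSet A C)))) fun w => t w ∈ histSet A C :=
    ⟨hB.subst (s := fun _ => t) fun _ => ht⟩
  have : DfnFamily (D0 (jump (join A (histSet A C)))) fun _ => histSet A C :=
    ⟨fun s _ _ _ => (hBt s).out⟩
  have hN (k t m : (ℕ → M) → M) [IsTerm k] [IsTerm t] [IsTerm m] :
      Dfn (D0 (jump (join A (histSet A C)))) fun w => Next A (histSet A C) (k w) (t w) (m w) :=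
    instDfnNext (O := fun _ => histSet A C) (p := fun _ => 0)
  have hch : Dfn (D0 (jump (join A (histSet A C)))) fun w =>
      Chain A (histSet A C) (bits (w 2)) (w 1) (w 0) fun _ _ => True := by
    simp only [Chain, Agree, implies_true, and_true]
    infer_instance
  have h1 : Dfn (D0 (jump (join A (histSet A C)))) fun w =>
    Chain A (histSet A C) (bits (w 2)) (w 1) (w 0) (fun _ _ => True) ∧
      ∃ k < w 1, k ∈ bits (w 2) ∧ w 3 < k ∧ ∃ t < w 0, ∃ m ≤ w 1, Next A (histSet A C) k t m ∧
        m + w 3 ∈ histSet A C := inferInstance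
  have h2 : Dfn (D0 (jump (join A (histSet A C)))) fun w =>
    Chain A (histSet A C) (bits (w 2)) (w 1) (w 0) (fun _ _ => True) ∧
      ∃ k < w 1, k ∈ bits (w 2) ∧ w 3 < k ∧ ∃ t < w 0, ∃ m ≤ w 1, Next A (histSet A C) k t m ∧
        ¬ m + w 3 ∈ histSet A C := inferInstance
  constructor
  · convert Sg.ex (.ex (.ex (.of_d0 h1.out 1))) using 2 with w
    exact (mem_iff_exists_chain hW hJ hB (w 0)).1
  · convert Sg.ex (.ex (.ex (.of_d0 h2.out 1))) using 2 with w
    exact (mem_iff_exists_chain hW hJ hB (w 0)).2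

end

theorem D1.join {Z A B : Set M} (hA : D1 Z fun w => w 0 ∈ A) (hB : D1 Z fun w => w 0 ∈ B) :
    DeltaSet 1 Z (join A B) := by
  have hA1 := hA.1.subst (s := fun _ w => w 0) fun _ => .var 0
  have hA2 := hA.2.subst (s := fun _ w => w 0) fun _ => .var 0
  have hB1 := hB.1.subst (s := fun _ w => w 0) fun _ => .var 0
  have hB2 := hB.2.subst (s := fun _ w => w 0) fun _ => .var 0
  have h0 : Sg Z 1 fun w => w 1 = 2 * w 0 :=
    .of_d0 (inferInstance : Dfn (D0 Z) fun w => w 1 = 2 * w 0).out 1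
  have h1 : Sg Z 1 fun w => w 1 = 2 * w 0 + 1 :=
    .of_d0 (inferInstance : Dfn (D0 Z) fun w => w 1 = 2 * w 0 + 1).out 1
  refine D1.deltaSet ⟨?_, ?_⟩
  · exact .or (.ex (hA1.and h0)) (.ex (hB1.and h1))
  · have h := Sg.or (.ex (hA2.and h0)) (.ex (hB2.and h1))
    convert h using 2 with w
    obtain ⟨q, r, hr, hw⟩ := exists_div hM.induction (w 0) (two_pos (α := M))
    constructor
    · intro hn
      rcases lt_succ_iff.1 ((one_add_one_eq_two (R := M)).symm ▸ hr) |>.lt_or_eq with h0 | rfl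
      · obtain rfl := nonpos_iff_eq_zero.1 (lt_succ_iff.1 ((zero_add (1 : M)).symm ▸ h0))
        rw [add_zero, mul_comm] at hw
        exact Or.inl ⟨q, fun hq => hn (by
          change w 0 ∈ _
          rw [hw]
          exact two_mul_mem_join.2 hq), hw⟩
      · rw [mul_comm] at hw
        exact Or.inr ⟨q, fun hq => hn (by
          change w 0 ∈ _
          rw [hw]
          exact two_mul_add_one_mem_join.2 hq), hw⟩
    · rintro (⟨q, hq, hw⟩ | ⟨q, hq, hw⟩) hn
      · rw [show w 0 = 2 * q from hw, two_mul_mem_join] at hn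
        exact hq hn
      · rw [show w 0 = 2 * q + 1 from hw, two_mul_add_one_mem_join] at hn
        exact hq hn

/-- Jump inversion: the set built by the histories has, joined with `A`, a jump that is equivalent to
`A' ⊕ C`. -/
theorem exists_jump_inversion {A C : Set M} (hW : ISigma 0 {join (jump A) C}) :
    ∃ B, DeltaSet 1 (jump (join A B)) (join (jump A) C) ∧
      DeltaSet 1 (join (jump A) C) (jump (join A B)) ∧ Regular (jump (join A B)) := by
  have hA' : Fact (ISigma 0 {jump A}) := ⟨hW.zero_of_d0 (d0_join_left _ _)⟩
  have hA : Fact (ISigma 1 {A}) := ⟨hA'.out.one_of_jump⟩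
  have hreg := regular_jump_join_histSet hW
  refine ⟨histSet A C, ?_, deltaSet_jump_join_histSet hW, hreg⟩
  refine D1.join (.of_d0 ?_) (d1_coded hW hreg.iSigma)
  exact d0_jump_of_deltaSet hreg.iSigma (deltaSet_of_d0 (d0_join_left _ _))

end

/-! ### Exponentiation from `Σ₁` induction -/

section

variable {M : Type u} [CommSemiring M] [LinearOrder M] [PeanoMinus M]

theorem exists_common_multiple (hM : ISigma 1 {(∅ : Set M)}) (n : M) :
    ∃ d, 0 < d ∧ ∀ i ≤ n, 0 < i → ∃ e ≤ d, d = i * e := by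
  have hd : Dfn (D0 (∅ : Set M)) fun w => 0 < w 0 ∧ ∀ i ≤ w 1, 0 < i → ∃ e ≤ w 0, w 0 = i * e :=
    inferInstance
  refine Sg.induction hM (P := fun n => ∃ d, 0 < d ∧ ∀ i ≤ n, 0 < i → ∃ e ≤ d, d = i * e)
    ⟨.ex (.of_d0 hd.out 1)⟩ ⟨1, one_pos, fun i hi h => absurd hi h.not_ge⟩ ?_ n
  rintro n ⟨d, hd, h⟩
  refine ⟨d * (n + 1), mul_pos hd (by positivity), fun i hi hi0 => ?_⟩
  rcases hi.lt_or_eq with hi | rfl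
  · obtain ⟨e, he, rfl⟩ := h i (lt_succ_iff.1 hi) hi0
    exact ⟨e * (n + 1), mul_le_mul_left he _, mul_assoc _ _ _⟩
  · exact ⟨d, self_le_mul_of_pos hi0, mul_comm _ _⟩

/-- The moduli of the beta function are coprime, explicitly. -/
theorem exists_inverse_modulus {d j l e : M} (hjl : j < l) (hd : 0 < d)
    (he : ∀ i, l = j + i → d = i * e) :
    ∃ b, ((l + 1) ^ 2 * e) ^ 2 * (1 + (j + 1) * d) * (1 + (j + 1) * d)
      = b * (1 + (l + 1) * d) + 1 := by
  obtain ⟨i, rfl⟩ := exists_add_of_le hjl.le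
  obtain rfl := he i rfl
  have he0 : 0 < e := pos_of_mul_pos_right hd zero_le
  have hz : 0 < (j + i + 1) ^ 2 * e * (1 + (j + 1) * (i * e)) := by positivity
  obtain ⟨z, hz⟩ := exists_add_of_le (PeanoMinus.one_le_of_pos _ hz)
  -- With `X = (l + 1)² e` and `m` the moduli, `X mⱼ ≡ -1` modulo `mₗ`; here `X mⱼ = 1 + z`.
  have hm : (j + i + 1) ^ 2 * e * (1 + (j + 1) * (i * e)) + 1 =
      (1 + (j + i + 1) * e * (j + 1)) * (1 + (j + i + 1) * (i * e)) := by ring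
  refine ⟨z * (1 + (j + i + 1) * e * (j + 1)), ?_⟩
  calc _ = ((j + i + 1) ^ 2 * e * (1 + (j + 1) * (i * e))) ^ 2 := by ring
    _ = z * ((j + i + 1) ^ 2 * e * (1 + (j + 1) * (i * e)) + 1) + 1 := by rw [hz]; ring
    _ = _ := by rw [hm]; ring

set_option synthInstance.maxHeartbeats 400000 in
set_option synthInstance.maxSize 2000 in
/-- A sequence coded by the beta function may be prolonged by one entry. This is the Chinese remainder
theorem: the new `d'` is divisible by all differences of indices, which makes the moduli coprime,
and exceeds all entries. -/
theorem exists_append (hM : ISigma 1 {(∅ : Set M)}) (c d k v : M) :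
    ∃ c' d', (∀ i < k, ∀ u, Beta c d i u → Beta c' d' i u) ∧ Beta c' d' k v := by
  have hM0 : ISigma 0 {(∅ : Set M)} := hM.zero_of_one
  obtain ⟨d₀, hd₀, hdiv⟩ := exists_common_multiple hM k
  obtain ⟨D, hD⟩ : ∃ D, D = d₀ * (c + v + 1) := ⟨_, rfl⟩
  have hcv : c + v + 1 ≤ D := by
    rw [hD, mul_comm]
    exact self_le_mul_of_pos hd₀
  have hD0 : 0 < D := (by positivity : 0 < c + v + 1).trans_le hcv
  have hDdiv (i : M) (hi : i ≤ k) (hi0 : 0 < i) : ∃ e, D = i * e := by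
    obtain ⟨e, -, he⟩ := hdiv i hi hi0
    exact ⟨e * (c + v + 1), by rw [hD, he, mul_assoc]⟩
  have hDd : Dfn (D0 (∅ : Set M)) fun w => w 3 ≤ k + 1 →
    (∀ i < w 3, ∃ u < D, ((i < k ∧ Beta c d i u) ∨ (i = k ∧ u = v)) ∧ Beta (w 2) D i u) ∧
    (∀ i < w 3, ∃ s ≤ w 1, w 1 = s * (1 + (i + 1) * D)) ∧
    ∀ l ≤ k, w 3 ≤ l → ∃ a ≤ w 0, ∃ b ≤ a * w 1, a * w 1 = b * (1 + (l + 1) * D) + 1 :=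
      inferInstance
  -- `c'` has the entries below `j`, `P` is the product of the moduli below `j`, and `b` bounds
  -- the inverses of `P` modulo the remaining moduli.
  have key := Sg.induction hM (P := fun j => j ≤ k + 1 → ∃ c' P b,
    (∀ i < j, ∃ u < D, ((i < k ∧ Beta c d i u) ∨ (i = k ∧ u = v)) ∧ Beta c' D i u) ∧
    (∀ i < j, ∃ s ≤ P, P = s * (1 + (i + 1) * D)) ∧
    ∀ l ≤ k, j ≤ l → ∃ a ≤ b, ∃ b' ≤ a * P, a * P = b' * (1 + (l + 1) * D) + 1)
    (by
      refine Dfn.congr ⟨.ex (.ex (.ex (.of_d0 hDd.out 1)))⟩ fun w => ⟨fun h => ?_, ?_⟩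
      · by_cases hw : w 0 ≤ k + 1
        · obtain ⟨c', P, b, h⟩ := h hw
          exact ⟨c', P, b, fun _ => h⟩
        · exact ⟨0, 0, 0, fun h' => absurd h' hw⟩
      · rintro ⟨c', P, b, h⟩ hw
        exact ⟨c', P, b, h hw⟩)
    (fun _ => ⟨0, 1, 2 + (k + 1) * D, fun i hi => absurd hi not_lt_zero,
      fun i hi => absurd hi not_lt_zero, fun l hl _ =>
        ⟨2 + (l + 1) * D, by gcongr, 1, one_le_two.trans (le_self_add.trans_eq (mul_one _).symm), by ring⟩⟩) (by
      rintro j hj hjk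
      obtain ⟨c', P, b, hc', hP, hb⟩ := hj ((le_add_of_nonneg_right zero_le).trans hjk)
      have hjk : j ≤ k := le_of_add_le_add_right hjk
      set m := 1 + (j + 1) * D with hm
      have hm0 : 0 < m := by positivity
      have hDm : D < m := by
        rw [hm, add_comm, lt_succ_iff, mul_comm]
        exact self_le_mul_of_pos (by positivity)
      obtain ⟨u, huD, hu⟩ : ∃ u < D, (j < k ∧ Beta c d j u) ∨ (j = k ∧ u = v) := by
        rcases hjk.lt_or_eq with hjk | rfl
        · obtain ⟨q, r, hr, hq⟩ := exists_div hM0 c (b := 1 + (j + 1) * d) (by positivity)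
          have hb : Beta c d j r := ⟨hr, q, hq⟩
          refine ⟨r, ?_, Or.inl ⟨hjk, hb⟩⟩
          refine (lt_succ_iff.2 (hb.le.trans ?_)).trans_le hcv
          exact le_self_add
        · exact ⟨v, (lt_succ_iff.2 le_add_self).trans_le hcv, Or.inr ⟨rfl, rfl⟩⟩
      obtain ⟨a, _, b', _, hab⟩ := hb j hjk le_rfl
      obtain ⟨q, r, hr, hq⟩ := exists_div hM0 c' hm0
      obtain ⟨r', hr'⟩ := exists_add_of_le hr.le
      refine ⟨c' + P * (a * (u + r')), P * m, b * ((k + 1) ^ 2 * D) ^ 2 * (1 + (k + 1) * D) , ?_, ?_, ?_⟩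
      · intro i hi
        rcases (lt_succ_iff.1 hi).lt_or_eq with hi | rfl
        · obtain ⟨u', hu', hT, hlt, q', hq'⟩ := hc' i hi
          obtain ⟨s, _, hs⟩ := hP i hi
          refine ⟨u', hu', hT, hlt, q' + s * (a * (u + r')), ?_⟩
          rw [hq', hs]
          ring
        · refine ⟨u, huD, hu, huD.trans hDm, q + 1 + b' * (u + r'), ?_⟩
          rw [← hm]
          calc c' + P * (a * (u + r')) = q * m + r + a * P * (u + r') := by rw [hq]; ring
            _ = q * m + u + (r + r') + b' * m * (u + r') := by rw [hab]; ring
            _ = _ := by rw [← hr']; ring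
      · intro i hi
        rcases (lt_succ_iff.1 hi).lt_or_eq with hi | rfl
        · obtain ⟨s, hsP, hs⟩ := hP i hi
          refine ⟨s * m, mul_le_mul_left hsP _, ?_⟩
          rw [mul_right_comm, ← hs]
        · exact ⟨P, self_le_mul_of_pos hm0, rfl⟩
      · intro l hl hjl
        have hjl : j < l := (lt_add_one j).trans_le hjl
        obtain ⟨a', ha', b'', _, hab'⟩ := hb l hl hjl.le
        obtain ⟨i, hi⟩ := exists_add_of_le hjl.le
        have hi0 : 0 < i := pos_of_ne_zero (by
          rintro rfl
          exact hjl.ne' (by rw [hi, add_zero]))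
        obtain ⟨e, he⟩ := hDdiv i (le_trans (hi ▸ le_add_self) hl) hi0
        obtain ⟨b₃, hb₃⟩ := exists_inverse_modulus (e := e) hjl hD0 fun i' hi' => by
          rw [he, add_left_cancel (hi.symm.trans hi')]
        have heD : e ≤ D := by
          rw [he, mul_comm]
          exact self_le_mul_of_pos hi0
        have heq : a' * (((l + 1) ^ 2 * e) ^ 2 * m) * (P * m) =
            (b'' * (b₃ * (1 + (l + 1) * D) + 1) + b₃) * (1 + (l + 1) * D) + 1 := by
          calc _ = (a' * P) * (((l + 1) ^ 2 * e) ^ 2 * m * m) := by ring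
            _ = _ := by rw [hab', hb₃]; ring
        refine ⟨_, ?_, _, ?_, heq⟩
        · rw [mul_assoc]
          have hmk : m ≤ 1 + (k + 1) * D := by
            rw [hm]
            gcongr
          gcongr
        · rw [heq]
          exact (self_le_mul_of_pos (by positivity)).trans le_self_add) (k + 1) le_rfl
  obtain ⟨c', P, b, h, -⟩ := key
  refine ⟨c', D, fun i hi u hu => ?_, ?_⟩
  · obtain ⟨u', _, ⟨_, hu'⟩ | ⟨rfl, _⟩, h'⟩ := h i (hi.trans (lt_add_one k))
    · rwa [hu.unique hu']
    · exact absurd hi (lt_irrefl _)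
  · obtain ⟨u', _, ⟨hk, _⟩ | ⟨_, rfl⟩, h'⟩ := h k (lt_add_one k)
    · exact absurd hk (lt_irrefl _)
    · exact h'

/-- Exponentiation is total: the sequence of powers of `2` can always be prolonged. -/
theorem ISigma.exp (hM : ISigma 1 {(∅ : Set M)}) : Exp M := by
  have h : Dfn (D0 (∅ : Set M)) fun w =>
    PowSeq (w 2) (w 1) (w 3) ∧ Beta (w 2) (w 1) (w 3) (w 0) := inferInstance
  have hd : Dfn (Sg (∅ : Set M) 1) fun w => ∃ p, IsPow2 (w 0) p := by
    refine Dfn.congr ⟨.ex (.ex (.ex (.of_d0 h.out 1)))⟩ fun w => ?_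
    simp only [isPow2_iff_powSeq]
    rw [exists_comm]
    refine exists_congr fun c => ?_
    rw [exists_comm]
    rfl
  refine Sg.induction hM hd ?_ ?_
  · refine ⟨1, 1, 1, ?_, fun i hi => absurd hi not_lt_zero, ?_⟩ <;>
    exact ⟨by norm_num, 0, by norm_num⟩
  · rintro x ⟨p, c, d, h0, hs, hp⟩
    obtain ⟨c', d', h, h'⟩ := exists_append hM c d (x + 1) (2 * p)
    refine ⟨2 * p, c', d', h 0 (by positivity) 1 h0, fun i hi => ?_, h'⟩
    rcases (lt_succ_iff.1 hi).lt_or_eq with hi' | rfl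
    · obtain ⟨v, hv, hv'⟩ := hs i hi'
      exact ⟨v, h i hi v hv, h (i + 1) (by gcongr) _ hv'⟩
    · exact ⟨p, h _ hi p hp, h'⟩

end

/-! ### Iterated jumps and the extensions `M[X]` -/

section

variable {M : Type u} [CommSemiring M] [LinearOrder M] [PeanoMinus M]

section

variable [hM : Elementary M]

theorem Ext.deltaSet {X Y : Set M} (hX : ISigma 1 {X}) (hY : Ext X Y) : DeltaSet 1 X Y := by
  induction hY with
  | base => exact deltaSet_of_d0 (.mem (.var 0))
  | join _ _ h h' => exact D1.join (h.d1 _ (.var 0)) (h'.d1 _ (.var 0))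
  | comprehension _ hZ h => exact h.trans hX hZ

theorem ISigma.one_of_iterate_jump {X : Set M} {n : ℕ} (h : ISigma 0 {jump^[n + 1] X}) :
    ISigma 1 {X} := by
  induction n with
  | zero => exact h.one_of_jump
  | succ n ih =>
    rw [Function.iterate_succ_apply'] at h
    exact ih h.of_jump

theorem d0_iterate_jump_of_deltaSet {X Y : Set M} {n : ℕ} (hX : ISigma 0 {jump^[n + 1] X})
    (hY : DeltaSet 1 X Y) : D0 (jump^[n + 1] X) fun w => w 0 ∈ jump^[n + 1] Y := by
  induction n with
  | zero => exact d0_jump_of_deltaSet hX hY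
  | succ n ih =>
    simp only [Function.iterate_succ_apply' _ (n + 1)] at hX ⊢
    exact d0_jump_of_deltaSet hX (deltaSet_of_d0 (ih hX.of_jump))

/-- Post's theorem for the iterated jump. -/
theorem Sg.iterate_jump {Y : Set M} {n m : ℕ} (hY : ISigma 0 {RevRec.jump^[n] Y})
    {P : (ℕ → M) → Prop} (hP : Sg Y (m + n) P) : Sg (RevRec.jump^[n] Y) m P := by
  induction n generalizing m with
  | zero => exact hP
  | succ n ih =>
    rw [Function.iterate_succ_apply'] at hY ⊢
    exact (ih hY.of_jump (m := m + 1) (by rwa [add_right_comm])).jump hY.of_jump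

/-- The relations that are `Σ` in a member of `M[X]` are `Σ`, with `n` quantifiers fewer, in the
`n`-th jump of `X`. -/
theorem Ext.sg_iterate_jump {X Y : Set M} {n m : ℕ} (hX : ISigma 0 {jump^[n + 1] X})
    (hY : Ext X Y) {P : (ℕ → M) → Prop} (hP : Sg Y (m + (n + 1)) P) :
    Sg (jump^[n + 1] X) m P := by
  have hYX := d0_iterate_jump_of_deltaSet hX (hY.deltaSet hX.one_of_iterate_jump)
  exact (hP.iterate_jump (hX.zero_of_d0 hYX)).of_d0_param hYX

theorem Ext.d0_iterate_jump {X Y D : Set M} {n : ℕ} (hX : ISigma 0 {jump^[n + 1] X})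
    (hY : Ext X Y) (hD : SigmaSet (n + 1) Y D) : D0 (jump^[n + 1] X) fun w => w 0 ∈ D := by
  cases hY.sg_iterate_jump (m := 0) hX (by simpa using sigmaSet_iff.1 hD) with
  | delta0 h => exact h

theorem iSigma_ext {X : Set M} {n : ℕ} (hX : ISigma 0 {jump^[n + 1] X}) :
    ISigma (n + 1) (Ext X) := fun _ hY _ hD =>
  hX _ rfl _ (sigmaSet_iff.2 (.delta0 (Ext.d0_iterate_jump hX hY hD)))

theorem sigmaRegular_ext {X : Set M} {n : ℕ} (hX : ISigma 0 {jump^[n + 1] X}) :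
    SigmaRegular (n + 1) (Ext X) := fun _ hY _ hD =>
  .of_loc hX ⟨.of_d0 (Ext.d0_iterate_jump hX hY hD)⟩

/-- Bounding for the relations that are `Σ` in `X` follows from bounding in any `M[W]` to which
the `n`-th jump of `X` belongs. -/
theorem bSigma_ext {X W : Set M} {n : ℕ} (hX : ISigma 0 {jump^[n + 1] X})
    (hXW : DeltaSet 1 W (jump^[n + 1] X)) (hW : BSigma 1 (Ext W)) :
    BSigma (n + 1 + 1) (Ext X) := by
  constructor
  · intro Y hY D hD
    rw [sigmaSet_iff] at hD
    cases hD with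
    | delta0 hD => exact iSigma_ext hX Y hY D (sigmaSet_iff.2 (.of_d0 hD _))
  · intro Y hY R hR
    refine hW.2 _ (.comprehension .base hXW) R (Sg.sigmaRel ?_)
    refine hY.sg_iterate_jump hX ?_
    rw [add_comm]
    exact .of_sigmaRel hR

/-- Iterated jump inversion: invert the outermost jump first, relative to the lower jumps of `A`, and
take the set obtained there as the new target for one jump less. -/
theorem exists_iterate_jump_inversion {A C : Set M} {n : ℕ}
    (hW : ISigma 0 {join (jump^[n] A) C}) :
    ∃ B, DeltaSet 1 (jump^[n] (join A B)) (join (jump^[n] A) C) ∧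
      DeltaSet 1 (join (jump^[n] A) C) (jump^[n] (join A B)) ∧
      ISigma 0 {jump^[n] (join A B)} := by
  induction n generalizing C with
  | zero =>
    have h : DeltaSet 1 (join A C) (join A C) := deltaSet_of_d0 (.mem (.var 0))
    exact ⟨C, h, h, hW⟩
  | succ n ih =>
    simp only [Function.iterate_succ_apply'] at hW ⊢
    obtain ⟨D, hZW, hWZ, hZ⟩ := exists_jump_inversion hW
    obtain ⟨B, hXZ, hZX, hX⟩ := ih hZ.iSigma.of_jump
    -- The reduction of the jumps is a polynomial, so it yields `Δ₀` induction relative to the jump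
    -- of `(A ⊕ B)⁽ⁿ⁾`.
    obtain ⟨t, ht, hiff⟩ := exists_jump_iff hZ.iSigma hZX
    have hX' : ISigma 0 {jump (jump^[n] (join A B))} := hZ.iSigma.zero_of_d0 (by
      simp only [hiff]
      exact .mem ht)
    refine ⟨B, hZW.of_d0_param (d0_jump_of_deltaSet hX' hXZ), D1.deltaSet ?_, hX'⟩
    have h := hWZ.d1 t ht
    simpa only [D1, ← hiff] using h

end

end

end RevRec

open RevRec in
theorem lemma2p6 {M : Type*} [CommSemiring M] [LinearOrder M] [PeanoMinus M] :
    (∀ A C : Set M, ISigma 1 {(∅ : Set M)} → Regular (join (jump A) C) →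
      ∃ B : Set M,
        DeltaSet 1 (jump (join A B)) (join (jump A) C) ∧
        DeltaSet 1 (join (jump A) C) (jump (join A B)) ∧
        Regular (jump (join A B)) ∧
        ISigma 1 (Ext (join A B)) ∧ SigmaRegular 1 (Ext (join A B)) ∧
        (BSigma 1 (Ext (join (jump A) C)) → BSigma 2 (Ext (join A B)))) ∧
    (∀ n : ℕ, 1 ≤ n → ∀ A C : Set M, Exp M →
      (ISigma 0 {join (jump^[n] A) C} →
        ∃ B : Set M,
          DeltaSet n (jump^[n] (join A B)) (join (jump^[n] A) C) ∧
          DeltaSet n (join (jump^[n] A) C) (jump^[n] (join A B)) ∧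
          ISigma n (Ext (join A B)) ∧ SigmaRegular n (Ext (join A B))) ∧
      (BSigma 1 (Ext (join (jump^[n] A) C)) →
        ∃ B : Set M,
          DeltaSet n (jump^[n] (join A B)) (join (jump^[n] A) C) ∧
          DeltaSet n (join (jump^[n] A) C) (jump^[n] (join A B)) ∧
          BSigma (n + 1) (Ext (join A B)))) := by
  constructor
  · intro A C hM hreg
    have : Elementary M := ⟨hM.exp, hM.zero_of_one⟩
    obtain ⟨B, h1, h2, h3⟩ := exists_jump_inversion hreg.iSigma
    have hX : ISigma 0 {jump^[0 + 1] (join A B)} := h3.iSigma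
    exact ⟨B, h1, h2, h3, iSigma_ext hX, sigmaRegular_ext hX, bSigma_ext hX h2⟩
  · rintro n hn A C hexp
    obtain ⟨n, rfl⟩ := Nat.exists_eq_add_one.2 hn
    constructor
    · intro hW
      have : Elementary M := ⟨hexp, hW.zero_empty⟩
      obtain ⟨B, h1, h2, hX⟩ := exists_iterate_jump_inversion hW
      exact ⟨B, h1.of_one, h2.of_one, iSigma_ext hX, sigmaRegular_ext hX⟩
    · intro hB
      have hW : ISigma 0 {join (jump^[n + 1] A) C} := by
        rintro _ rfl
        exact hB.1 _ .base
      have : Elementary M := ⟨hexp, hW.zero_empty⟩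
      obtain ⟨B, h1, h2, hX⟩ := exists_iterate_jump_inversion hW
      exact ⟨B, h1.of_one, h2.of_one, bSigma_ext hX h2 hB⟩
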